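/- **Setting.** Let $M$ be a smooth manifold, let $\pi:Z\to M$ and $\hat\pi:\hat Z\to M$ be principal circle bundles, and let $v,\hat v$ be the period-one generators of the circle actions. All functions, vector fields and forms are complex-valued. Let $A,\hat A$ be connection one-forms (invariant, with $A(v)=1$, $\hat A(\hat v)=1$; real ones are a special case), with curvatures $dA=\pi^*F$ and $d\hat A=\hat\pi^*\hat F$. Let $H,\hat H$ be closed three-forms with $$H=\pi^*\Omega+A\wedge\pi^*\hat F,\qquad \hat H=\hat\pi^*\Omega+\hat A\wedge\hat\pi^*F ,$$ where $\Omega$ is a three-form on $M$ (so $(Z,A,H)$ and $(\hat Z,\hat A,\hat H)$ are T-dual). On $\Gamma(Z,TZ\oplus T^*Z)$ use the pairing $\langle x+\alpha,y+\beta\rangle=\alpha(y)+\beta(x)$, the anchor $\rho(x+\alpha)=x$ and the bracket $[x+\alpha,y+\beta]_H=[x,y]+\mathcal L_x\beta-\iota_yd\alpha+\iota_x\iota_yH$. Sections of weight $-n$ are those with $\mathcal L_va=-2\pi i n\,a$. Let $L=Z\times_{S^1}\mathbb C$ be the complex line bundle associated to $Z$, with the connection $\nabla$ induced by $A$. A section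 of $W\otimes L^{\otimes n}$ over $M$ is regarded as a section of $\pi^*W$ over $Z$ with $u(tz)=t^{-n}u(z)$ for $t\in S^1$; locally $s_\alpha^{\otimes n}$ is $e^{-2\pi i n\theta_\alpha}$. Put $E_n=(TM\oplus\mathbb 1\oplus T^*M\oplus\mathbb 1)\otimes L^{\otimes n}$. Sections of $\bigoplus_nL^{\otimes n}$ and of $\hat{\mathcal E}=\bigoplus_nE_n$ over $M$ are the sequences $(s_n)_{n\in\mathbb Z}$ of smooth sections which are rapidly decreasing in $n$, together with all derivatives, uniformly on compact sets (the Fréchet completion of the algebraic direct sum). The exotic Courant algebroid of the dual pair $(\hat Z,\hat H)$ is $\hat{\mathcal E}$, where $(X,f,\xi,g)\in\Gamma(E_n)$ stands for the invariant section $X+f\hat v+\xi+g\hat A$ of $(T\hat Z\oplus T^*\hat Z)\otimes\hat\pi^*L^{\otimes n}$, with the following structures on weight spaces, extended by $c_p=\sum_n(\cdot)(s_n,t_{p-n})$: * the pairing $\langle(X,f,\xi,g),(Y,k,\eta,l)\rangle=\eta(X)+\xi(Y)+gk+fl\in\Gamma(L^{\otimes(n+m)})$; * the bracket $[a,b]_{\hat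 H}=[[\mathcal D,a],b]$, the derived bracket (graded commutators of operators) of $\mathcal D=-(\nabla-2\pi i p\,\iota_{\hat v}+\hat H\wedge)$ acting on the invariant forms on $\hat Z$ with values in $\hat\pi^*L^{\otimes p}$, $p\in\mathbb Z$, where $a,b$ act by Clifford multiplication (contraction plus exterior product); * the operator $\hat D_nh=-(\nabla h-2\pi i n\,h\,\hat v)$ on $h\in\Gamma(L^{\otimes n})$, and the anchor $\hat\rho$ given, as an action on $\bigoplus_m\Gamma(L^{\otimes m})$, by $\hat\rho(a)h=\langle a,\hat Dh\rangle$. Let $\phi''$ send $h\in C^\infty(Z)$ to its weight components, $\phi''(h)_n(z)=\int_0^1h(e^{2\pi it}z)e^{2\pi int}dt\in\Gamma(L^{\otimes n})$. Let $\phi'$ send $a\in\Gamma(Z,TZ\oplus T^*Z)$ to the sequence of the $(X_n,f_n,\xi_n,g_n)\in\Gamma(E_n)$, where $a=\sum_na_n$ is the Fourier expansion into sections of weight $-n$ and $a_n=X_n+f_nv+\xi_n+g_nA$ (with $X_n$ lifted horizontally and $\xi_n$ pulled back). Let $\varphi(X,f,\xi,g)=-(X,g,\xi,f)$ on each weight space,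 and put $\mu=\varphi\circ\phi'$. **Theorem (T-duality of exotic Courant algebroids).** The maps $$\phi'':C^\infty(Z)\to\Gamma\Big(M,\bigoplus_nL^{\otimes n}\Big),\qquad \phi',\ \mu:\Gamma(Z,TZ\oplus T^*Z)\to\Gamma(M,\hat{\mathcal E})$$ are well-defined linear bijections. For each $n$, $\mu$ sends $X+fv+\xi+gA$, with $(X,f,\xi,g)\in\Gamma(E_n)$, to $-(X,g,\xi,f)$ in weight $n$ and $0$ in all other weights; a section has weight $-n$ if and only if its image is concentrated in weight $n$. The bracket, pairing and anchor of $\hat{\mathcal E}$ are well-defined on the completed sums, and $\mu$ is an isomorphism of exotic Courant algebroid structures: for all sections $a,b$ of $TZ\oplus T^*Z$ and all $h\in C^\infty(Z)$, $$[\mu(a),\mu(b)]_{\hat H}=\mu([a,b]_H),\quad \langle\mu(a),\mu(b)\rangle=\phi''(\langle a,b\rangle),\quad \hat\rho(\mu(a))\,\phi''(h)=\phi''(\rho(a)h),\quad \mu(dh)=\hat D\,\phi''(h).$$ On invariant sections, $\mu$ is, up to sign, the complexified Cavalcanti–Gualtieri T-duality isomorphism $\chi:\Gamma(TZ\oplus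 T^*Z)^{S^1}\to\Gamma(T\hat Z\oplus T^*\hat Z)^{\hat S^1}$, $X+fv+\xi+gA\mapsto X+g\hat v+\xi+f\hat A$ (with $X,f,\xi,g$ on $M$): identifying $\Gamma(E_0)$ with $\Gamma(T\hat Z\oplus T^*\hat Z)^{\hat S^1}$ by $(X,f,\xi,g)\mapsto X+f\hat v+\xi+g\hat A$, one has $\mu(a)=-\chi(a)$ for every invariant $a$. -/

import Mathlib

open scoped Manifold ContDiff

noncomputable section

namespace ExoticTDuality

/-! ### Smooth functions, vector fields and forms

All function spaces are complex.  Vector fields are derivations of the algebra of smooth functions,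
`k`-forms are alternating `k`-linear maps (over smooth functions) from vector fields to functions. -/

section Basic

variable (E : Type*) [NormedAddCommGroup E] [NormedSpace ℝ E]
  (N : Type*) [TopologicalSpace N] [ChartedSpace E N]

/-- The `ℂ`-algebra `C^∞(N, ℂ)` of a manifold `N` modelled on `E`. -/
def smoothSubalgebra : Subalgebra ℂ (N → ℂ) where
  carrier := {h | ContMDiff 𝓘(ℝ, E) 𝓘(ℝ, ℂ) ∞ h}
  mul_mem' {a b} ha hb :=
    ((contDiff_mul (𝕜 := ℝ) (𝔸 := ℂ) (n := ∞)).contMDiff.comp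
      (ContMDiff.prodMk_space ha hb) : ContMDiff 𝓘(ℝ, E) 𝓘(ℝ, ℂ) ∞ fun x => a x * b x)
  add_mem' ha hb := ha.add hb
  algebraMap_mem' _ := contMDiff_const

/-- Smooth complex-valued functions on `N`. -/
def SmoothFun := ↥(smoothSubalgebra E N)

instance : CommRing (SmoothFun E N) := inferInstanceAs (CommRing ↥(smoothSubalgebra E N))

instance : Algebra ℂ (SmoothFun E N) := inferInstanceAs (Algebra ℂ ↥(smoothSubalgebra E N))

instance : FunLike (SmoothFun E N) N ℂ where
  coe h := h.1
  coe_injective _ _ h := Subtype.ext h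

theorem SmoothFun.smooth {E N : Type*} [NormedAddCommGroup E] [NormedSpace ℝ E]
    [TopologicalSpace N] [ChartedSpace E N] (h : SmoothFun E N) :
    ContMDiff 𝓘(ℝ, E) 𝓘(ℝ, ℂ) ∞ h := h.2

/-- A smooth function as an element of the algebra `SmoothFun`. -/
def SmoothFun.mk {E N : Type*} [NormedAddCommGroup E] [NormedSpace ℝ E]
    [TopologicalSpace N] [ChartedSpace E N] (h : N → ℂ) (hh : ContMDiff 𝓘(ℝ, E) 𝓘(ℝ, ℂ) ∞ h) :
    SmoothFun E N := ⟨h, hh⟩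

/-- Smooth complex vector fields on `N`, i.e. sections of `TN ⊗ ℂ`. -/
abbrev VecField := Derivation ℂ (SmoothFun E N) (SmoothFun E N)

/-- Smooth complex one-forms on `N`. -/
abbrev OneForm := Module.Dual (SmoothFun E N) (VecField E N)

/-- Smooth complex `k`-forms on `N`. -/
abbrev KForm (k : ℕ) := VecField E N [⋀^Fin k]→ₗ[SmoothFun E N] SmoothFun E N

/-- Complex sections of the generalized tangent bundle `TN ⊕ T*N`. -/
abbrev GenSection := VecField E N × OneForm E N

end Basic

/-! ### Cartan calculus

`V` is a module of vector-field-like objects, acting on functions `R` by `ρ` and carrying a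
bracket `br`.  A cochain of degree `k` is a function of `k` arguments from `V`; the operations below
are the usual ones when evaluated on alternating multilinear cochains.  They are written
through Cartan's formulas `ι_x d = L_x - d ι_x` and `ι_x (η ∧ σ) = (ι_x η) ∧ σ ± η ∧ ι_x σ`. -/

section Cartan

variable {V R : Type*} [CommRing R]

/-- Cochains of degree `k`. -/
abbrev Cochain (V R : Type*) (k : ℕ) := (Fin k → V) → R

/-- The contraction `ι_x σ`. -/
def contract (x : V) {k : ℕ} (σ : Cochain V R (k + 1)) : Cochain V R k :=
  fun u => σ (Fin.cons x u)

/-- The Lie derivative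
`(L_x σ)(u₁, …, u_k) = x(σ(u₁, …, u_k)) - ∑ σ(u₁, …, [x, u_i], …, u_k)`. -/
def lieDer (ρ : V → R → R) (br : V → V → V) (x : V) {k : ℕ} (σ : Cochain V R k) : Cochain V R k :=
  fun u => ρ x (σ u) - ∑ i, σ (Function.update u i (br x (u i)))

/-- The exterior derivative: `ι_x (d h) = x(h)` on functions and `ι_x (d σ) = L_x σ - d (ι_x σ)`. -/
def extDer (ρ : V → R → R) (br : V → V → V) : ∀ k : ℕ, Cochain V R k → Cochain V R (k + 1)
  | 0, σ => fun u => ρ (u 0) (σ ![])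
  | k + 1, σ => fun u =>
      lieDer ρ br (u 0) σ (Fin.tail u) - extDer ρ br k (contract (u 0) σ) (Fin.tail u)

/-- `α ∧ σ` for a one-form `α`. -/
def wedgeOne (α : V → R) : ∀ k : ℕ, Cochain V R k → Cochain V R (k + 1)
  | 0, σ => fun u => α (u 0) * σ ![]
  | k + 1, σ => fun u =>
      α (u 0) * σ (Fin.tail u) - wedgeOne α k (contract (u 0) σ) (Fin.tail u)

/-- `β ∧ σ` for a two-form `β`. -/
def wedgeTwo (β : V → V → R) : ∀ k : ℕ, Cochain V R k → Cochain V R (k + 2)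
  | 0, σ => fun u => β (u 0) (u 1) * σ ![]
  | k + 1, σ => fun u =>
      wedgeOne (β (u 0)) (k + 1) σ (Fin.tail u) + wedgeTwo β k (contract (u 0) σ) (Fin.tail u)

/-- `η ∧ σ` for a three-form `η`. -/
def wedgeThree (η : V → V → V → R) : ∀ k : ℕ, Cochain V R k → Cochain V R (k + 3)
  | 0, σ => fun u => η (u 0) (u 1) (u 2) * σ ![]
  | k + 1, σ => fun u =>
      wedgeTwo (η (u 0)) (k + 1) σ (Fin.tail u) - wedgeThree η k (contract (u 0) σ) (Fin.tail u)

/-- An inhomogeneous cochain: one component in every degree. -/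
abbrev MixedCochain (V R : Type*) := ∀ k : ℕ, Cochain V R k

/-- Contraction on inhomogeneous cochains. -/
def mixedContract (x : V) (σ : MixedCochain V R) : MixedCochain V R :=
  fun k => contract x (σ (k + 1))

/-- Exterior derivative on inhomogeneous cochains. -/
def mixedExtDer (ρ : V → R → R) (br : V → V → V) (σ : MixedCochain V R) : MixedCochain V R
  | 0 => 0
  | k + 1 => extDer ρ br k (σ k)

/-- Exterior multiplication by a one-form on inhomogeneous cochains. -/
def mixedWedgeOne (α : V → R) (σ : MixedCochain V R) : MixedCochain V R
  | 0 => 0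
  | k + 1 => wedgeOne α k (σ k)

/-- Exterior multiplication by a three-form on inhomogeneous cochains. -/
def mixedWedgeThree (η : V → V → V → R) (σ : MixedCochain V R) : MixedCochain V R
  | 0 => 0
  | 1 => 0
  | 2 => 0
  | k + 3 => wedgeThree η k (σ k)

end Cartan

/-! ### The standard `H`-twisted Courant algebroid of a manifold (complexified) -/

section Standard

variable {E : Type*} [NormedAddCommGroup E] [NormedSpace ℝ E]
  {N : Type*} [TopologicalSpace N] [ChartedSpace E N]

theorem lie_smul_right (x w : VecField E N) (r : SmoothFun E N) :
    ⁅x, r • w⁆ = r • ⁅x, w⁆ + x r • w := by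
  ext1 h
  simp only [Derivation.commutator_apply, Derivation.smul_apply, Derivation.add_apply,
    smul_eq_mul, Derivation.leibniz]
  ring

/-- The exterior derivative of a function, `(dh)(w) = w(h)`. -/
def dFun (h : SmoothFun E N) : OneForm E N where
  toFun w := w h
  map_add' _ _ := rfl
  map_smul' _ _ := rfl

/-- The Lie derivative of a one-form, `(L_x β)(w) = x(β(w)) - β([x, w])`. -/
def lieOneForm (x : VecField E N) (β : OneForm E N) : OneForm E N where
  toFun w := x (β w) - β ⁅x, w⁆
  map_add' u w := by
    have h : ⁅x, u + w⁆ = ⁅x, u⁆ + ⁅x, w⁆ := lie_add x u w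
    rw [h]; simp only [map_add]; ring
  map_smul' r w := by
    simp only [map_smul, lie_smul_right, map_add, smul_eq_mul, Derivation.leibniz,
      RingHom.id_apply]
    ring

/-- The contraction `ι_y dα = L_y α - d(α(y))` of the exterior derivative of a one-form:
`(dα)(y, w) = y(α(w)) - w(α(y)) - α([y, w])`. -/
def contractD (y : VecField E N) (α : OneForm E N) : OneForm E N :=
  lieOneForm y α - dFun (α y)

/-- The exterior derivative of a one-form, evaluated on two vector fields. -/
def dOneForm (α : OneForm E N) (y w : VecField E N) : SmoothFun E N := contractD y α w

/-- The one-form `ι_x ι_y H`, that is `w ↦ H(y, x, w)`. -/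
def contractTwo (H : KForm E N 3) (x y : VecField E N) : OneForm E N where
  toFun w := H ![y, x, w]
  map_add' u w := by
    have h : ∀ w : VecField E N, ![y, x, w] = Function.update ![y, x, 0] 2 w := by
      intro w; funext i; fin_cases i <;> rfl
    rw [h, h u, h w, H.map_update_add]
  map_smul' r w := by
    have h : ∀ w : VecField E N, ![y, x, w] = Function.update ![y, x, 0] 2 w := by
      intro w; funext i; fin_cases i <;> rfl
    rw [h, h w, H.map_update_smul]; rfl

/-- The `H`-twisted Dorfman bracket
`[x + α, y + β]_H = [x, y] + L_x β - ι_y dα + ι_x ι_y H`. -/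
def dorfman (H : KForm E N 3) (a b : GenSection E N) : GenSection E N :=
  (⁅a.1, b.1⁆, lieOneForm a.1 b.2 - contractD b.1 a.2 + contractTwo H a.1 b.1)

/-- The pairing `⟨x + α, y + β⟩ = α(y) + β(x)`. -/
def stdPairing (a b : GenSection E N) : SmoothFun E N := a.2 b.1 + b.2 a.1

/-- A three-form is closed. -/
def IsClosed3 (H : KForm E N 3) : Prop :=
  extDer (fun (x : VecField E N) (h : SmoothFun E N) => x h) (fun x y => ⁅x, y⁆) 3 (fun u => H u) = 0

/-- The Lie derivative of a section of `TN ⊕ T*N`. -/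
def lieGen (x : VecField E N) (a : GenSection E N) : GenSection E N :=
  (⁅x, a.1⁆, lieOneForm x a.2)

end Standard

/-! ### Rapidly decreasing sequences -/

section Decay

variable {F : Type*} [NormedAddCommGroup F] [NormedSpace ℝ F]
  {Z : Type*} [TopologicalSpace Z] [ChartedSpace F Z]

/-- A sequence of smooth functions on `Z` is rapidly decreasing if all seminorms
`sup_n |n|^N sup_K |x₁ ⋯ x_r u_n|` are finite (`K ⊆ Z` compact, `x_i` vector fields). -/
def RapidDecay (u : ℤ → SmoothFun F Z) : Prop :=
  ∀ (D : List (VecField F Z)) (K : Set Z), IsCompact K → ∀ N : ℕ, ∃ C : ℝ, ∀ n : ℤ, ∀ z ∈ K,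
    |(n : ℝ)| ^ N * ‖(D.foldr (fun x h => x h) (u n)) z‖ ≤ C

theorem foldr_add (D : List (VecField F Z)) (u w : SmoothFun F Z) :
    D.foldr (fun x h => x h) (u + w) =
      D.foldr (fun x h => x h) u + D.foldr (fun x h => x h) w := by
  induction D with
  | nil => rfl
  | cons x D ih => simp only [List.foldr_cons, ih, map_add]

theorem foldr_smul (D : List (VecField F Z)) (c : ℂ) (u : SmoothFun F Z) :
    D.foldr (fun x h => x h) (c • u) = c • D.foldr (fun x h => x h) u := by
  induction D with
  | nil => rfl
  | cons x D ih => simp only [List.foldr_cons, ih, Derivation.map_smul]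

theorem RapidDecay.zero : RapidDecay (0 : ℤ → SmoothFun F Z) := by
  intro D K _ N
  refine ⟨0, fun n z _ => ?_⟩
  have h := foldr_smul D 0 (0 : SmoothFun F Z)
  rw [zero_smul, zero_smul] at h
  change _ * ‖(D.foldr (fun x h => x h) (0 : SmoothFun F Z)) z‖ ≤ 0
  rw [h]
  change _ * ‖(0 : ℂ)‖ ≤ 0
  simp

theorem RapidDecay.add {u w : ℤ → SmoothFun F Z} (hu : RapidDecay u) (hw : RapidDecay w) :
    RapidDecay (u + w) := by
  intro D K hK N
  obtain ⟨C, hC⟩ := hu D K hK N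
  obtain ⟨C', hC'⟩ := hw D K hK N
  refine ⟨C + C', fun n z hz => ?_⟩
  rw [Pi.add_apply, foldr_add]
  refine le_trans ?_ (add_le_add (hC n z hz) (hC' n z hz))
  rw [← mul_add]
  exact mul_le_mul_of_nonneg_left (norm_add_le _ _) (by positivity)

theorem RapidDecay.smul (c : ℂ) {u : ℤ → SmoothFun F Z} (hu : RapidDecay u) :
    RapidDecay (c • u) := by
  intro D K hK N
  obtain ⟨C, hC⟩ := hu D K hK N
  refine ⟨‖c‖ * C, fun n z hz => ?_⟩
  rw [Pi.smul_apply, foldr_smul]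
  change _ * ‖c * _‖ ≤ _
  rw [norm_mul, mul_left_comm]
  exact mul_le_mul_of_nonneg_left (hC n z hz) (norm_nonneg _)

end Decay

/-! ### Principal circle bundles -/

/-- A smooth principal circle bundle `proj : Z → M`: a smooth action of the circle group on `Z`
together with local trivializations `Z|_U ≅ U × S¹` that are equivariant diffeomorphisms over `U`. -/
structure CircleBundle (E : Type*) [NormedAddCommGroup E] [NormedSpace ℝ E]
    (F : Type*) [NormedAddCommGroup F] [NormedSpace ℝ F]
    (M : Type*) [TopologicalSpace M] [ChartedSpace E M]
    (Z : Type*) [TopologicalSpace Z] [ChartedSpace F Z] [MulAction Circle Z] where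
  /-- The bundle projection. -/
  proj : Z → M
  proj_smooth : ContMDiff 𝓘(ℝ, F) 𝓘(ℝ, E) ∞ proj
  act_smooth : ContMDiff ((𝓡 1).prod 𝓘(ℝ, F)) 𝓘(ℝ, F) ∞ (fun p : Circle × Z => p.1 • p.2)
  locally_trivial : ∀ m : M, ∃ (U : Set M) (e : OpenPartialHomeomorph Z (M × Circle)),
    IsOpen U ∧ m ∈ U ∧ e.source = proj ⁻¹' U ∧ e.target = U ×ˢ Set.univ ∧
    ContMDiffOn 𝓘(ℝ, F) (𝓘(ℝ, E).prod (𝓡 1)) ∞ e e.source ∧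
    ContMDiffOn (𝓘(ℝ, E).prod (𝓡 1)) 𝓘(ℝ, F) ∞ e.symm e.target ∧
    ∀ z ∈ e.source, (e z).1 = proj z ∧ ∀ t : Circle, e (t • z) = (proj z, t * (e z).2)

namespace CircleBundle

variable {E : Type*} [NormedAddCommGroup E] [NormedSpace ℝ E]
  {F : Type*} [NormedAddCommGroup F] [NormedSpace ℝ F]
  {M : Type*} [TopologicalSpace M] [ChartedSpace E M]
  {Z : Type*} [TopologicalSpace Z] [ChartedSpace F Z] [MulAction Circle Z]

/-- The rotation `e^{2πit} ∈ S¹`; the action of `t ∈ ℝ` has period one. -/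
def rot (t : ℝ) : Circle := Circle.exp (2 * Real.pi * t)

theorem orbit_smooth (P : CircleBundle E F M Z) (h : SmoothFun F Z) :
    ContMDiff (𝓘(ℝ, F).prod 𝓘(ℝ, ℝ)) 𝓘(ℝ, ℂ) ∞ (fun p : Z × ℝ => h (rot p.2 • p.1)) := by
  have h1 : ContMDiff (𝓘(ℝ, F).prod 𝓘(ℝ, ℝ)) (𝓡 1) ∞ (fun p : Z × ℝ => rot p.2) := by
    have h2 : ContMDiff 𝓘(ℝ, ℝ) 𝓘(ℝ, ℝ) ∞ (fun t : ℝ => 2 * Real.pi * t) :=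
      (contDiff_const.mul contDiff_id).contMDiff
    exact (contMDiff_circleExp.comp h2).comp contMDiff_snd
  exact h.smooth.comp (P.act_smooth.comp (h1.prodMk contMDiff_fst))

theorem orbit_differentiable (P : CircleBundle E F M Z) (h : SmoothFun F Z) (z : Z) :
    Differentiable ℝ (fun t : ℝ => h (rot t • z)) := by
  have h1 : ContMDiff 𝓘(ℝ, ℝ) 𝓘(ℝ, ℂ) ∞ (fun t : ℝ => h (rot t • z)) :=
    (P.orbit_smooth h).comp (contMDiff_const.prodMk contMDiff_id)
  exact h1.contDiff.differentiable (by simp)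

variable [IsManifold 𝓘(ℝ, F) ∞ Z]

theorem generator_smooth (P : CircleBundle E F M Z) (h : SmoothFun F Z) :
    ContMDiff 𝓘(ℝ, F) 𝓘(ℝ, ℂ) ∞ (fun z : Z => deriv (fun t : ℝ => h (rot t • z)) 0) := by
  intro z
  have : IsManifold 𝓘(ℝ, F) 1 Z := IsManifold.of_le (n := ∞) (by simp)
  have h1 := ContMDiffAt.mfderiv_apply (m := ∞) (n := ∞) (x₀ := z)
    (I := 𝓘(ℝ, ℝ)) (I' := 𝓘(ℝ, ℂ)) (J := 𝓘(ℝ, F)) (J' := 𝓘(ℝ, F))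
    (fun (z : Z) (t : ℝ) => h (rot t • z)) (fun _ => (0 : ℝ)) id (fun _ => (1 : ℝ))
    (P.orbit_smooth h).contMDiffAt contMDiffAt_const contMDiffAt_id contMDiffAt_const (by simp)
  simpa [inTangentCoordinates_model_space, mfderiv_eq_fderiv] using h1

/-- The generator `v` of the circle action, normalized to have period one:
`(v h)(z) = d/dt h(e^{2πit} z)` at `t = 0`. -/
def generator (P : CircleBundle E F M Z) : VecField F Z :=
  Derivation.mk'
    { toFun := fun h => SmoothFun.mk (fun z => deriv (fun t : ℝ => h (rot t • z)) 0)
        (P.generator_smooth h)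
      map_add' := fun h k => Subtype.ext <| funext fun z =>
        deriv_fun_add (P.orbit_differentiable h z 0) (P.orbit_differentiable k z 0)
      map_smul' := fun c h => Subtype.ext <| funext fun z =>
        deriv_fun_const_smul c (P.orbit_differentiable h z 0) }
    (fun h k => Subtype.ext <| funext fun z => by
      have h0 : rot 0 • z = z := by simp [rot]
      have := deriv_fun_mul (P.orbit_differentiable h z 0) (P.orbit_differentiable k z 0)
      simp only [h0] at this
      refine this.trans ?_
      change _ = h z * _ + k z * _
      rw [mul_comm (k z), add_comm]
      rfl)

/-- Pullback of functions along the projection. -/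
def pullFun (P : CircleBundle E F M Z) : SmoothFun E M →ₐ[ℂ] SmoothFun F Z where
  toFun h := SmoothFun.mk (fun z => h (P.proj z)) (h.smooth.comp P.proj_smooth)
  map_one' := rfl
  map_mul' _ _ := rfl
  map_zero' := rfl
  map_add' _ _ := rfl
  commutes' _ := rfl

/-- Complex vector fields along `proj`, i.e. sections of `proj^*(TM ⊗ ℂ)` over `Z`, as derivations
from `C^∞(M, ℂ)` to `C^∞(Z, ℂ)`. -/
def vecAlong (P : CircleBundle E F M Z) :
    Submodule (SmoothFun F Z) (SmoothFun E M →ₗ[ℂ] SmoothFun F Z) where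
  carrier := {X | ∀ h k, X (h * k) = P.pullFun h * X k + P.pullFun k * X h}
  zero_mem' h k := by simp
  add_mem' {X Y} hX hY h k := by
    simp only [LinearMap.add_apply, hX h k, hY h k]; ring
  smul_mem' r X hX h k := by
    simp only [LinearMap.smul_apply, hX h k, smul_eq_mul]; ring

/-- The type of complex vector fields along `proj`. -/
abbrev VecAlong (P : CircleBundle E F M Z) := ↥P.vecAlong

/-- The differential of `proj`, `x ↦ proj_* x`, from vector fields on `Z` to vector fields along
`proj`. -/
def push (P : CircleBundle E F M Z) : VecField F Z →ₗ[SmoothFun F Z] P.VecAlong where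
  toFun x := ⟨(x : SmoothFun F Z →ₗ[ℂ] SmoothFun F Z) ∘ₗ P.pullFun.toLinearMap, fun h k => by
    simp [Derivation.leibniz]⟩
  map_add' _ _ := rfl
  map_smul' _ _ := rfl

/-- A vector field on `M`, regarded as a vector field along `proj`. -/
def baseVec (P : CircleBundle E F M Z) (X : VecField E M) : P.VecAlong :=
  ⟨P.pullFun.toLinearMap ∘ₗ (X : SmoothFun E M →ₗ[ℂ] SmoothFun E M), fun h k => by
    simp [Derivation.leibniz]⟩

/-! Let `L = Z ×_{S¹} ℂ` be the complex line bundle associated to `Z`.  A section `s` of `L^{⊗n}`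
is a function `u` on `Z` with `u(t z) = t^{-n} u(z)`, through `s(proj z) = [z, u(z)]`.  The local
frame `s_α` of `L` given by a local trivialization with circle coordinate `θ_α` is the function
`e^{-2πi θ_α}`.  More generally a section of `W ⊗ L^{⊗n}` over `M`, for a vector bundle `W` over `M`,
is a section of `proj^* W` over `Z` with the same equivariance. -/

/-- Smooth sections of `L^{⊗n}`. -/
def lineSec (_P : CircleBundle E F M Z) (n : ℤ) : Submodule ℂ (SmoothFun F Z) where
  carrier := {u | ∀ (t : Circle) (z : Z), u (t • z) = (t : ℂ) ^ (-n) * u z}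
  zero_mem' t z := by change (0 : ℂ) = _ * 0; simp
  add_mem' {a b} ha hb t z := by
    change a (t • z) + b (t • z) = _ * (a z + b z)
    rw [ha, hb]; ring
  smul_mem' c a ha t z := by
    change c * a (t • z) = _ * (c * a z)
    rw [ha]; ring

/-- Quadruples `(X, f, ξ, g)`, with `X` a section of `proj^* TM`, `f, g` functions on `Z` and `ξ` a
section of `proj^* T*M` (all complex): sections of `proj^*(TM ⊕ 1 ⊕ T*M ⊕ 1)` over `Z`. -/
abbrev Quad (P : CircleBundle E F M Z) :=
  P.VecAlong × SmoothFun F Z × Module.Dual (SmoothFun F Z) P.VecAlong × SmoothFun F Z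

/-- Smooth sections over `M` of the `n`-th weight space `(TM ⊕ 1 ⊕ T*M ⊕ 1) ⊗ L^{⊗n}`. -/
def weightSec (P : CircleBundle E F M Z) (n : ℤ) : Submodule ℂ P.Quad where
  carrier := {c | (∀ h, c.1.1 h ∈ P.lineSec n) ∧ c.2.1 ∈ P.lineSec n ∧
    (∀ W : VecField E M, c.2.2.1 (P.baseVec W) ∈ P.lineSec n) ∧ c.2.2.2 ∈ P.lineSec n}
  zero_mem' := ⟨fun _ => zero_mem _, zero_mem _, fun _ => zero_mem _, zero_mem _⟩
  add_mem' ha hb := ⟨fun h => add_mem (ha.1 h) (hb.1 h), add_mem ha.2.1 hb.2.1,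
    fun W => add_mem (ha.2.2.1 W) (hb.2.2.1 W), add_mem ha.2.2.2 hb.2.2.2⟩
  smul_mem' c _ ha := ⟨fun h => Submodule.smul_mem _ c (ha.1 h), Submodule.smul_mem _ c ha.2.1,
    fun W => Submodule.smul_mem _ c (ha.2.2.1 W), Submodule.smul_mem _ c ha.2.2.2⟩

/-! #### Completed direct sums -/

/-- Sections of `⊕_n L^{⊗n}`: the completed direct sum of the spaces of sections of `L^{⊗n}`. -/
def lineSum (P : CircleBundle E F M Z) : Submodule ℂ (ℤ → SmoothFun F Z) where
  carrier := {u | (∀ n, u n ∈ P.lineSec n) ∧ RapidDecay u}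
  zero_mem' := ⟨fun _ => zero_mem _, RapidDecay.zero⟩
  add_mem' ha hb := ⟨fun n => add_mem (ha.1 n) (hb.1 n), ha.2.add hb.2⟩
  smul_mem' c _ ha := ⟨fun n => Submodule.smul_mem _ c (ha.1 n), ha.2.smul c⟩

/-- Sections of `⊕_n (TM ⊕ 1 ⊕ T*M ⊕ 1) ⊗ L^{⊗n}`: the completed direct sum of the spaces of
sections of the weight spaces. -/
def quadSum (P : CircleBundle E F M Z) : Submodule ℂ (ℤ → P.Quad) where
  carrier := {s | (∀ n, s n ∈ P.weightSec n) ∧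
    (∀ h, RapidDecay (fun n => (s n).1.1 h)) ∧ RapidDecay (fun n => (s n).2.1) ∧
    (∀ W : VecField E M, RapidDecay (fun n => (s n).2.2.1 (P.baseVec W))) ∧
    RapidDecay (fun n => (s n).2.2.2)}
  zero_mem' := ⟨fun _ => zero_mem _, fun _ => RapidDecay.zero, RapidDecay.zero,
    fun _ => RapidDecay.zero, RapidDecay.zero⟩
  add_mem' ha hb := ⟨fun n => add_mem (ha.1 n) (hb.1 n), fun h => (ha.2.1 h).add (hb.2.1 h),
    ha.2.2.1.add hb.2.2.1, fun W => (ha.2.2.2.1 W).add (hb.2.2.2.1 W), ha.2.2.2.2.add hb.2.2.2.2⟩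
  smul_mem' c _ ha := ⟨fun n => Submodule.smul_mem _ c (ha.1 n), fun h => (ha.2.1 h).smul c,
    ha.2.2.1.smul c, fun W => (ha.2.2.2.1 W).smul c, ha.2.2.2.2.smul c⟩

/-- Pointwise convergence `∑_n s_n = c` in every component. -/
def QuadHasSum (P : CircleBundle E F M Z) (s : ℤ → P.Quad) (c : P.Quad) : Prop :=
  (∀ h z, HasSum (fun n => (s n).1.1 h z) (c.1.1 h z)) ∧
  (∀ z, HasSum (fun n => (s n).2.1 z) (c.2.1 z)) ∧
  (∀ W z, HasSum (fun n => (s n).2.2.1 W z) (c.2.2.1 W z)) ∧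
  (∀ z, HasSum (fun n => (s n).2.2.2 z) (c.2.2.2 z))

/-! #### Pullback of forms, connections, invariant sections -/

open Classical in
/-- The pullback of a `k`-form on `M` to a `k`-form on vector fields along `proj`: the unique
`C^∞(Z)`-multilinear extension. -/
def formAlong (P : CircleBundle E F M Z) {k : ℕ} (η : KForm E M k) :
    P.VecAlong [⋀^Fin k]→ₗ[SmoothFun F Z] SmoothFun F Z :=
  if h : ∃ ζ : P.VecAlong [⋀^Fin k]→ₗ[SmoothFun F Z] SmoothFun F Z,
      ∀ X : Fin k → VecField E M, ζ (fun i => P.baseVec (X i)) = P.pullFun (η X)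
  then h.choose else 0

/-- The pullback `proj^* η` of a `k`-form on `M` to `Z`. -/
def pullForm (P : CircleBundle E F M Z) {k : ℕ} (η : KForm E M k) : KForm F Z k :=
  (P.formAlong η).compLinearMap P.push

open Classical in
/-- The pullback of a one-form on `M` to a section of `proj^* T*M`: the unique `C^∞(Z)`-linear
extension. -/
def oneFormAlong (P : CircleBundle E F M Z) (ξ : OneForm E M) :
    Module.Dual (SmoothFun F Z) P.VecAlong :=
  if h : ∃ ζ : Module.Dual (SmoothFun F Z) P.VecAlong,
      ∀ X : VecField E M, ζ (P.baseVec X) = P.pullFun (ξ X)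
  then h.choose else 0

/-- A connection: an invariant one-form `A` with `A(v) = 1`. -/
structure Connection (P : CircleBundle E F M Z) where
  /-- The connection form. -/
  form : OneForm F Z
  form_generator : form P.generator = 1
  form_invariant : lieOneForm P.generator form = 0

open Classical in
/-- The horizontal lift of vector fields along `proj`: the unique `C^∞(Z)`-linear right inverse of
`proj_*` with values in the kernel of the connection form. -/
def horLift {P : CircleBundle E F M Z} (A : P.Connection) :
    P.VecAlong →ₗ[SmoothFun F Z] VecField F Z :=
  if h : ∃ l : P.VecAlong →ₗ[SmoothFun F Z] VecField F Z,
      ∀ X, P.push (l X) = X ∧ A.form (l X) = 0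
  then h.choose else 0

/-- `(X, f, ξ, g) ↦ X + f v + ξ + g A`, with `X` lifted horizontally and `ξ` pulled back to `Z`. -/
def assemble {P : CircleBundle E F M Z} (A : P.Connection) (c : P.Quad) : GenSection F Z :=
  (horLift A c.1 + c.2.1 • P.generator, c.2.2.1 ∘ₗ P.push + c.2.2.2 • A.form)

/-- The weight component `h_n(z) = ∫_0^1 h(e^{2πit} z) e^{2πint} dt`, so that locally
`h = ∑_n h_n` is the Fourier expansion with `h_n` proportional to `e^{-2πinθ}` along the fibres. -/
def weightComponent (n : ℤ) (h : SmoothFun F Z) (z : Z) : ℂ :=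
  ∫ t in (0 : ℝ)..1, Complex.exp (2 * Real.pi * Complex.I * n * t) * h (rot t • z)

/-- The sections of weight `-n` of `TZ ⊕ T*Z`: those with `L_v a = -2πi n a`. -/
def IsWeightNeg (P : CircleBundle E F M Z) (n : ℤ) (a : GenSection F Z) : Prop :=
  lieGen P.generator a = (-(2 * Real.pi * Complex.I * n) : ℂ) • a

/-- The invariant sections of `TZ ⊕ T*Z`. -/
def invariantSec (P : CircleBundle E F M Z) : Submodule ℂ (GenSection F Z) where
  carrier := {a | lieGen P.generator a = 0}
  zero_mem' := by
    refine Prod.ext (lie_zero P.generator) (LinearMap.ext fun w => ?_)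
    simp [lieGen, lieOneForm]
  add_mem' {a b} ha hb := by
    have h1 : ⁅P.generator, a.1 + b.1⁆ = ⁅P.generator, a.1⁆ + ⁅P.generator, b.1⁆ := lie_add _ _ _
    have h2 : lieOneForm P.generator (a.2 + b.2) =
        lieOneForm P.generator a.2 + lieOneForm P.generator b.2 := LinearMap.ext fun w => by
      simp only [lieOneForm, LinearMap.coe_mk, AddHom.coe_mk, LinearMap.add_apply, map_add]; ring
    have h3 : lieGen P.generator (a + b) = lieGen P.generator a + lieGen P.generator b :=
      Prod.ext h1 h2
    change lieGen P.generator a = 0 at ha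
    change lieGen P.generator b = 0 at hb
    change lieGen P.generator (a + b) = 0
    rw [h3, ha, hb, add_zero]
  smul_mem' c a ha := by
    have h1 : ⁅P.generator, c • a.1⁆ = c • ⁅P.generator, a.1⁆ := lie_smul _ _ _
    have h2 : lieOneForm P.generator (c • a.2) = c • lieOneForm P.generator a.2 :=
      LinearMap.ext fun w => by
        simp only [lieOneForm, LinearMap.coe_mk, AddHom.coe_mk, LinearMap.smul_apply,
          Derivation.map_smul, smul_sub]
    have h3 : lieGen P.generator (c • a) = c • lieGen P.generator a := Prod.ext h1 h2
    change lieGen P.generator a = 0 at ha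
    change lieGen P.generator (c • a) = 0
    rw [h3, ha, smul_zero]

/-- Sections of the complexified bundle `TM ⊕ 1 ⊕ T*M ⊕ 1`. -/
abbrev BaseQuad (E M : Type*) [NormedAddCommGroup E] [NormedSpace ℝ E]
    [TopologicalSpace M] [ChartedSpace E M] :=
  VecField E M × SmoothFun E M × OneForm E M × SmoothFun E M

/-- A section of `TM ⊕ 1 ⊕ T*M ⊕ 1` as a section of the weight space `n = 0`, where
`L^{⊗0}` is trivial. -/
def baseQuad (P : CircleBundle E F M Z) (e : BaseQuad E M) : P.Quad :=
  (P.baseVec e.1, P.pullFun e.2.1, P.oneFormAlong e.2.2.1, P.pullFun e.2.2.2)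

/-- `(X, f, ξ, g) ↦ (X, g, ξ, f)` on sections over `M`. -/
def swapBase (e : BaseQuad E M) : BaseQuad E M := (e.1, e.2.2.2, e.2.2.1, e.2.1)

/-- The fibrewise map `φ : (X, f, ξ, g) ↦ -(X, g, ξ, f)`. -/
def negSwap (P : CircleBundle E F M Z) (c : P.Quad) : P.Quad := -(c.1, c.2.2.2, c.2.2.1, c.2.1)

/-- The pairing `⟨(X, f, ξ, g), (Y, k, η, l)⟩ = η(X) + ξ(Y) + g k + f l`; it sends sections of
weights `n` and `m` to sections of `L^{⊗(n+m)}`. -/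
def quadPairing (P : CircleBundle E F M Z) (a b : P.Quad) : SmoothFun F Z :=
  b.2.2.1 a.1 + a.2.2.1 b.1 + a.2.2.2 * b.2.1 + a.2.1 * b.2.2.2

/-- The covariant derivative `∇h ∈ Ω¹(M, L^{⊗n})` of a section `h` of `L^{⊗n}`, for the connection
induced by `A`: `∇_X h` is the derivative of `h` along the horizontal lift of `X`. -/
def nabla {P : CircleBundle E F M Z} (A : P.Connection) (h : SmoothFun F Z) :
    Module.Dual (SmoothFun F Z) P.VecAlong :=
  dFun h ∘ₗ horLift A

end CircleBundle

/-! ### T-dual pairs and the exotic Courant algebroid of the dual pair -/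

section TDuality

variable {E : Type*} [NormedAddCommGroup E] [NormedSpace ℝ E]
  {M : Type*} [TopologicalSpace M] [ChartedSpace E M]
  {F : Type*} [NormedAddCommGroup F] [NormedSpace ℝ F]
  {Z : Type*} [TopologicalSpace Z] [ChartedSpace F Z] [IsManifold 𝓘(ℝ, F) ∞ Z] [MulAction Circle Z]
  {F' : Type*} [NormedAddCommGroup F'] [NormedSpace ℝ F']
  {Z' : Type*} [TopologicalSpace Z'] [ChartedSpace F' Z'] [IsManifold 𝓘(ℝ, F') ∞ Z']
  [MulAction Circle Z']

open CircleBundle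

/-- T-dual data on circle bundles `P : Z → M` and `P' : Z' → M` (`Z'`, `A'`, `F'`, `H'` are the hatted
objects): connections `A`, `A'` with curvatures `dA = K` and `dA' = K'`, and closed invariant fluxes
`H = Ω + A ∧ K'` on `Z` and `H' = Ω + A' ∧ K` on `Z'`, with `K`, `K'`, `Ω` forms on `M` (pulled back
to `Z` and `Z'`); these are `curv`, `curv'` and `base`. -/
structure TDualPair (P : CircleBundle E F M Z) (P' : CircleBundle E F' M Z') where
  conn : P.Connection
  conn' : P'.Connection
  curv : KForm E M 2
  curv' : KForm E M 2
  base : KForm E M 3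
  flux : KForm F Z 3
  flux' : KForm F' Z' 3
  conn_curv : ∀ x y, dOneForm conn.form x y = P.pullForm curv ![x, y]
  conn_curv' : ∀ x y, dOneForm conn'.form x y = P'.pullForm curv' ![x, y]
  flux_eq : ∀ x y w, flux ![x, y, w] = P.pullForm base ![x, y, w]
    + conn.form x * P.pullForm curv' ![y, w] - conn.form y * P.pullForm curv' ![x, w]
    + conn.form w * P.pullForm curv' ![x, y]
  flux_eq' : ∀ x y w, flux' ![x, y, w] = P'.pullForm base ![x, y, w]
    + conn'.form x * P'.pullForm curv ![y, w] - conn'.form y * P'.pullForm curv ![x, w]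
    + conn'.form w * P'.pullForm curv ![x, y]
  flux_closed : IsClosed3 flux
  flux_closed' : IsClosed3 flux'

namespace TDualPair

variable {P : CircleBundle E F M Z} {P' : CircleBundle E F' M Z'}

/-! Through the connection `A'`, an invariant section of `TZ' ⊗ proj'^*(L^{⊗n})` over `Z'` is
`X + f v'` with `X` a section of `TM ⊗ L^{⊗n}` and `f` a section of `L^{⊗n}`; likewise an invariant
section of `T*Z' ⊗ proj'^*(L^{⊗n})` is `ξ + g A'`.  Here `L` is associated to `Z`. -/

/-- Pairs `(X, f)` standing for the vector fields `X + f v'` with coefficients in powers of `L`. -/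
abbrev DualVec (_T : TDualPair P P') := P.VecAlong × SmoothFun F Z

/-- The covariant derivative along `X + f v'` of sections of powers of `L`, pulled back from `M` to
`Z'`. -/
def dualAct (T : TDualPair P P') (x : T.DualVec) (h : SmoothFun F Z) : SmoothFun F Z :=
  nabla T.conn h x.1

/-- The bracket of vector fields on `Z'` with coefficients in powers of `L`:
`[X + f v', Y + k v'] = [X, Y] + (∇_X k - ∇_Y f - K'(X, Y)) v'`, where `[X, Y]` is formed with the
covariant derivative. -/
def dualLie (T : TDualPair P P') (x y : T.DualVec) : T.DualVec :=
  (P.push ⁅horLift T.conn x.1, horLift T.conn y.1⁆,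
    nabla T.conn y.2 x.1 - nabla T.conn x.2 y.1 - P.formAlong T.curv' ![x.1, y.1])

/-- The flux `H' = Ω + A' ∧ K` evaluated on vector fields `X + f v'`. -/
def dualFlux (T : TDualPair P P') (x y w : T.DualVec) : SmoothFun F Z :=
  P.formAlong T.base ![x.1, y.1, w.1]
    + x.2 * P.formAlong T.curv ![y.1, w.1] - y.2 * P.formAlong T.curv ![x.1, w.1]
    + w.2 * P.formAlong T.curv ![x.1, y.1]

/-- An exotic differential form of weight `p`: an invariant inhomogeneous form on `Z'` with values in
`proj'^*(L^{⊗p})`. -/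
def IsExoticForm (T : TDualPair P P') (p : ℤ)
    (σ : MixedCochain T.DualVec (SmoothFun F Z)) : Prop :=
  ∀ k, (∃ ζ : T.DualVec [⋀^Fin k]→ₗ[SmoothFun F Z] SmoothFun F Z, σ k = fun u => ζ u) ∧
    ∀ (X : Fin k → VecField E M) (f : Fin k → SmoothFun E M),
      σ k (fun i => (P.baseVec (X i), P.pullFun (f i))) ∈ P.lineSec p

/-- The Clifford action of `X + f v' + ξ + g A'`: contraction with `X + f v'` plus exterior
multiplication by `ξ + g A'`. -/
def clifford (T : TDualPair P P') (a : P.Quad) (σ : MixedCochain T.DualVec (SmoothFun F Z)) :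
    MixedCochain T.DualVec (SmoothFun F Z) :=
  mixedContract (a.1, a.2.1) σ + mixedWedgeOne (fun x => a.2.2.1 x.1 + a.2.2.2 * x.2) σ

/-- The twisted differential `-(∇ - 2πi p ι_{v'} + H')` on exotic forms of weight `p`. -/
def exoticDiff (T : TDualPair P P') (p : ℤ) (σ : MixedCochain T.DualVec (SmoothFun F Z)) :
    MixedCochain T.DualVec (SmoothFun F Z) :=
  -(mixedExtDer T.dualAct T.dualLie σ
    - (2 * Real.pi * Complex.I * p : ℂ) • mixedContract ((0, 1) : T.DualVec) σ
    + mixedWedgeThree T.dualFlux σ)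

/-- `c = [a, b]` for the derived bracket `[[𝒟, a], b]` of the twisted differential `𝒟`, for sections
`a`, `b` of weights `n`, `m`; the brackets are graded commutators of operators on exotic forms. -/
def IsWeightBracket (T : TDualPair P P') (n m : ℤ) (a b c : P.Quad) : Prop :=
  ∀ (p : ℤ) (σ : MixedCochain T.DualVec (SmoothFun F Z)), T.IsExoticForm p σ →
    T.clifford c σ =
      (T.exoticDiff (p + m + n) (T.clifford a (T.clifford b σ))
        + T.clifford a (T.exoticDiff (p + m) (T.clifford b σ)))
      - T.clifford b (T.exoticDiff (p + n) (T.clifford a σ) + T.clifford a (T.exoticDiff p σ))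

/-- `c = [s, t]` for the exotic bracket on the completed direct sum: `c_p = ∑_n [s_n, t_{p-n}]`. -/
def IsExoticBracket (T : TDualPair P P') (s t c : P.quadSum) : Prop :=
  ∃ b : ℤ → ℤ → P.Quad,
    (∀ n m, b n m ∈ P.weightSec (n + m) ∧ T.IsWeightBracket n m (s.1 n) (t.1 m) (b n m)) ∧
    ∀ p, P.QuadHasSum (fun n => b n (p - n)) (c.1 p)

/-- `u = ⟨s, t⟩` for the exotic pairing: `u_p = ∑_n ⟨s_n, t_{p-n}⟩`. -/
def IsExoticPairing (_T : TDualPair P P') (s t : P.quadSum) (u : P.lineSum) : Prop :=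
  ∀ p z, HasSum (fun n => (P.quadPairing (s.1 n) (t.1 (p - n))) z) (u.1 p z)

/-- The operator `h ↦ -(∇h - 2πi n h v')` from sections of `L^{⊗n}` to sections of weight `n`. -/
def exoticD (T : TDualPair P P') (n : ℤ) (h : SmoothFun F Z) : P.Quad :=
  -(0, -((2 * Real.pi * Complex.I * n : ℂ) • h), nabla T.conn h, 0)

/-- `w = ρ(s) u` for the exotic anchor, given on weight spaces by `ρ(a) h = ⟨a, D h⟩`, with `D` the
operator `exoticD`: `w_p = ∑_n ρ(s_n) u_{p-n}`. -/
def IsExoticAnchor (T : TDualPair P P') (s : P.quadSum) (u w : P.lineSum) : Prop :=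
  ∀ p z, HasSum
    (fun n => (P.quadPairing (s.1 n) (T.exoticD (p - n) (u.1 (p - n)))) z) (w.1 p z)

/-- The map `φ''` from functions on `Z` to sections of `⊕_n L^{⊗n}` is the decomposition into weight
components. -/
def IsFunDecomposition (_T : TDualPair P P') (Φ : SmoothFun F Z →ₗ[ℂ] P.lineSum) : Prop :=
  ∀ h n z, (Φ h).1 n z = weightComponent n h z

/-- The map `φ'` from sections of `TZ ⊕ T*Z` to sections of `⊕_n (TM ⊕ 1 ⊕ T*M ⊕ 1) ⊗ L^{⊗n}` is the
decomposition into weight components: if `x + α = ∑_n a_n` is the expansion into sections of weights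
`-n`, then `a_n = X_n + f_n v + ξ_n + g_n A` goes to `(X_n, f_n, ξ_n, g_n)` in degree `n`. -/
def IsDecomposition (T : TDualPair P P') (Φ : GenSection F Z →ₗ[ℂ] P.quadSum) : Prop :=
  ∀ (a : GenSection F Z) (n : ℤ) (z : Z),
    (∀ h, ((Φ a).1 n).1.1 h z = weightComponent n (a.1 (P.pullFun h)) z) ∧
    ((Φ a).1 n).2.1 z = weightComponent n (T.conn.form a.1) z ∧
    (∀ W, ((Φ a).1 n).2.2.1 (P.baseVec W) z =
      weightComponent n (a.2 (horLift T.conn (P.baseVec W))) z) ∧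
    ((Φ a).1 n).2.2.2 z = weightComponent n (a.2 P.generator) z

/-- The complexified Cavalcanti-Gualtieri T-duality map on invariant sections,
`X + f v + ξ + g A ↦ X + g v' + ξ + f A'`. -/
def IsCavalcantiGualtieri (T : TDualPair P P') (χ : P.invariantSec →ₗ[ℂ] P'.invariantSec) : Prop :=
  ∀ (e : BaseQuad E M) (a : P.invariantSec), a.1 = assemble T.conn (P.baseQuad e) →
    (χ a).1 = assemble T.conn' (P'.baseQuad (swapBase e))

/-- The identification `(X, f, ξ, g) ↦ X + f v' + ξ + g A'` of the sections of weight `0` of the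
exotic bundle with the invariant sections of `TZ' ⊕ T*Z'`. -/
def IsWeightZeroIdentification (T : TDualPair P P')
    (ψ : P.weightSec 0 →ₗ[ℂ] P'.invariantSec) : Prop :=
  ∀ (e : BaseQuad E M) (c : P.weightSec 0), c.1 = P.baseQuad e →
    (ψ c).1 = assemble T.conn' (P'.baseQuad e)

end TDualPair

end TDuality

end ExoticTDuality
end

/-! Fourier expansion along the circle orbits reduces the statement to an identity between sections
of pure weight. A smooth function on `Z` is the sum of its weight components: integration by parts
along the orbits makes them rapidly decreasing (`rapidDecay_comp`), Fourier inversion recovers the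
function (`hasSum_comp`), and conversely every rapidly decreasing sequence can be summed and
differentiated term by term (`RapidDecay.apply_hasSum`). This gives `funDecomposition`. The
connection splits TZ ⊕ T*Z into the pullback of TM ⊕ 1 ⊕ T*M ⊕ 1 (`assembleEquiv`), so sections
decompose in the same way (`quadDecomposition`). The fibrewise map `negSwap` is an involution that
preserves weights, hence `duality` is bijective.

Pairing, anchor and Dorfman bracket on `Z` are bilinear and invariant under the circle, because dA
and H are built from forms on M and the invariant form A. Hence the weight-p component of a result
is the sum over n of the operation applied to the components of index n and p - n (`IsConvolution`,
`isQuadConvolution_dorfman`). The completed operations on the dual side are defined by the same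
sums, so only pure weights have to be compared.

For pure weights the derived bracket is evaluated by Cartan calculus (`derived_bracket`), with a
correction because the coefficient of the contraction with the dual generator depends on the weight
(`weighted_derived_bracket`). On `Z` the same correction arises from the generator, which acts on
weight -n as -2πin. The curvatures trade places: F enters the vertical part of a Lie bracket on `Z`
and the flux on the dual side, while F̂ enters the flux on `Z` and the Lie bracket on the dual side.
Swapping the two functions matches these terms, and the sign in the swap compensates the sign of the
twisted differential (`isWeightBracket_negSwap`). Brackets are unique because the Clifford action is
faithful (`clifford_injective`); brackets, pairings and anchors of arbitrary completed sections
exist because they can be transported from `Z`. In weight zero everything descends to M, where the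
duality is the swap up to sign. -/

section

open scoped Topology
open MeasureTheory

set_option linter.unusedSectionVars false
set_option linter.unusedSimpArgs false

noncomputable section

namespace ExoticTDuality

/-! ### Pointwise evaluation of smooth functions. -/

section SmoothFunLemmas

variable {E : Type*} [NormedAddCommGroup E] [NormedSpace ℝ E]
  {N : Type*} [TopologicalSpace N] [ChartedSpace E N]

namespace SmoothFun

@[ext] theorem ext' {f g : SmoothFun E N} (h : ∀ z, f z = g z) : f = g :=
  Subtype.ext (funext h)

@[simp] theorem add_apply (f g : SmoothFun E N) (z : N) : (f + g) z = f z + g z := rfl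
@[simp] theorem mul_apply (f g : SmoothFun E N) (z : N) : (f * g) z = f z * g z := rfl
@[simp] theorem sub_apply (f g : SmoothFun E N) (z : N) : (f - g) z = f z - g z := rfl
@[simp] theorem neg_apply (f : SmoothFun E N) (z : N) : (-f) z = -f z := rfl
@[simp] theorem zero_apply (z : N) : (0 : SmoothFun E N) z = 0 := rfl
@[simp] theorem one_apply (z : N) : (1 : SmoothFun E N) z = 1 := rfl
@[simp] theorem smul_apply (c : ℂ) (f : SmoothFun E N) (z : N) : (c • f) z = c * f z := rfl
@[simp] theorem mk_apply (f : N → ℂ) (hf : ContMDiff 𝓘(ℝ, E) 𝓘(ℝ, ℂ) ∞ f) (z : N) :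
    SmoothFun.mk f hf z = f z := rfl
@[simp] theorem algebraMap_apply (c : ℂ) (z : N) : algebraMap ℂ (SmoothFun E N) c z = c := rfl

/-- Evaluation at a point. -/
def evalHom (z : N) : SmoothFun E N →ₐ[ℂ] ℂ where
  toFun f := f z
  map_one' := rfl
  map_mul' _ _ := rfl
  map_zero' := rfl
  map_add' _ _ := rfl
  commutes' _ := rfl

@[simp] theorem evalHom_apply (z : N) (f : SmoothFun E N) : evalHom z f = f z := rfl

@[simp] theorem sum_apply {ι : Type*} (s : Finset ι) (f : ι → SmoothFun E N) (z : N) :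
    (∑ i ∈ s, f i) z = ∑ i ∈ s, f i z :=
  map_sum (evalHom z) f s

@[simp] theorem pow_apply (f : SmoothFun E N) (n : ℕ) (z : N) : (f ^ n) z = f z ^ n :=
  map_pow (evalHom z) f n

theorem continuous (f : SmoothFun E N) : Continuous f := f.smooth.continuous

end SmoothFun

end SmoothFunLemmas

/-! ### Parametric integrals and Hadamard's lemma in a vector space. -/

section ParametricIntegral

variable {E : Type*} [NormedAddCommGroup E] [NormedSpace ℝ E] [FiniteDimensional ℝ E]

/-- Differentiation under the integral sign for jointly smooth functions on `E × [0, 1]`. -/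
theorem hasFDerivAt_unitInterval_integral {g : E × ℝ → ℂ} (hg : ContDiff ℝ ∞ g) (w₀ : E) :
    HasFDerivAt (fun w => ∫ t in (0 : ℝ)..1, g (w, t))
      (∫ t in (0 : ℝ)..1, (fderiv ℝ g (w₀, t)).comp (ContinuousLinearMap.inl ℝ E ℝ)) w₀ := by
  have hg' : Continuous (fun p : E × ℝ => (fderiv ℝ g p).comp (ContinuousLinearMap.inl ℝ E ℝ)) :=
    (hg.continuous_fderiv (by simp)).clm_comp continuous_const
  have hK : IsCompact (Metric.closedBall w₀ 1 ×ˢ Set.Icc (0 : ℝ) 1) :=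
    (isCompact_closedBall w₀ 1).prod isCompact_Icc
  obtain ⟨C, hC⟩ := hK.exists_bound_of_continuousOn hg'.continuousOn
  refine intervalIntegral.hasFDerivAt_integral_of_dominated_of_fderiv_le
    (F' := fun w t => (fderiv ℝ g (w, t)).comp (ContinuousLinearMap.inl ℝ E ℝ))
    (bound := fun _ => C) (Metric.ball_mem_nhds w₀ one_pos) ?_ ?_ ?_ ?_ ?_ ?_
  · refine Filter.Eventually.of_forall fun w => ?_
    exact (hg.continuous.comp (by fun_prop : Continuous fun t : ℝ => (w, t))).aestronglyMeasurable
  · exact (hg.continuous.comp (by fun_prop : Continuous fun t : ℝ => (w₀,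
      t))).intervalIntegrable _ _
  · exact (hg'.comp (by fun_prop : Continuous fun t : ℝ => (w₀, t))).aestronglyMeasurable
  · refine Filter.Eventually.of_forall fun t ht w hw => hC (w,
      t) ⟨Metric.ball_subset_closedBall hw, ?_⟩
    rw [Set.uIoc_of_le zero_le_one] at ht
    exact ⟨ht.1.le, ht.2⟩
  · exact intervalIntegrable_const
  · refine Filter.Eventually.of_forall fun t ht w hw => ?_
    have h1 : HasFDerivAt g (fderiv ℝ g (w, t)) (w, t) :=
      (hg.differentiable (by simp) (w, t)).hasFDerivAt
    exact h1.comp w (hasFDerivAt_prodMk_left w t)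

/-- The derivative in a direction y is an integral of the same kind, with integrand the derivative
of `g` along (y, 0). Induction on the order of differentiability therefore has to vary `g`. -/
theorem contDiff_unitInterval_integral {g : E × ℝ → ℂ} (hg : ContDiff ℝ ∞ g) :
    ContDiff ℝ ∞ (fun w => ∫ t in (0 : ℝ)..1, g (w, t)) := by
  rw [contDiff_infty]
  intro n
  induction n generalizing g with
  | zero =>
    exact contDiff_zero.2 (Differentiable.continuous (𝕜 := ℝ) fun w =>
      (hasFDerivAt_unitInterval_integral hg w).differentiableAt)
  | succ n ih =>
    rw [Nat.cast_add, Nat.cast_one, contDiff_succ_iff_fderiv_apply]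
    refine ⟨fun w => (hasFDerivAt_unitInterval_integral hg w).differentiableAt, by simp,
        fun y => ?_⟩
    have hg' : ContDiff ℝ ∞ (fun p : E × ℝ => fderiv ℝ g p (y, 0)) :=
      (hg.fderiv_right (m := ∞) (by simp)).clm_apply contDiff_const
    convert ih hg' using 2 with w
    rw [(hasFDerivAt_unitInterval_integral hg w).fderiv,
      ContinuousLinearMap.intervalIntegral_apply]
    · simp
    · refine Continuous.intervalIntegrable ?_ _ _
      exact ((hg.continuous_fderiv (by simp)).comp
        (by fun_prop : Continuous fun t : ℝ => (w, t))).clm_comp continuous_const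

/-- Hadamard's lemma. -/
theorem exists_hadamard {ι : Type*} [Fintype ι] (b : Module.Basis ι ℝ E) {h : E → ℂ}
    (hh : ContDiff ℝ ∞ h) (p : E) :
    ∃ g : ι → E → ℂ, (∀ i, ContDiff ℝ ∞ (g i)) ∧ (∀ i, g i p = fderiv ℝ h p (b i)) ∧
      ∀ w, h w = h p + ∑ i, ((b.repr w i - b.repr p i : ℝ) : ℂ) * g i w := by
  -- Integrating the derivative of `h` along the segment from `p` to `w` gives `h w - h p`; the
  -- coefficients are the averaged partial derivatives.
  refine ⟨fun i w => ∫ t in (0 : ℝ)..1, fderiv ℝ h (p + t • (w - p)) (b i), fun i => ?_,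
    fun i => by simp, fun w => ?_⟩
  · refine contDiff_unitInterval_integral
      (g := fun q : E × ℝ => fderiv ℝ h (p + q.2 • (q.1 - p)) (b i)) ?_
    refine ((hh.fderiv_right (m := ∞) (by simp)).comp ?_).clm_apply contDiff_const
    fun_prop
  · have hcont : Continuous fun t : ℝ => fderiv ℝ h (p + t • (w - p)) :=
      (hh.continuous_fderiv (by simp)).comp (by fun_prop)
    have h1 : ∫ t in (0 : ℝ)..1, fderiv ℝ h (p + t • (w - p)) (w - p) = h w - h p := by
      have h2 : ∀ t ∈ Set.uIcc (0 : ℝ) 1, HasDerivAt (fun t : ℝ => h (p + t • (w - p)))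
          (fderiv ℝ h (p + t • (w - p)) (w - p)) t := by
        intro t _
        have h3 : HasDerivAt (fun t : ℝ => p + t • (w - p)) (w - p) t := by
          simpa using ((hasDerivAt_id t).smul_const (w - p)).const_add p
        exact ((hh.differentiable (by simp) _).hasFDerivAt).comp_hasDerivAt t h3
      rw [intervalIntegral.integral_eq_sub_of_hasDerivAt h2
        ((hcont.clm_apply continuous_const).intervalIntegrable _ _)]
      simp
    have h4 : ∀ t : ℝ, fderiv ℝ h (p + t • (w - p)) (w - p) =
        ∑ i, ((b.repr w i - b.repr p i : ℝ) : ℂ) * fderiv ℝ h (p + t • (w - p)) (b i) := by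
      intro t
      generalize fderiv ℝ h (p + t • (w - p)) = L
      conv_lhs => rw [← b.sum_repr (w - p)]
      simp [map_sum]
    simp only [h4] at h1
    rw [intervalIntegral.integral_finsetSum] at h1
    · simp only [intervalIntegral.integral_const_mul] at h1
      rw [h1]; ring
    · intro i _
      exact (continuous_const.mul (hcont.clm_apply continuous_const)).intervalIntegrable _ _

end ParametricIntegral

/-- Function and base point both move with the parameter. This is the source of smoothness for all
vector fields constructed by differentiating in a chart or a trivialization. -/
theorem contMDiffAt_fderiv_param {E : Type*} [NormedAddCommGroup E] [NormedSpace ℝ E]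
    {B : Type*} [NormedAddCommGroup B] [NormedSpace ℝ B] {H : Type*} [TopologicalSpace H]
    {J : ModelWithCorners ℝ B H} {Q : Type*} [TopologicalSpace Q] [ChartedSpace H Q]
    [IsManifold J 1 Q] {f : Q → E → ℂ} {g : Q → E} {x₀ : Q} (e : E)
    (hf : ContMDiffAt (J.prod 𝓘(ℝ, E)) 𝓘(ℝ, ℂ) ∞ (Function.uncurry f) (x₀, g x₀))
    (hg : ContMDiffAt J 𝓘(ℝ, E) ∞ g x₀) :
    ContMDiffAt J 𝓘(ℝ, ℂ) ∞ (fun x => fderiv ℝ (f x) (g x) e) x₀ := by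
  have h1 := ContMDiffAt.mfderiv_apply (m := ∞) (n := ∞) (x₀ := x₀)
    (I := 𝓘(ℝ, E)) (I' := 𝓘(ℝ, ℂ)) (J := J) (J' := J) f g id (fun _ => e)
    hf hg contMDiffAt_id contMDiffAt_const (by simp)
  simpa [inTangentCoordinates_model_space, mfderiv_eq_fderiv] using h1

/-! ### Point derivations and cut-off coordinate frames. -/

section Frames

variable {E : Type*} [NormedAddCommGroup E] [NormedSpace ℝ E] [FiniteDimensional ℝ E]
  {M : Type*} [TopologicalSpace M] [ChartedSpace E M] [IsManifold 𝓘(ℝ, E) ∞ M] [T2Space M]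

theorem exists_smoothFun_one_nhds (q : M) {U : Set M} (hU : U ∈ 𝓝 q) :
    ∃ χ : SmoothFun E M, (∀ᶠ x in 𝓝 q, χ x = 1) ∧ tsupport χ ⊆ U := by
  obtain ⟨ρ, -, hρ⟩ := (SmoothBumpFunction.nhds_basis_tsupport (I := 𝓘(ℝ, E)) q).mem_iff.1 hU
  refine ⟨SmoothFun.mk (fun x => ρ x • (1 : ℂ)) (ρ.contMDiff_smul contMDiffOn_const), ?_, ?_⟩
  · filter_upwards [ρ.eventuallyEq_one] with x hx
    simp [hx]
  · exact (tsupport_smul_subset_left (ρ : M → ℝ) (fun _ => (1 : ℂ))).trans hρ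

/-- A derivation of smooth functions at a point vanishes on functions vanishing nearby. -/
theorem pointDerivation_local {q : M} {D : SmoothFun E M →ₗ[ℂ] ℂ}
    (hD : ∀ h k, D (h * k) = h q * D k + k q * D h) {h : SmoothFun E M}
    (h0 : ∀ᶠ x in 𝓝 q, h x = 0) : D h = 0 := by
  obtain ⟨χ, hχ, hs⟩ := exists_smoothFun_one_nhds (E := E) q h0
  -- The cutoff is supported where `h` vanishes and equals 1 at `q`, so the Leibniz rule for this
  -- zero product leaves only `D h`.
  have h1 : χ * h = 0 := by
    ext x
    by_cases hx : x ∈ tsupport χ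
    · simp [show h x = 0 from hs hx]
    · simp [image_eq_zero_of_notMem_tsupport hx]
  have h2 := hD χ h
  rw [h1, map_zero, hχ.self_of_nhds, h0.self_of_nhds] at h2
  simpa using h2.symm

theorem pointDerivation_congr {q : M} {D : SmoothFun E M →ₗ[ℂ] ℂ}
    (hD : ∀ h k, D (h * k) = h q * D k + k q * D h) {h k : SmoothFun E M}
    (h0 : ∀ᶠ x in 𝓝 q, h x = k x) : D h = D k := by
  rw [← sub_eq_zero, ← map_sub]
  exact pointDerivation_local hD (h0.mono fun x hx => by simp [hx])

theorem pointDerivation_algebraMap {q : M} {D : SmoothFun E M →ₗ[ℂ] ℂ}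
    (hD : ∀ h k, D (h * k) = h q * D k + k q * D h) (c : ℂ) :
    D (algebraMap ℂ (SmoothFun E M) c) = 0 := by
  have h1 := hD 1 1
  rw [mul_one] at h1
  have h2 : D 1 = 0 := by simpa using h1
  rw [Algebra.algebraMap_eq_smul_one, map_smul, h2, smul_zero]

variable {c : M} (ρ : SmoothBumpFunction 𝓘(ℝ, E) c)

/-- A linear coordinate of the chart at `c`, cut off by `ρ`. -/
def chartCoord (l : E →L[ℝ] ℝ) : SmoothFun E M :=
  SmoothFun.mk (fun x => ρ x • ((l (extChartAt 𝓘(ℝ, E) c x) : ℝ) : ℂ)) <|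
    ρ.contMDiff_smul <| by
      have h1 : ContDiff ℝ ∞ (fun w : E => ((l w : ℝ) : ℂ)) :=
        Complex.ofRealCLM.contDiff.comp l.contDiff
      exact h1.contMDiff.comp_contMDiffOn contMDiffOn_extChartAt

/-- Outside the chart the cutoff vanishes on a neighbourhood, so only points of the chart matter.
The extra real parameter is needed later for the time along circle orbits. -/
theorem contMDiff_chartDer_param {G : M × ℝ → ℂ}
    (hG : ContMDiff (𝓘(ℝ, E).prod 𝓘(ℝ, ℝ)) 𝓘(ℝ, ℂ) ∞ G) (e : E) :
    ContMDiff (𝓘(ℝ, E).prod 𝓘(ℝ, ℝ)) 𝓘(ℝ, ℂ) ∞ (fun p : M × ℝ => ρ p.1 •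
      fderiv ℝ (fun w => G ((extChartAt 𝓘(ℝ, E) c).symm w, p.2)) (extChartAt 𝓘(ℝ, E) c p.1) e) := by
  intro p
  have : IsManifold 𝓘(ℝ, E) 1 M := IsManifold.of_le (n := ∞) (by simp)
  by_cases hp : p.1 ∈ (chartAt E c).source
  · refine (ρ.contMDiff.comp contMDiff_fst).contMDiffAt.smul ?_
    have hp' : p.1 ∈ (extChartAt 𝓘(ℝ, E) c).source := by simpa using hp
    refine contMDiffAt_fderiv_param
      (f := fun (p : M × ℝ) w => G ((extChartAt 𝓘(ℝ, E) c).symm w, p.2))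
      (g := fun p => extChartAt 𝓘(ℝ, E) c p.1) e ?_ ?_
    · refine hG.contMDiffAt.comp _ (ContMDiffAt.prodMk ?_ ?_)
      · refine ContMDiffAt.comp (p, extChartAt 𝓘(ℝ, E) c p.1) (g := (extChartAt 𝓘(ℝ, E) c).symm)
          (f := Prod.snd) (I' := 𝓘(ℝ, E)) ?_ contMDiffAt_snd
        refine (contMDiffOn_extChartAt_symm c).contMDiffAt ?_
        exact (isOpen_extChartAt_target c).mem_nhds ((extChartAt 𝓘(ℝ, E) c).map_source hp')
      · exact contMDiffAt_snd.comp _ contMDiffAt_fst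
    · exact ContMDiffAt.comp p (contMDiffAt_extChartAt' hp) contMDiffAt_fst
  · have h0 : p.1 ∉ tsupport ρ := fun h => hp (ρ.tsupport_subset_chartAt_source h)
    have h1 : ∀ᶠ x in 𝓝 p, ρ x.1 = 0 :=
      (continuous_fst.tendsto p).eventually ((notMem_tsupport_iff_eventuallyEq.1 h0))
    refine (contMDiffAt_const (c := (0 : ℂ))).congr_of_eventuallyEq (h1.mono fun x hx => ?_)
    simp only [hx, zero_smul]

theorem contMDiff_chartDer (h : SmoothFun E M) (e : E) :
    ContMDiff 𝓘(ℝ, E) 𝓘(ℝ, ℂ) ∞ (fun x : M => ρ x •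
      fderiv ℝ (fun w => h ((extChartAt 𝓘(ℝ, E) c).symm w)) (extChartAt 𝓘(ℝ, E) c x) e) :=
  (contMDiff_chartDer_param ρ (G := fun p => h p.1) (h.smooth.comp contMDiff_fst) e).comp
    (contMDiff_id.prodMk (contMDiff_const (c := (0 : ℝ))))

theorem SmoothFun.contDiffAt_extChartAt_symm (h : SmoothFun E M) {w : E}
    (hw : w ∈ (extChartAt 𝓘(ℝ, E) c).target) :
    ContDiffAt ℝ ∞ (fun w => h ((extChartAt 𝓘(ℝ, E) c).symm w)) w := by
  rw [← contMDiffAt_iff_contDiffAt]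
  exact h.smooth.contMDiffAt.comp w ((contMDiffOn_extChartAt_symm c).contMDiffAt
    ((isOpen_extChartAt_target c).mem_nhds hw))

/-- The derivative in the direction `e` in the chart at `c`, cut off by `ρ`. -/
def chartDer (e : E) : VecField E M :=
  have key : ∀ (x : M), ρ x ≠ 0 → extChartAt 𝓘(ℝ, E) c x ∈ (extChartAt 𝓘(ℝ, E) c).target ∧
      (extChartAt 𝓘(ℝ, E) c).symm (extChartAt 𝓘(ℝ, E) c x) = x := fun x hx => by
    have hx' : x ∈ (extChartAt 𝓘(ℝ, E) c).source := by
      simpa using ρ.support_subset_source hx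
    exact ⟨(extChartAt 𝓘(ℝ, E) c).map_source hx', (extChartAt 𝓘(ℝ, E) c).left_inv hx'⟩
  have hd : ∀ (h : SmoothFun E M) (x : M), ρ x ≠ 0 → DifferentiableAt ℝ
      (fun w => h ((extChartAt 𝓘(ℝ, E) c).symm w)) (extChartAt 𝓘(ℝ, E) c x) := fun h x hx =>
    (h.contDiffAt_extChartAt_symm (key x hx).1).differentiableAt (by simp)
  Derivation.mk'
    { toFun := fun h => SmoothFun.mk _ (contMDiff_chartDer ρ h e)
      map_add' := fun h k => by
        ext x
        by_cases hx : ρ x = 0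
        · simp [hx]
        · simp only [SmoothFun.mk_apply, SmoothFun.add_apply]
          rw [fderiv_fun_add (hd h x hx) (hd k x hx), add_apply, smul_add]
      map_smul' := fun a h => by
        ext x
        by_cases hx : ρ x = 0
        · simp [hx]
        · simp only [SmoothFun.mk_apply, SmoothFun.smul_apply, RingHom.id_apply]
          rw [fderiv_const_mul (hd h x hx)]
          simp only [smul_apply, smul_eq_mul, Complex.real_smul]
          ring }
    (fun h k => by
      ext x
      by_cases hx : ρ x = 0
      · simp [hx]
      · change ρ x • fderiv ℝ (fun w => h _ * k _) _ e = h x * _ + k x * _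
        rw [fderiv_fun_mul (hd h x hx) (hd k x hx)]
        simp only [add_apply, smul_apply, smul_eq_mul,
          Complex.real_smul, (key x hx).2]
        change _ = h x * (ρ x • _) + k x * (ρ x • _)
        simp only [Complex.real_smul]
        ring)

theorem chartDer_apply (e : E) (h : SmoothFun E M) (x : M) :
    chartDer ρ e h x = ρ x • fderiv ℝ (fun w => h ((extChartAt 𝓘(ℝ, E) c).symm w))
      (extChartAt 𝓘(ℝ, E) c x) e := rfl

/-- Derivations at a point near `c` are combinations of coordinate derivatives. -/
theorem pointDerivation_eq_sum {ι : Type*} [Fintype ι] (b : Module.Basis ι ℝ E) {q : M}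
    (hq : q ∈ (chartAt E c).source)
    (hd : dist (extChartAt 𝓘(ℝ, E) c q) (extChartAt 𝓘(ℝ, E) c c) < ρ.rIn)
    {D : SmoothFun E M →ₗ[ℂ] ℂ} (hD : ∀ h k, D (h * k) = h q * D k + k q * D h)
    (h : SmoothFun E M) :
    D h = ∑ i, D (chartCoord ρ (LinearMap.toContinuousLinearMap (b.coord i))) *
      chartDer ρ (b i) h q := by
  set φ := extChartAt 𝓘(ℝ, E) c with hφ
  have hq' : q ∈ φ.source := by simpa [hφ] using hq
  have hsub : Metric.closedBall (φ c) ρ.rOut ⊆ φ.target :=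
    fun w hw => ρ.closedBall_subset ⟨hw, by simp⟩
  -- Hadamard's lemma is available on the whole vector space, so `h` is first cut off inside the
  -- chart. Near `φ q` nothing changes, because that point lies within the inner radius.
  have hsm : ContDiff ℝ ∞ (fun w => ρ.toContDiffBump w • h (φ.symm w)) := by
    rw [contDiff_iff_contDiffAt]
    intro w
    by_cases hw : w ∈ φ.target
    · exact ρ.toContDiffBump.contDiffAt.smul (h.contDiffAt_extChartAt_symm hw)
    · have h1 : w ∉ tsupport ρ.toContDiffBump := by
        rw [ρ.toContDiffBump.tsupport_eq]
        exact fun h2 => hw (hsub h2)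
      refine (contDiffAt_const (c := (0 : ℂ))).congr_of_eventuallyEq
        ((notMem_tsupport_iff_eventuallyEq.1 h1).mono fun x hx => ?_)
      simp only [hx, Pi.zero_apply, zero_smul]
  obtain ⟨g, hg, hgp, hgw⟩ := exists_hadamard b hsm (φ q)
  have hone : ∀ᶠ x in 𝓝 q, ρ x = 1 := ρ.eventuallyEq_one_of_dist_lt hq hd
  have hball : ρ.toContDiffBump =ᶠ[𝓝 (φ q)] 1 :=
    ρ.toContDiffBump.eventuallyEq_one_of_mem_ball hd
  let G : ι → SmoothFun E M := fun i => SmoothFun.mk (fun x => ρ x • g i (φ x))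
    (ρ.contMDiff_smul ((hg i).contMDiff.comp_contMDiffOn contMDiffOn_extChartAt))
  let X : ι → SmoothFun E M := fun i =>
    chartCoord ρ (LinearMap.toContinuousLinearMap (b.coord i))
  -- Near `q` the function is its value plus a sum of products, each with a first factor that
  -- vanishes at `q`. A derivation kills the constant and retains from each product only `D` of the
  -- coordinate times the value of the second factor.
  have hloc : D h = D (algebraMap ℂ _ (h q) +
      ∑ i, (X i - algebraMap ℂ _ (X i q)) * G i) := by
    refine pointDerivation_congr hD ?_
    filter_upwards [hone, (chartAt E c).open_source.mem_nhds hq, hone.eventually_nhds,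
      (continuousAt_extChartAt' (I := 𝓘(ℝ, E)) hq').eventually hball] with x hx hxs _ hx2
    have hxs' : x ∈ φ.source := by simpa [hφ] using hxs
    have h1 := hgw (φ x)
    rw [hball.self_of_nhds, hx2] at h1
    simp only [Pi.one_apply, one_smul, φ.left_inv hxs', φ.left_inv hq'] at h1
    rw [h1]
    simp [X, G, chartCoord, hx, hone.self_of_nhds, hφ]
  rw [hloc, map_add, pointDerivation_algebraMap hD, zero_add, map_sum]
  refine Finset.sum_congr rfl fun i _ => ?_
  rw [hD, map_sub, pointDerivation_algebraMap hD]
  have h3 : G i q = chartDer ρ (b i) h q := by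
    rw [chartDer_apply, hone.self_of_nhds, one_smul]
    change ρ q • g i (φ q) = _
    rw [hone.self_of_nhds, one_smul, hgp]
    congr 1
    refine Filter.EventuallyEq.fderiv_eq (hball.mono fun w hw => ?_)
    simp only [hw, Pi.one_apply, one_smul, hφ]
  simp [X, h3, mul_comm]

end Frames

/-! ### Dominated families: integrals and rapidly convergent series of smooth functions. -/

section Families

variable {F : Type*} [NormedAddCommGroup F] [NormedSpace ℝ F] [FiniteDimensional ℝ F]
  {N : Type*} [TopologicalSpace N] [ChartedSpace F N] [IsManifold 𝓘(ℝ, F) ∞ N] [T2Space N]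

/-- Iterated action of vector fields on a smooth function. -/
abbrev derWord (D : List (VecField F N)) (h : SmoothFun F N) : SmoothFun F N :=
  D.foldr (fun x h => x h) h

theorem derWord_append_singleton (D : List (VecField F N)) (x : VecField F N)
    (h : SmoothFun F N) : derWord (D ++ [x]) h = derWord D (x h) := by
  simp [derWord]

/-- A family of smooth functions all of whose derivatives are dominated on compact sets. -/
def DominatedFamily {T : Type*} [MeasurableSpace T] (ν : Measure T) (u : T → SmoothFun F N) :
    Prop :=
  ∀ D : List (VecField F N),
    (∀ z, AEStronglyMeasurable (fun t => derWord D (u t) z) ν) ∧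
    ∀ K : Set N, IsCompact K → ∃ b : T → ℝ, Integrable b ν ∧
      ∀ᵐ t ∂ν, ∀ z ∈ K, ‖derWord D (u t) z‖ ≤ b t

namespace DominatedFamily

variable {T : Type*} [MeasurableSpace T] {ν : Measure T} {u : T → SmoothFun F N}

theorem der (hu : DominatedFamily ν u) (x : VecField F N) :
    DominatedFamily ν (fun t => x (u t)) := by
  intro D
  simpa only [derWord_append_singleton] using hu (D ++ [x])

theorem integrable (hu : DominatedFamily ν u) (z : N) : Integrable (fun t => u t z) ν := by
  obtain ⟨h1, h2⟩ := hu []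
  obtain ⟨b, hb, hb'⟩ := h2 {z} isCompact_singleton
  exact hb.mono' (h1 z) (hb'.mono fun t ht => ht z rfl)

variable {c : N} (ρ : SmoothBumpFunction 𝓘(ℝ, F) c)

theorem mem_target_of_mem_ball {w : F}
    (hw : w ∈ Metric.closedBall (extChartAt 𝓘(ℝ, F) c c) ρ.rIn) :
    w ∈ (extChartAt 𝓘(ℝ, F) c).target :=
  ρ.closedBall_subset ⟨Metric.closedBall_subset_closedBall ρ.rIn_lt_rOut.le hw, by simp⟩

theorem chartDer_symm_apply (h : SmoothFun F N) (e : F) {w : F}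
    (hw : w ∈ Metric.ball (extChartAt 𝓘(ℝ, F) c c) ρ.rIn) :
    chartDer ρ e h ((extChartAt 𝓘(ℝ, F) c).symm w) =
      fderiv ℝ (fun w => h ((extChartAt 𝓘(ℝ, F) c).symm w)) w e := by
  have hw' := mem_target_of_mem_ball ρ (Metric.ball_subset_closedBall hw)
  rw [chartDer_apply, (extChartAt 𝓘(ℝ, F) c).right_inv hw']
  have h1 : ρ ((extChartAt 𝓘(ℝ, F) c).symm w) = 1 := by
    refine ρ.one_of_dist_le ?_ ?_
    · simpa using (extChartAt 𝓘(ℝ, F) c).map_target hw'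
    · rw [(extChartAt 𝓘(ℝ, F) c).right_inv hw']
      exact (Metric.mem_ball.1 hw).le
  rw [h1, one_smul]

theorem fderiv_eq_sum {ι : Type*} [Fintype ι] (b : Module.Basis ι ℝ F) (L : F →L[ℝ] ℂ) :
    L = ∑ i, (LinearMap.toContinuousLinearMap (b.coord i)).smulRight (L (b i)) := by
  ext y
  have h : L y = L (∑ i, b.repr y i • b i) := by rw [b.sum_repr]
  rw [h, map_sum]
  simp

/-- On the inner ball the cutoff is 1, so `chartDer` gives the true partial derivatives there. Their
bounds on the compact closed ball are the dominating functions for differentiation under the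
integral. -/
theorem hasFDerivAt_integral {ι : Type*} [Fintype ι] (b : Module.Basis ι ℝ F)
    (hu : DominatedFamily ν u) {w : F}
    (hw : w ∈ Metric.ball (extChartAt 𝓘(ℝ, F) c c) ρ.rIn) :
    HasFDerivAt (fun w => ∫ t, u t ((extChartAt 𝓘(ℝ, F) c).symm w) ∂ν)
      (∑ i, (LinearMap.toContinuousLinearMap (b.coord i)).smulRight
        (∫ t, chartDer ρ (b i) (u t) ((extChartAt 𝓘(ℝ, F) c).symm w) ∂ν)) w := by
  set φ := extChartAt 𝓘(ℝ, F) c with hφ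
  have hK : IsCompact (φ.symm '' Metric.closedBall (φ c) ρ.rIn) :=
    (isCompact_closedBall _ _).image_of_continuousOn
      ((continuousOn_extChartAt_symm c).mono fun w hw => mem_target_of_mem_ball ρ hw)
  have hdu := fun i => hu.der (chartDer ρ (b i))
  choose B hB hBb using fun i => (hdu i []).2 _ hK
  have hsm : ∀ i, Continuous fun a : ℂ =>
      (LinearMap.toContinuousLinearMap (b.coord i)).smulRight a := fun i =>
    (ContinuousLinearMap.smulRightL ℝ F ℂ (LinearMap.toContinuousLinearMap (b.coord i))).continuous
  have hsum : (∑ i, (LinearMap.toContinuousLinearMap (b.coord i)).smulRight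
        (∫ t, chartDer ρ (b i) (u t) (φ.symm w) ∂ν)) =
      ∫ t, ∑ i, (LinearMap.toContinuousLinearMap (b.coord i)).smulRight
        (chartDer ρ (b i) (u t) (φ.symm w)) ∂ν := by
    rw [integral_finsetSum]
    · refine Finset.sum_congr rfl fun i _ => ?_
      exact (ContinuousLinearMap.integral_comp_comm
        (ContinuousLinearMap.smulRightL ℝ F ℂ (LinearMap.toContinuousLinearMap (b.coord i)))
        ((hdu i).integrable _)).symm
    · intro i _
      exact (ContinuousLinearMap.smulRightL ℝ F ℂ
        (LinearMap.toContinuousLinearMap (b.coord i))).integrable_comp ((hdu i).integrable _)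
  rw [hsum]
  refine hasFDerivAt_integral_of_dominated_of_fderiv_le
    (F' := fun w t => ∑ i, (LinearMap.toContinuousLinearMap (b.coord i)).smulRight
        (chartDer ρ (b i) (u t) (φ.symm w)))
    (bound := fun t => ∑ i, ‖LinearMap.toContinuousLinearMap (b.coord i)‖ * B i t)
    (Metric.isOpen_ball.mem_nhds hw) ?_ ?_ ?_ ?_ ?_ ?_
  · exact Filter.Eventually.of_forall fun w => (hu []).1 _
  · exact hu.integrable _
  · refine Finset.aestronglyMeasurable_fun_sum _ fun i _ => ?_
    exact (hsm i).comp_aestronglyMeasurable ((hdu i []).1 _)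
  · filter_upwards [MeasureTheory.ae_all_iff.2 hBb] with t ht w hw
    refine (norm_sum_le _ _).trans (Finset.sum_le_sum fun i _ => ?_)
    rw [ContinuousLinearMap.norm_smulRight_apply]
    exact mul_le_mul_of_nonneg_left
      (ht i _ ⟨w, Metric.ball_subset_closedBall hw, rfl⟩) (norm_nonneg _)
  · exact integrable_finsetSum _ fun i _ => (hB i).const_mul _
  · refine Filter.Eventually.of_forall fun t w hw => ?_
    have h1 : DifferentiableAt ℝ (fun w => u t (φ.symm w)) w :=
      ((u t).contDiffAt_extChartAt_symm
        (mem_target_of_mem_ball ρ (Metric.ball_subset_closedBall hw))).differentiableAt (by simp)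
    have h2 := h1.hasFDerivAt
    rw [fderiv_eq_sum b (fderiv ℝ (fun w => u t (φ.symm w)) w)] at h2
    rw [Finset.sum_congr rfl fun i _ => by rw [chartDer_symm_apply ρ (u t) (b i) hw]]
    exact h2

/-- The partial derivatives of the integral are integrals of the derived families, which are
dominated again by `der`; this drives the induction. -/
theorem contDiffOn_integral (hu : DominatedFamily ν u) :
    ContDiffOn ℝ ∞ (fun w => ∫ t, u t ((extChartAt 𝓘(ℝ, F) c).symm w) ∂ν)
      (Metric.ball (extChartAt 𝓘(ℝ, F) c c) ρ.rIn) := by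
  let b := Module.finBasis ℝ F
  rw [contDiffOn_infty]
  intro n
  induction n generalizing u with
  | zero =>
    exact contDiffOn_zero.2 fun w hw =>
      (hasFDerivAt_integral ρ b hu hw).continuousAt.continuousWithinAt
  | succ n ih =>
    rw [Nat.cast_add, Nat.cast_one, contDiffOn_succ_iff_fderiv_of_isOpen Metric.isOpen_ball]
    refine ⟨fun w hw => (hasFDerivAt_integral ρ b hu hw).differentiableAt.differentiableWithinAt,
      by simp, ?_⟩
    refine ContDiffOn.congr ?_ fun w hw => (hasFDerivAt_integral ρ b hu hw).fderiv
    refine ContDiffOn.sum fun i _ => ?_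
    exact (ContinuousLinearMap.smulRightL ℝ F ℂ
      (LinearMap.toContinuousLinearMap (b.coord i))).contDiff.comp_contDiffOn (ih (hu.der _))

theorem contMDiff_integral (hu : DominatedFamily ν u) :
    ContMDiff 𝓘(ℝ, F) 𝓘(ℝ, ℂ) ∞ (fun z => ∫ t, u t z ∂ν) := by
  intro z
  let ρ : SmoothBumpFunction 𝓘(ℝ, F) z := Classical.arbitrary _
  have h1 : ContDiffAt ℝ ∞ (fun w => ∫ t, u t ((extChartAt 𝓘(ℝ, F) z).symm w) ∂ν)
      (extChartAt 𝓘(ℝ, F) z z) :=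
    (hu.contDiffOn_integral ρ).contDiffAt (Metric.ball_mem_nhds _ ρ.rIn_pos)
  refine (h1.contMDiffAt.comp z contMDiffAt_extChartAt).congr_of_eventuallyEq ?_
  filter_upwards [(chartAt F z).open_source.mem_nhds (mem_chart_source F z)] with x hx
  have hx' : x ∈ (extChartAt 𝓘(ℝ, F) z).source := by simpa using hx
  simp only [Function.comp_apply, (extChartAt 𝓘(ℝ, F) z).left_inv hx']

/-- The integral of a dominated family of smooth functions. -/
def integral (hu : DominatedFamily ν u) : SmoothFun F N :=
  SmoothFun.mk (fun z => ∫ t, u t z ∂ν) hu.contMDiff_integral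

theorem integral_apply (hu : DominatedFamily ν u) (z : N) :
    hu.integral z = ∫ t, u t z ∂ν := rfl

end DominatedFamily

/-- Frame expansion of a vector field at points close to the centre of a chart. -/
theorem vecField_apply_eq_sum {ι : Type*} [Fintype ι] (b : Module.Basis ι ℝ F) {c : N}
    (ρ : SmoothBumpFunction 𝓘(ℝ, F) c) {z : N} (hz : z ∈ (chartAt F c).source)
    (hd : dist (extChartAt 𝓘(ℝ, F) c z) (extChartAt 𝓘(ℝ, F) c c) < ρ.rIn)
    (x : VecField F N) (h : SmoothFun F N) :
    x h z = ∑ i, x (chartCoord ρ (LinearMap.toContinuousLinearMap (b.coord i))) z *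
      chartDer ρ (b i) h z :=
  pointDerivation_eq_sum ρ b hz hd
    (D := (SmoothFun.evalHom z).toLinearMap ∘ₗ (x : SmoothFun F N →ₗ[ℂ] SmoothFun F N))
    (fun h k => by simp [Derivation.leibniz]) h

/-- Vector fields can be applied under the integral sign. -/
theorem DominatedFamily.apply_integral {T : Type*} [MeasurableSpace T] {ν : Measure T}
    {u : T → SmoothFun F N} (hu : DominatedFamily ν u) (x : VecField F N) :
    x hu.integral = (hu.der x).integral := by
  ext z
  let b := Module.finBasis ℝ F
  let ρ : SmoothBumpFunction 𝓘(ℝ, F) z := Classical.arbitrary _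
  have hb : extChartAt 𝓘(ℝ, F) z z ∈ Metric.ball (extChartAt 𝓘(ℝ, F) z z) ρ.rIn :=
    Metric.mem_ball_self ρ.rIn_pos
  -- The coefficients depend on `x` and `z` but not on `h`, so commuting `x` with the integral
  -- reduces to coordinate derivatives.
  have key := fun h => vecField_apply_eq_sum b ρ (mem_chart_source F z) hb x h
  have h1 : ∀ i, chartDer ρ (b i) hu.integral z = ∫ t, chartDer ρ (b i) (u t) z ∂ν := by
    intro i
    rw [chartDer_apply, ρ.eq_one, one_smul]
    change fderiv ℝ (fun w => ∫ t, u t ((extChartAt 𝓘(ℝ, F) z).symm w) ∂ν) _ _ = _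
    rw [(hasFDerivAt_integral ρ b hu hb).fderiv]
    rw [extChartAt_to_inv]
    simp [Finsupp.single_apply, Finset.sum_ite_eq, sum_apply, ite_smul]
  have h2 : (fun t => x (u t) z) = fun t => _ := funext fun t => key (u t)
  rw [key, (hu.der x).integral_apply, h2, integral_finsetSum]
  · refine Finset.sum_congr rfl fun i _ => ?_
    rw [h1, integral_const_mul]
  · intro i _
    exact ((hu.der _).integrable z).const_mul _

/-- The function `z ↦ G (z, t)`. -/
def slice {G : N × ℝ → ℂ} (hG : ContMDiff (𝓘(ℝ, F).prod 𝓘(ℝ, ℝ)) 𝓘(ℝ, ℂ) ∞ G) (t : ℝ) :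
    SmoothFun F N :=
  SmoothFun.mk (fun z => G (z, t)) (hG.comp (contMDiff_id.prodMk contMDiff_const))

@[simp] theorem slice_apply {G : N × ℝ → ℂ}
    (hG : ContMDiff (𝓘(ℝ, F).prod 𝓘(ℝ, ℝ)) 𝓘(ℝ, ℂ) ∞ G) (t : ℝ) (z : N) :
    slice hG t z = G (z, t) := rfl

/-- Near a point `x` is a combination of coordinate derivatives with coefficients independent of the
slice, and those derivatives are jointly smooth in the point and the parameter. -/
theorem contMDiff_apply_slice {G : N × ℝ → ℂ}
    (hG : ContMDiff (𝓘(ℝ, F).prod 𝓘(ℝ, ℝ)) 𝓘(ℝ, ℂ) ∞ G) (x : VecField F N) :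
    ContMDiff (𝓘(ℝ, F).prod 𝓘(ℝ, ℝ)) 𝓘(ℝ, ℂ) ∞ (fun p : N × ℝ => x (slice hG p.2) p.1) := by
  intro p
  let b := Module.finBasis ℝ F
  let ρ : SmoothBumpFunction 𝓘(ℝ, F) p.1 := Classical.arbitrary _
  have hnear : ∀ᶠ z in 𝓝 p.1, z ∈ (chartAt F p.1).source ∧
      dist (extChartAt 𝓘(ℝ, F) p.1 z) (extChartAt 𝓘(ℝ, F) p.1 p.1) < ρ.rIn :=
    Filter.Eventually.and ((chartAt F p.1).open_source.mem_nhds (mem_chart_source F p.1))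
      ((continuousAt_extChartAt (I := 𝓘(ℝ, F)) p.1).eventually
        (Metric.ball_mem_nhds _ ρ.rIn_pos))
  have h1 : ContMDiffAt (𝓘(ℝ, F).prod 𝓘(ℝ, ℝ)) 𝓘(ℝ, ℂ) ∞ (fun q : N × ℝ => ∑ i,
      x (chartCoord ρ (LinearMap.toContinuousLinearMap (b.coord i))) q.1 *
        chartDer ρ (b i) (slice hG q.2) q.1) p := by
    refine ContMDiffAt.sum fun i _ => ?_
    have h2 : ContMDiffAt (𝓘(ℝ, F).prod 𝓘(ℝ, ℝ)) 𝓘(ℝ, ℂ) ∞ (fun q : N × ℝ =>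
        x (chartCoord ρ (LinearMap.toContinuousLinearMap (b.coord i))) q.1) p :=
      ((SmoothFun.smooth _).comp contMDiff_fst).contMDiffAt
    have h3 := (contMDiff_chartDer_param ρ hG (b i)).contMDiffAt (x := p)
    exact ((contDiff_mul (𝕜 := ℝ) (𝔸 := ℂ) (n := ∞)).contMDiff.contMDiffAt (x := _)).comp p
      (h2.prodMk_space h3)
  refine h1.congr_of_eventuallyEq ?_
  filter_upwards [(continuous_fst.tendsto p).eventually hnear] with q hq
  exact vecField_apply_eq_sum b ρ hq.1 hq.2 x _

theorem contMDiff_derWord_slice {G : N × ℝ → ℂ}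
    (hG : ContMDiff (𝓘(ℝ, F).prod 𝓘(ℝ, ℝ)) 𝓘(ℝ, ℂ) ∞ G) (D : List (VecField F N)) :
    ContMDiff (𝓘(ℝ, F).prod 𝓘(ℝ, ℝ)) 𝓘(ℝ, ℂ) ∞
      (fun p : N × ℝ => derWord D (slice hG p.2) p.1) := by
  induction D with
  | nil => exact hG
  | cons x D ih => exact contMDiff_apply_slice ih x

/-- Uniform bounds for the derivatives of the slices on a compact set. -/
theorem exists_bound_derWord_slice {G : N × ℝ → ℂ}
    (hG : ContMDiff (𝓘(ℝ, F).prod 𝓘(ℝ, ℝ)) 𝓘(ℝ, ℂ) ∞ G) (D : List (VecField F N))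
    {K : Set N} (hK : IsCompact K) :
    ∃ C : ℝ, ∀ t ∈ Set.Icc (0 : ℝ) 1, ∀ z ∈ K, ‖derWord D (slice hG t) z‖ ≤ C := by
  obtain ⟨C, hC⟩ := (hK.prod (isCompact_Icc (a := (0 : ℝ)) (b := 1))).exists_bound_of_continuousOn
    (contMDiff_derWord_slice hG D).continuous.continuousOn
  exact ⟨C, fun t ht z hz => hC (z, t) ⟨hz, ht⟩⟩

theorem dominatedFamily_slice {G : N × ℝ → ℂ}
    (hG : ContMDiff (𝓘(ℝ, F).prod 𝓘(ℝ, ℝ)) 𝓘(ℝ, ℂ) ∞ G) :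
    DominatedFamily (volume.restrict (Set.Ioc (0 : ℝ) 1)) (slice hG) := by
  intro D
  refine ⟨fun z => ?_, fun K hK => ?_⟩
  · exact ((contMDiff_derWord_slice hG D).continuous.comp
      (by fun_prop : Continuous fun t : ℝ => (z, t))).aestronglyMeasurable
  · obtain ⟨C, hC⟩ := exists_bound_derWord_slice hG D hK
    refine ⟨fun _ => C, integrable_const _, ?_⟩
    filter_upwards [ae_restrict_mem measurableSet_Ioc] with t ht z hz
    exact hC t ⟨ht.1.le, ht.2⟩ z hz

theorem RapidDecay.exists_summable_bound {u : ℤ → SmoothFun F N} (hu : RapidDecay u)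
    (D : List (VecField F N)) {K : Set N} (hK : IsCompact K) :
    ∃ b : ℤ → ℝ, Summable b ∧ ∀ n, ∀ z ∈ K, ‖derWord D (u n) z‖ ≤ b n := by
  obtain ⟨C₀, h0⟩ := hu D K hK 0
  obtain ⟨C₂, h2⟩ := hu D K hK 2
  -- Quadratic decay gives a summable tail but no information at n = 0, where its weight is zero;
  -- the bound of order zero supplies that single term.
  refine ⟨fun n => |C₂| * (1 / (n : ℝ) ^ 2) + (Pi.single 0 |C₀| : ℤ → ℝ) n,
    ((Real.summable_one_div_int_pow.2 one_lt_two).mul_left _).add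
      (hasSum_pi_single 0 |C₀|).summable, fun n z hz => ?_⟩
  rcases eq_or_ne n 0 with rfl | hn
  · have := h0 0 z hz
    simp only [pow_zero, one_mul] at this
    simpa using this.trans (le_abs_self _)
  · have h3 := (h2 n z hz).trans (le_abs_self _)
    have hn' : (0 : ℝ) < (n : ℝ) ^ 2 := by positivity
    rw [sq_abs] at h3
    simp only [Pi.single_apply, hn, if_false, add_zero]
    rw [mul_one_div, le_div_iff₀ hn', mul_comm]
    exact h3

/-- A series is an integral against counting measure. Thus the same theorems cover weight
components, which are integrals over time, and Fourier sums. -/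
theorem RapidDecay.dominatedFamily {u : ℤ → SmoothFun F N} (hu : RapidDecay u) :
    DominatedFamily Measure.count u := by
  intro D
  refine ⟨fun z => StronglyMeasurable.of_discrete.aestronglyMeasurable, fun K hK => ?_⟩
  obtain ⟨b, hb, hb'⟩ := hu.exists_summable_bound D hK
  exact ⟨b, integrable_count_iff.2 hb.norm, Filter.Eventually.of_forall hb'⟩

theorem RapidDecay.der {u : ℤ → SmoothFun F N} (hu : RapidDecay u) (x : VecField F N) :
    RapidDecay (fun n => x (u n)) := by
  intro D K hK m
  have := hu (D ++ [x]) K hK m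
  simpa only [List.foldr_append, List.foldr_cons, List.foldr_nil] using this

/-- The sum of a rapidly decreasing sequence of smooth functions. -/
def RapidDecay.sum {u : ℤ → SmoothFun F N} (hu : RapidDecay u) : SmoothFun F N :=
  hu.dominatedFamily.integral

theorem RapidDecay.hasSum {u : ℤ → SmoothFun F N} (hu : RapidDecay u) (z : N) :
    HasSum (fun n => u n z) (hu.sum z) := by
  obtain ⟨b, hb, hb'⟩ := hu.exists_summable_bound [] (isCompact_singleton (x := z))
  have hs : Summable (fun n => u n z) := Summable.of_norm_bounded hb fun n => hb' n z rfl
  have h1 : hu.sum z = ∑' n, u n z := by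
    change ∫ n, u n z ∂Measure.count = _
    rw [integral_countable (hu.dominatedFamily.integrable z)]
    simp [Measure.real]
  rw [h1]
  exact hs.hasSum

/-- Rapidly convergent series can be differentiated term by term. -/
theorem RapidDecay.apply_hasSum {u : ℤ → SmoothFun F N} (hu : RapidDecay u) (x : VecField F N)
    (z : N) : HasSum (fun n => x (u n) z) (x hu.sum z) := by
  have h1 : x hu.sum = (hu.der x).sum := hu.dominatedFamily.apply_integral x
  rw [h1]
  exact (hu.der x).hasSum z

end Families

/-! ### Fourier analysis along the circle orbits. -/

namespace CircleBundle

theorem rot_zero : rot 0 = 1 := by simp [rot]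

theorem rot_add (s t : ℝ) : rot (s + t) = rot s * rot t := by
  rw [rot, rot, rot, mul_add, Circle.exp_add]

theorem rot_one : rot 1 = 1 := by simp [rot]

theorem rot_surjective (t : Circle) : ∃ s : ℝ, rot s = t := by
  refine ⟨Complex.arg t / (2 * Real.pi), ?_⟩
  rw [rot, mul_div_cancel₀ _ (by positivity), Circle.exp_arg]

/-- The eigenvalue `-2πi n` of the generator on sections of weight `-n`. -/
def weightConst (n : ℤ) : ℂ := -(2 * Real.pi * Complex.I * n)

theorem weightConst_add (n m : ℤ) : weightConst (n + m) = weightConst n + weightConst m := by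
  simp only [weightConst]; push_cast; ring

theorem weightConst_zero : weightConst 0 = 0 := by simp [weightConst]

theorem coe_rot_zpow (n : ℤ) (t : ℝ) :
    ((rot t : Circle) : ℂ) ^ (-n) = Complex.exp (weightConst n * t) := by
  rw [rot, Circle.coe_exp, ← Complex.exp_int_mul, weightConst]
  congr 1
  push_cast
  ring

theorem exp_weightConst_neg_one (n : ℤ) : Complex.exp (weightConst n * 1) = 1 := by
  have := coe_rot_zpow n 1
  rw [rot_one] at this
  simpa using this.symm

section

variable {E : Type*} [NormedAddCommGroup E] [NormedSpace ℝ E]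
  {M : Type*} [TopologicalSpace M] [ChartedSpace E M]
  {F : Type*} [NormedAddCommGroup F] [NormedSpace ℝ F] [FiniteDimensional ℝ F]
  {Z : Type*} [TopologicalSpace Z] [ChartedSpace F Z] [IsManifold 𝓘(ℝ, F) ∞ Z] [T2Space Z]
  [MulAction Circle Z] (P : CircleBundle E F M Z)

theorem orbit_continuous (P : CircleBundle E F M Z) (h : SmoothFun F Z) (z : Z)
    : Continuous (fun t : ℝ => h (rot t • z)) :=
  (P.orbit_differentiable h z).continuous

theorem generator_apply (h : SmoothFun F Z) (z : Z) :
    P.generator h z = deriv (fun t : ℝ => h (rot t • z)) 0 := rfl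

theorem hasDerivAt_orbit (h : SmoothFun F Z) (z : Z) (t : ℝ) :
    HasDerivAt (fun t : ℝ => h (rot t • z)) (P.generator h (rot t • z)) t := by
  have h1 : HasDerivAt (fun s : ℝ => h (rot s • (rot t • z))) (P.generator h (rot t • z)) 0 :=
    (P.orbit_differentiable h (rot t • z) 0).hasDerivAt
  have h2 : HasDerivAt (fun s : ℝ => h (rot (s + t) • z)) (P.generator h (rot t • z)) 0 := by
    simpa only [rot_add, mul_smul] using h1
  have h3 := HasDerivAt.comp_sub_const (a := t) (x := t) (by simpa using h2)
  simpa only [sub_add_cancel] using h3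

theorem mem_lineSec_iff_rot {n : ℤ} {u : SmoothFun F Z} :
    u ∈ P.lineSec n ↔ ∀ (t : ℝ) z, u (rot t • z) = Complex.exp (weightConst n * t) * u z := by
  constructor
  · intro h t z
    rw [← coe_rot_zpow]
    exact h (rot t) z
  · intro h t z
    obtain ⟨s, rfl⟩ := rot_surjective t
    rw [coe_rot_zpow]
    exact h s z

/-- Equivariance is the solution of the linear differential equation along the orbit:
differentiating at time zero gives the eigenvalue, and conversely the function multiplied by the
inverse phase has zero derivative along the orbit. -/
theorem mem_lineSec_iff {n : ℤ} {u : SmoothFun F Z} :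
    u ∈ P.lineSec n ↔ P.generator u = weightConst n • u := by
  rw [mem_lineSec_iff_rot]
  have hexp : ∀ (a : ℂ) (t : ℝ), HasDerivAt (fun t : ℝ => Complex.exp (a * t))
      (Complex.exp (a * t) * a) t := fun a t => by
    have h2 : HasDerivAt (fun t : ℝ => a * (t : ℂ)) a t := by
      simpa using (Complex.ofRealCLM.hasDerivAt (x := t)).const_mul a
    exact h2.cexp
  constructor
  · intro h
    ext z
    rw [generator_apply]
    simp only [h]
    have h3 := ((hexp (weightConst n) 0).mul_const (u z)).deriv
    simpa using h3
  · intro h t z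
    have h1 : ∀ t : ℝ, HasDerivAt (fun t : ℝ => Complex.exp (-weightConst n * t) * u (rot t • z))
        0 t := by
      intro t
      refine ((hexp (-weightConst n) t).mul (P.hasDerivAt_orbit u z t)).congr_deriv ?_
      rw [h, SmoothFun.smul_apply]
      ring
    have h2 := is_const_of_deriv_eq_zero (fun t => (h1 t).differentiableAt)
      (fun t => (h1 t).deriv) t 0
    simp only [rot_zero, one_smul, Complex.ofReal_zero, mul_zero, Complex.exp_zero, one_mul] at h2
    rw [← h2, ← mul_assoc, ← Complex.exp_add]
    simp

theorem mul_mem_lineSec {n m : ℤ} {u w : SmoothFun F Z} (hu : u ∈ P.lineSec n)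
    (hw : w ∈ P.lineSec m) : u * w ∈ P.lineSec (n + m) := by
  rw [mem_lineSec_iff] at *
  rw [Derivation.leibniz, hu, hw, weightConst_add, add_smul]
  simp only [smul_eq_mul, mul_smul_comm, mul_comm w u]
  abel

theorem twist_smooth (P : CircleBundle E F M Z) (n : ℤ) (h : SmoothFun F Z) :
    ContMDiff (𝓘(ℝ, F).prod 𝓘(ℝ, ℝ)) 𝓘(ℝ, ℂ) ∞
      (fun p : Z × ℝ => Complex.exp (2 * Real.pi * Complex.I * n * p.2) * h (rot p.2 • p.1)) := by
  have h1 : ContDiff ℝ ∞ (fun t : ℝ => Complex.exp (2 * Real.pi * Complex.I * n * t)) :=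
    Complex.contDiff_exp.comp (contDiff_const.mul Complex.ofRealCLM.contDiff)
  exact ((contDiff_mul (𝕜 := ℝ) (𝔸 := ℂ) (n := ∞)).contMDiff.comp
    (ContMDiff.prodMk_space (h1.contMDiff.comp contMDiff_snd) (P.orbit_smooth h)) :)

/-- The weight component of a smooth function, as a smooth function. -/
def comp (n : ℤ) : SmoothFun F Z →ₗ[ℂ] SmoothFun F Z where
  toFun h := (dominatedFamily_slice (P.twist_smooth n h)).integral
  map_add' h k := by
    ext z
    simp only [DominatedFamily.integral_apply, SmoothFun.add_apply]
    rw [← integral_add ((dominatedFamily_slice (P.twist_smooth n h)).integrable z)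
      ((dominatedFamily_slice (P.twist_smooth n k)).integrable z)]
    simp only [slice_apply, mul_add]
  map_smul' c h := by
    ext z
    simp only [DominatedFamily.integral_apply, SmoothFun.smul_apply, RingHom.id_apply]
    rw [← integral_const_mul]
    simp only [slice_apply, mul_left_comm]

theorem comp_apply (n : ℤ) (h : SmoothFun F Z) (z : Z) :
    P.comp n h z = weightComponent n h z := by
  rw [weightComponent, intervalIntegral.integral_of_le zero_le_one]
  rfl

theorem comp_apply' (n : ℤ) (h : SmoothFun F Z) (z : Z) :
    P.comp n h z = ∫ t in (0 : ℝ)..1, Complex.exp (-weightConst n * t) * h (rot t • z) := by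
  rw [comp_apply, weightComponent]
  simp [weightConst]

theorem twist_continuous (P : CircleBundle E F M Z) (n : ℤ) (h : SmoothFun F Z) (z : Z) :
    Continuous (fun t : ℝ => Complex.exp (-weightConst n * t) * h (rot t • z)) :=
  (by fun_prop : Continuous fun t : ℝ => Complex.exp (-weightConst n * t)).mul
    (P.orbit_continuous h z)

/-- The integrand has period one, so moving the base point along its orbit translates the integrand
without changing its integral over a period, up to the phase. -/
theorem comp_mem (n : ℤ) (h : SmoothFun F Z) : P.comp n h ∈ P.lineSec n := by
  rw [mem_lineSec_iff_rot]
  intro s z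
  rw [comp_apply', comp_apply']
  have hper : Function.Periodic
      (fun t : ℝ => Complex.exp (-weightConst n * t) * h (rot t • z)) 1 := by
    intro t
    simp only [rot_add, rot_one, mul_one]
    congr 1
    have := exp_weightConst_neg_one (-n)
    push_cast
    rw [mul_add, Complex.exp_add]
    simp only [weightConst, Int.cast_neg] at this ⊢
    simp only [mul_neg, neg_neg] at this ⊢
    rw [this, mul_one]
  have h1 : ∀ t : ℝ, Complex.exp (-weightConst n * t) * h (rot t • rot s • z) =
      Complex.exp (weightConst n * s) *
        (fun t : ℝ => Complex.exp (-weightConst n * t) * h (rot t • z)) (t + s) := by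
    intro t
    simp only [rot_add, mul_smul]
    rw [← mul_assoc, ← Complex.exp_add]
    congr 2
    push_cast
    ring
  simp only [h1]
  rw [intervalIntegral.integral_const_mul, intervalIntegral.integral_comp_add_right
    (fun t : ℝ => Complex.exp (-weightConst n * t) * h (rot t • z)), zero_add, add_comm (1 : ℝ) s,
    hper.intervalIntegral_add_eq s 0, zero_add]

theorem comp_mul {n : ℤ} {u : SmoothFun F Z} (hu : u ∈ P.lineSec n) (p : ℤ)
    (g : SmoothFun F Z) : P.comp p (u * g) = u * P.comp (p - n) g := by
  rw [mem_lineSec_iff_rot] at hu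
  ext z
  rw [SmoothFun.mul_apply, comp_apply', comp_apply', ← intervalIntegral.integral_const_mul]
  congr 1
  ext t
  rw [SmoothFun.mul_apply, hu]
  have h1 : Complex.exp (-weightConst (p - n) * t) =
      Complex.exp (-weightConst p * t) * Complex.exp (weightConst n * t) := by
    rw [← Complex.exp_add, sub_eq_add_neg, weightConst_add]
    congr 1
    simp only [weightConst]
    push_cast
    ring
  rw [h1]
  ring

/-- Integration by parts along the orbit; the boundary terms cancel by periodicity. -/
theorem comp_generator (n : ℤ) (h : SmoothFun F Z) :
    P.comp n (P.generator h) = weightConst n • P.comp n h := by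
  ext z
  rw [SmoothFun.smul_apply, comp_apply', comp_apply']
  have h1 : ∀ t ∈ Set.uIcc (0 : ℝ) 1,
      HasDerivAt (fun t : ℝ => Complex.exp (-weightConst n * t) * h (rot t • z))
        (Complex.exp (-weightConst n * t) * P.generator h (rot t • z) -
          weightConst n * (Complex.exp (-weightConst n * t) * h (rot t • z))) t := by
    intro t _
    have h2 : HasDerivAt (fun t : ℝ => -weightConst n * (t : ℂ)) (-weightConst n) t := by
      simpa using (Complex.ofRealCLM.hasDerivAt (x := t)).const_mul (-weightConst n)
    refine (h2.cexp.mul (P.hasDerivAt_orbit h z t)).congr_deriv ?_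
    ring
  have hc1 := P.twist_continuous n (P.generator h) z
  have hc2 : Continuous fun t : ℝ =>
      weightConst n * (Complex.exp (-weightConst n * t) * h (rot t • z)) :=
    continuous_const.mul (P.twist_continuous n h z)
  have h3 := intervalIntegral.integral_eq_sub_of_hasDerivAt h1
    ((hc1.sub hc2).intervalIntegrable _ _)
  rw [intervalIntegral.integral_sub (hc1.intervalIntegrable _ _) (hc2.intervalIntegrable _ _),
    intervalIntegral.integral_const_mul] at h3
  have h4 := exp_weightConst_neg_one (-n)
  have h5 : Complex.exp (-weightConst n) = 1 := by
    rw [← h4]; congr 1; simp [weightConst]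
  rw [← sub_eq_zero, h3]
  simp [rot_zero, rot_one, h5]

/-- The generator kills constants, so by `comp_generator` the component is annihilated by the
weight, which is nonzero unless n = 0. With `comp_mul` this yields the orthogonality relation
`comp_of_mem`. -/
theorem comp_one (n : ℤ) : P.comp n 1 = if n = 0 then 1 else 0 := by
  split_ifs with hn
  · subst hn
    ext z
    rw [comp_apply']
    simp [weightConst_zero]
  · have h1 := P.comp_generator n 1
    have h2 : P.generator (1 : SmoothFun F Z) = 0 := P.generator.map_one_eq_zero
    rw [h2, map_zero] at h1
    have h3 : weightConst n ≠ 0 := by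
      simp [weightConst, hn, Real.pi_ne_zero]
    exact (smul_eq_zero.1 h1.symm).resolve_left h3

theorem comp_of_mem {n : ℤ} {u : SmoothFun F Z} (hu : u ∈ P.lineSec n) (p : ℤ) :
    P.comp p u = if p = n then u else 0 := by
  have h1 := P.comp_mul hu p 1
  rw [mul_one, comp_one] at h1
  rw [h1]
  by_cases hp : p = n
  · simp [hp]
  · simp [hp, sub_eq_zero]

theorem derWord_integral {T : Type*} [MeasurableSpace T] {ν : Measure T}
    {u : T → SmoothFun F Z} (hu : DominatedFamily ν u) (D : List (VecField F Z)) (z : Z) :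
    derWord D hu.integral z = ∫ t, derWord D (u t) z ∂ν := by
  induction D using List.reverseRecOn generalizing u with
  | nil => rfl
  | append_singleton D x ih =>
    simp only [derWord_append_singleton]
    rw [hu.apply_integral x, ih (hu.der x)]

/-- The phase in the integrand is constant in `z` and has modulus one. It passes through all
derivatives, so the bound for the slices of the orbit map serves for every n at once. -/
theorem exists_bound_derWord_comp (h : SmoothFun F Z) (D : List (VecField F Z)) {K : Set Z}
    (hK : IsCompact K) : ∃ C : ℝ, ∀ n, ∀ z ∈ K, ‖derWord D (P.comp n h) z‖ ≤ C := by
  obtain ⟨C, hC⟩ := exists_bound_derWord_slice (P.orbit_smooth h) D hK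
  refine ⟨C, fun n z hz => ?_⟩
  have h1 : derWord D (P.comp n h) z = _ :=
    derWord_integral (dominatedFamily_slice (P.twist_smooth n h)) D z
  have h2 : ∀ t : ℝ, slice (P.twist_smooth n h) t =
      Complex.exp (2 * Real.pi * Complex.I * n * t) • slice (P.orbit_smooth h) t := fun t => rfl
  have h3 : ∀ t : ℝ, ‖Complex.exp (2 * Real.pi * Complex.I * n * t)‖ = 1 := fun t => by
    have h4 : (2 * Real.pi * Complex.I * n * t : ℂ) = ((2 * Real.pi * n * t : ℝ)
        : ℂ) * Complex.I := by
      push_cast; ring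
    rw [h4, Complex.norm_exp_ofReal_mul_I]
  rw [h1, ← intervalIntegral.integral_of_le zero_le_one]
  refine (intervalIntegral.norm_integral_le_of_norm_le_const (C := C) fun t ht =>
      ?_).trans (by simp)
  rw [Set.uIoc_of_le zero_le_one] at ht
  rw [h2, derWord, foldr_smul, SmoothFun.smul_apply, norm_mul, h3, one_mul]
  exact hC t ⟨ht.1.le, ht.2⟩ z hz

/-- Applying the generator N times multiplies the n-th component by the N-th power of its weight,
whose modulus 2π|n| is at least |n|. The uniform bound for the iterated derivative thus gives decay
of order N. -/
theorem rapidDecay_comp (h : SmoothFun F Z) : RapidDecay (fun n => P.comp n h) := by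
  intro D K hK N
  have hiter : ∀ (N : ℕ) (n : ℤ), P.comp n ((fun k => P.generator k)^[N] h) =
      weightConst n ^ N • P.comp n h := by
    intro N n
    induction N with
    | zero => simp
    | succ N ih => rw [Function.iterate_succ_apply', comp_generator, ih, smul_smul, pow_succ']
  obtain ⟨C, hC⟩ := P.exists_bound_derWord_comp ((fun k => P.generator k)^[N] h) D hK
  refine ⟨C, fun n z hz => le_trans ?_ (hC n z hz)⟩
  rw [hiter, derWord, foldr_smul, SmoothFun.smul_apply, norm_mul, norm_pow]
  refine mul_le_mul_of_nonneg_right (pow_le_pow_left₀ (abs_nonneg _) ?_ _) (norm_nonneg _)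
  have h1 : ‖weightConst n‖ = 2 * Real.pi * |(n : ℝ)| := by
    simp [weightConst, abs_of_pos Real.pi_pos]
  rw [h1]
  have h2 : 1 ≤ 2 * Real.pi := by linarith [Real.pi_gt_three]
  exact le_mul_of_one_le_left (abs_nonneg _) h2

/-- Fourier inversion along the orbits. -/
theorem hasSum_comp (h : SmoothFun F Z) (z : Z) : HasSum (fun n => P.comp n h z) (h z) := by
  have : Fact ((0 : ℝ) < 1) := ⟨one_pos⟩
  have hper : Function.Periodic (fun t : ℝ => h (rot t • z)) 1 := fun t => by
    simp only [rot_add, rot_one, mul_one]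
  let f : C(AddCircle (1 : ℝ), ℂ) :=
    ⟨hper.lift, continuous_coinduced_dom.2 (P.orbit_continuous h z)⟩
  -- Index n stands for the behaviour t^(-n), which reverses the sign relative to the usual Fourier
  -- index.
  have hf : ∀ n, fourierCoeff f n = P.comp (-n) h z := by
    intro n
    rw [fourierCoeff_eq_intervalIntegral f n 0, comp_apply']
    simp only [zero_add, div_one, one_smul, smul_eq_mul]
    congr 1
    ext t
    rw [fourier_coe_apply]
    congr 1
    simp [weightConst]
  have hs : Summable (fun n => P.comp n h z) := by
    obtain ⟨b, hb, hb'⟩ := (P.rapidDecay_comp h).exists_summable_bound []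
      (isCompact_singleton (x := z))
    exact Summable.of_norm_bounded hb fun n => hb' n z rfl
  have hs' : Summable (fourierCoeff f) := by
    have h1 : fourierCoeff f = (fun n => P.comp n h z) ∘ (Equiv.neg ℤ) := funext hf
    rw [h1]
    exact (Equiv.neg ℤ).summable_iff.2 hs
  have h2 := has_pointwise_sum_fourier_series_of_summable hs' ((0 : ℝ) : AddCircle (1 : ℝ))
  have h3 : f ((0 : ℝ) : AddCircle (1 : ℝ)) = h z := by
    change h (rot 0 • z) = h z
    rw [rot_zero, one_smul]
  rw [h3] at h2
  have h4 : (fun i => fourierCoeff f i • (fourier i ((0 : ℝ) : AddCircle (1 : ℝ)) : ℂ)) =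
      (fun n => P.comp n h z) ∘ (Equiv.neg ℤ) := by
    funext i
    rw [hf, fourier_coe_apply]
    simp
  rw [h4] at h2
  exact (Equiv.neg ℤ).hasSum_iff.1 h2

theorem isCompact_orbit (P : CircleBundle E F M Z) (z : Z) : IsCompact (Set.range fun t
    : Circle => t • z) := by
  have h1 : Continuous fun t : Circle => t • z :=
    P.act_smooth.continuous.comp (by fun_prop : Continuous fun t : Circle => (t, z))
  exact isCompact_range h1

/-- Weight components of a uniformly summable series. -/
theorem hasSum_comp_of_bound {u : ℤ → SmoothFun F Z} {S : SmoothFun F Z} {z : Z} {b : ℤ → ℝ}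
    (hb : Summable b) (hub : ∀ n (t : Circle), ‖u n (t • z)‖ ≤ b n)
    (hS : ∀ t : Circle, HasSum (fun n => u n (t • z)) (S (t • z))) (p : ℤ) :
    HasSum (fun n => P.comp p (u n) z) (P.comp p S z) := by
  simp only [comp_apply']
  refine intervalIntegral.hasSum_integral_of_dominated_convergence (fun n _ => b n) ?_ ?_ ?_ ?_ ?_
  · exact fun n => (P.twist_continuous p (u n) z).aestronglyMeasurable
  · refine fun n => Filter.Eventually.of_forall fun t _ => ?_
    have h4 : (-weightConst p * t : ℂ) = ((2 * Real.pi * p * t : ℝ) : ℂ) * Complex.I := by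
      simp only [weightConst]; push_cast; ring
    rw [norm_mul, h4, Complex.norm_exp_ofReal_mul_I, one_mul]
    exact hub n _
  · exact Filter.Eventually.of_forall fun t _ => hb
  · exact intervalIntegrable_const
  · exact Filter.Eventually.of_forall fun t _ => (hS _).mul_left _

theorem hasSum_comp_of_rapidDecay {u : ℤ → SmoothFun F Z} (hu : RapidDecay u)
    {S : SmoothFun F Z} (hS : ∀ z, HasSum (fun n => u n z) (S z)) (p : ℤ) (z : Z) :
    HasSum (fun n => P.comp p (u n) z) (P.comp p S z) := by
  obtain ⟨b, hb, hb'⟩ := hu.exists_summable_bound [] (P.isCompact_orbit z)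
  exact P.hasSum_comp_of_bound hb (fun n t => hb' n _ ⟨t, rfl⟩) (fun t => hS _) p

/-- Taking components commutes with the sum, and orthogonality retains one term. This uniqueness of
Fourier expansions shows that the decomposition is onto and identifies components of derived
objects. -/
theorem comp_of_hasSum {u : ℤ → SmoothFun F Z} (hu : RapidDecay u)
    (hw : ∀ n, u n ∈ P.lineSec n) {S : SmoothFun F Z} (hS : ∀ z, HasSum (fun n => u n z) (S z))
    (p : ℤ) : P.comp p S = u p := by
  ext z
  refine (P.hasSum_comp_of_rapidDecay hu hS p z).unique ?_
  have h1 : (fun n => P.comp p (u n) z) = fun n => if n = p then u p z else 0 := by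
    funext n
    rw [P.comp_of_mem (hw n)]
    by_cases h : n = p
    · simp [h]
    · simp [h, Ne.symm h]
  rw [h1]
  exact hasSum_ite_eq p (u p z)

/-- The product formula for weight components. -/
theorem hasSum_comp_mul (f g : SmoothFun F Z) (p : ℤ) (z : Z) :
    HasSum (fun n => P.comp n f z * P.comp (p - n) g z) (P.comp p (f * g) z) := by
  obtain ⟨b, hb, hb'⟩ := (P.rapidDecay_comp f).exists_summable_bound [] (P.isCompact_orbit z)
  obtain ⟨C, hC⟩ := (P.isCompact_orbit z).exists_bound_of_continuousOn g.continuous.continuousOn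
  -- Only `f` is expanded: each of its components has pure weight, so `comp_mul` turns the
  -- components of the product with `g` into the convolution. Boundedness of `g` on the compact
  -- orbit gives domination.
  have h1 := P.hasSum_comp_of_bound (u := fun n => P.comp n f * g) (S := f * g) (z := z)
    (hb.mul_right |C|) (fun n t => ?_) (fun t => ?_) p
  · simpa only [P.comp_mul (P.comp_mem _ f), SmoothFun.mul_apply] using h1
  · rw [SmoothFun.mul_apply, norm_mul]
    have h2 := hb' n _ ⟨t, rfl⟩
    exact mul_le_mul h2 ((hC _ ⟨t, rfl⟩).trans (le_abs_self _)) (norm_nonneg _)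
      ((norm_nonneg _).trans h2)
  · exact (P.hasSum_comp f _).mul_right _

/-- Invariant vector fields commute with taking weight components. -/
theorem comp_apply_of_invariant {y : VecField F Z} (hy : ⁅P.generator, y⁆ = 0) (n : ℤ)
    (h : SmoothFun F Z) : P.comp n (y h) = y (P.comp n h) := by
  -- An invariant field commutes with the generator and hence preserves weights, and it may be
  -- applied term by term; uniqueness of the expansion of `y h` concludes.
  refine P.comp_of_hasSum (u := fun n => y (P.comp n h)) ((P.rapidDecay_comp h).der y)
    (fun n => ?_) (fun z => ?_) n
  · have h1 := P.comp_mem n h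
    rw [mem_lineSec_iff] at h1 ⊢
    have h2 : ⁅P.generator, y⁆ (P.comp n h) = 0 := by rw [hy]; rfl
    rw [Derivation.commutator_apply, sub_eq_zero] at h2
    rw [h2, h1, Derivation.map_smul]
  · have h1 : (P.rapidDecay_comp h).sum = h := by
      ext z
      exact ((P.rapidDecay_comp h).hasSum z).unique (P.hasSum_comp h z)
    have h2 := (P.rapidDecay_comp h).apply_hasSum y z
    rwa [h1] at h2

theorem ext_comp {f g : SmoothFun F Z} (h : ∀ n, P.comp n f = P.comp n g) : f = g := by
  ext z
  refine (P.hasSum_comp f z).unique ?_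
  simp only [h]
  exact P.hasSum_comp g z

/-- The decomposition of smooth functions into weight components. -/
def funDecomposition : SmoothFun F Z ≃ₗ[ℂ] P.lineSum where
  toFun h := ⟨fun n => P.comp n h, fun n => P.comp_mem n h, P.rapidDecay_comp h⟩
  map_add' h k := Subtype.ext <| funext fun n => map_add _ h k
  map_smul' c h := Subtype.ext <| funext fun n => map_smul _ c h
  invFun u := u.2.2.sum
  left_inv h := by
    ext z
    exact ((P.rapidDecay_comp h).hasSum z).unique (P.hasSum_comp h z)
  right_inv u := Subtype.ext <| funext fun n =>
    P.comp_of_hasSum u.2.2 u.2.1 u.2.2.hasSum n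

@[simp] theorem funDecomposition_apply (h : SmoothFun F Z) (n : ℤ) :
    (P.funDecomposition h).1 n = P.comp n h := rfl

theorem comp_funDecomposition_symm (u : P.lineSum) (n : ℤ) :
    P.comp n (P.funDecomposition.symm u) = u.1 n := by
  rw [← funDecomposition_apply, LinearEquiv.apply_symm_apply]

end

end CircleBundle

/-! ### Local frames with a built-in cutoff. -/

/-- A family of vector fields near `m` together with coordinates that expand every derivation at a
point, after multiplication with a cutoff function. -/
structure LocalFrame (E : Type*) [NormedAddCommGroup E] [NormedSpace ℝ E]
    {M : Type*} [TopologicalSpace M] [ChartedSpace E M] (m : M) where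
  /-- The cutoff function. -/
  cutoff : SmoothFun E M
  /-- The coordinates. -/
  coord : Fin (Module.finrank ℝ E) → SmoothFun E M
  /-- The coordinate vector fields. -/
  vec : Fin (Module.finrank ℝ E) → VecField E M
  cutoff_eq_one : ∀ᶠ x in 𝓝 m, cutoff x = 1
  expand : ∀ (q : M) (D : SmoothFun E M →ₗ[ℂ] ℂ), (∀ h k, D (h * k) = h q * D k + k q * D h) →
    ∀ h, cutoff q * D h = ∑ i, D (coord i) * vec i h q

section LocalFrame

variable {E : Type*} [NormedAddCommGroup E] [NormedSpace ℝ E] [FiniteDimensional ℝ E]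
  {M : Type*} [TopologicalSpace M] [ChartedSpace E M] [IsManifold 𝓘(ℝ, E) ∞ M] [T2Space M]

/-- The coordinate expansion is valid only near `m`. A cutoff supported there makes it hold at every
point, since both sides vanish elsewhere. The explicit form of the fields is kept because it allows
them to be lifted to the total space. -/
theorem exists_localFrame_of_bump {m : M} (ρ : SmoothBumpFunction 𝓘(ℝ, E) m) :
    ∃ fr : LocalFrame E m, ∀ i, fr.vec i = fr.cutoff • chartDer ρ (Module.finBasis ℝ E i) := by
  have hnear : ∀ᶠ z in 𝓝 m, z ∈ (chartAt E m).source ∧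
      dist (extChartAt 𝓘(ℝ, E) m z) (extChartAt 𝓘(ℝ, E) m m) < ρ.rIn :=
    Filter.Eventually.and ((chartAt E m).open_source.mem_nhds (mem_chart_source E m))
      ((continuousAt_extChartAt (I := 𝓘(ℝ, E)) m).eventually
        (Metric.ball_mem_nhds _ ρ.rIn_pos))
  obtain ⟨χ, hχ, hs⟩ := exists_smoothFun_one_nhds (E := E) m hnear
  refine ⟨⟨χ, fun i => chartCoord ρ (LinearMap.toContinuousLinearMap
    ((Module.finBasis ℝ E).coord i)), fun i => χ • chartDer ρ (Module.finBasis ℝ E i), hχ, ?_⟩,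
    fun i => rfl⟩
  intro q D hD h
  by_cases hq : q ∈ tsupport χ
  · rw [pointDerivation_eq_sum ρ (Module.finBasis ℝ E) (hs hq).1 (hs hq).2 hD h, Finset.mul_sum]
    refine Finset.sum_congr rfl fun i _ => ?_
    rw [Derivation.smul_apply, smul_eq_mul, SmoothFun.mul_apply]
    ring
  · have h0 : χ q = 0 := image_eq_zero_of_notMem_tsupport hq
    simp [h0]

theorem exists_localFrame (m : M) : Nonempty (LocalFrame E m) :=
  ⟨(exists_localFrame_of_bump (Classical.arbitrary (SmoothBumpFunction 𝓘(ℝ, E) m))).choose⟩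

theorem LocalFrame.smul_vecField {m : M} (fr : LocalFrame E m) (x : VecField E M) :
    fr.cutoff • x = ∑ i, x (fr.coord i) • fr.vec i := by
  ext h q
  have := fr.expand q ((SmoothFun.evalHom q).toLinearMap ∘ₗ (x : SmoothFun E M →ₗ[ℂ] SmoothFun E M))
    (fun h k => by simp [Derivation.leibniz]) h
  rw [← Derivation.coeFnAddMonoidHom_apply (∑ i, _), map_sum, Finset.sum_apply,
    SmoothFun.sum_apply]
  simpa using this

/-- A vector field that vanishes at a point is annihilated there by every one-form. -/
theorem oneForm_apply_eq_zero (α : OneForm E M) {x : VecField E M} {q : M}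
    (hx : ∀ h, x h q = 0) : α x q = 0 := by
  obtain ⟨fr⟩ := exists_localFrame (E := E) q
  have h1 := congrArg (fun y => α y q) (fr.smul_vecField x)
  simp only [map_smul, map_sum, smul_eq_mul, SmoothFun.mul_apply, fr.cutoff_eq_one.self_of_nhds,
    one_mul, SmoothFun.sum_apply, hx, zero_mul, Finset.sum_const_zero] at h1
  exact h1

end LocalFrame

/-! ### Fibres of the projection, descent of invariant functions, vector fields along the
projection. -/

namespace CircleBundle

variable {E : Type*} [NormedAddCommGroup E] [NormedSpace ℝ E] [FiniteDimensional ℝ E]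
  {M : Type*} [TopologicalSpace M] [ChartedSpace E M] [IsManifold 𝓘(ℝ, E) ∞ M] [T2Space M]
  {F : Type*} [NormedAddCommGroup F] [NormedSpace ℝ F] [FiniteDimensional ℝ F]
  {Z : Type*} [TopologicalSpace Z] [ChartedSpace F Z] [IsManifold 𝓘(ℝ, F) ∞ Z] [T2Space Z]
  [MulAction Circle Z] (P : CircleBundle E F M Z)

@[simp] theorem pullFun_apply (h : SmoothFun E M) (z : Z) : P.pullFun h z = h (P.proj z) := rfl

theorem proj_surjective : Function.Surjective P.proj := by
  intro m
  obtain ⟨U, e, -, hm, hs, ht, -, -, he⟩ := P.locally_trivial m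
  have h1 : (m, (1 : Circle)) ∈ e.target := by rw [ht]; exact ⟨hm, trivial⟩
  refine ⟨e.symm (m, 1), ?_⟩
  rw [← (he _ (e.map_target h1)).1, e.right_inv h1]

/-- Equivariance of a trivialization does not say that the orbit stays in its domain. The times at
which the projection is unchanged form a closed set by continuity and an open one because it is the
preimage of that domain; connectedness of the line concludes. -/
theorem proj_rot (z : Z) (t : ℝ) : P.proj (rot t • z) = P.proj z := by
  have hcont : Continuous fun t : ℝ => rot t • z :=
    P.act_smooth.continuous.comp (f := fun t : ℝ => ((rot t, z) : Circle × Z))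
      ((Circle.exp.continuous.comp (by fun_prop : Continuous fun t : ℝ => 2 * Real.pi * t)).prodMk
        continuous_const)
  have hc : IsClosed {t : ℝ | P.proj (rot t • z) = P.proj z} :=
    isClosed_eq (P.proj_smooth.continuous.comp hcont) continuous_const
  obtain ⟨U, e, hU, hm, hs, -, -, -, he⟩ := P.locally_trivial (P.proj z)
  have hz : z ∈ e.source := by rw [hs]; exact hm
  have ho : IsOpen {t : ℝ | P.proj (rot t • z) = P.proj z} := by
    have h1 : {t : ℝ | P.proj (rot t • z) = P.proj z} = (fun t : ℝ => rot t • z) ⁻¹' e.source := by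
      ext t
      constructor
      · intro h
        rw [Set.mem_preimage, hs]
        change P.proj _ ∈ U
        rw [show P.proj (rot t • z) = P.proj z from h]
        exact hm
      · intro h
        change P.proj _ = _
        rw [← (he _ h).1, (he z hz).2]
    rw [h1]
    exact e.open_source.preimage hcont
  have h2 := IsClopen.eq_univ ⟨hc, ho⟩ ⟨0, by simp [rot_zero]⟩
  exact (Set.eq_univ_iff_forall.1 h2) t

theorem proj_smul (t : Circle) (z : Z) : P.proj (t • z) = P.proj z := by
  obtain ⟨s, rfl⟩ := rot_surjective t
  exact P.proj_rot z s

theorem exists_smul_eq {z z' : Z} (h : P.proj z = P.proj z') : ∃ t : Circle, t • z = z' := by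
  obtain ⟨U, e, -, hm, hs, -, -, -, he⟩ := P.locally_trivial (P.proj z)
  have hz : z ∈ e.source := by rw [hs]; exact hm
  have hz' : z' ∈ e.source := by rw [hs]; change P.proj z' ∈ U; rwa [← h]
  refine ⟨(e z').2 * ((e z).2)⁻¹, e.injOn ?_ hz' ?_⟩
  · rw [hs]; change P.proj _ ∈ U; rwa [P.proj_smul]
  · rw [(he z hz).2, inv_mul_cancel_right, h, ← (he z' hz').1]

theorem pullFun_mem (h : SmoothFun E M) : P.pullFun h ∈ P.lineSec 0 := by
  intro t z
  simp [P.proj_smul]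

theorem pullFun_injective : Function.Injective P.pullFun := by
  intro h k hk
  ext m
  obtain ⟨z, rfl⟩ := P.proj_surjective m
  exact congrArg (fun u : SmoothFun F Z => u z) hk

/-- Fibres are orbits, so an invariant function is constant on them. The descended function is
smooth because locally it is the composite with the smooth section `e.symm (·, 1)`. -/
theorem exists_pullFun_eq {u : SmoothFun F Z} (hu : u ∈ P.lineSec 0) :
    ∃ h : SmoothFun E M, P.pullFun h = u := by
  have hinv : ∀ z z', P.proj z = P.proj z' → u z = u z' := by
    intro z z' h
    obtain ⟨t, rfl⟩ := P.exists_smul_eq h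
    simpa using (hu t z).symm
  refine ⟨SmoothFun.mk (fun m => u (Function.surjInv P.proj_surjective m)) ?_, ?_⟩
  · intro m
    obtain ⟨U, e, hU, hm, hs, ht, -, hsm, he⟩ := P.locally_trivial m
    have h1 : ContMDiffAt 𝓘(ℝ, E) 𝓘(ℝ, ℂ) ∞ (fun m' => u (e.symm (m', 1))) m := by
      refine u.smooth.contMDiffAt.comp m ?_
      have h2 : (m, (1 : Circle)) ∈ e.target := by rw [ht]; exact ⟨hm, trivial⟩
      exact ((hsm _ h2).contMDiffAt (e.open_target.mem_nhds h2)).comp m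
        (contMDiffAt_id.prodMk contMDiffAt_const)
    refine h1.congr_of_eventuallyEq ?_
    filter_upwards [hU.mem_nhds hm] with m' hm'
    refine hinv _ _ ?_
    have h2 : (m', (1 : Circle)) ∈ e.target := by rw [ht]; exact ⟨hm', trivial⟩
    rw [Function.surjInv_eq P.proj_surjective m', ← (he _ (e.map_target h2)).1, e.right_inv h2]
  · ext z
    exact hinv _ _ (Function.surjInv_eq P.proj_surjective _)

theorem generator_pullFun (h : SmoothFun E M) : P.generator (P.pullFun h) = 0 := by
  have h1 := P.mem_lineSec_iff.1 (P.pullFun_mem h)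
  rwa [weightConst_zero, zero_smul] at h1

theorem push_apply (x : VecField F Z) (h : SmoothFun E M) :
    (P.push x).1 h = x (P.pullFun h) := rfl

theorem baseVec_apply (W : VecField E M) (h : SmoothFun E M) :
    (P.baseVec W).1 h = P.pullFun (W h) := rfl

theorem vecAlong_ext {X Y : P.VecAlong} (h : ∀ k, X.1 k = Y.1 k) : X = Y :=
  Subtype.ext (LinearMap.ext h)

@[simp] theorem vecAlong_add_apply (X Y : P.VecAlong) (h : SmoothFun E M) :
    (X + Y).1 h = X.1 h + Y.1 h := rfl

@[simp] theorem vecAlong_sub_apply (X Y : P.VecAlong) (h : SmoothFun E M) :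
    (X - Y).1 h = X.1 h - Y.1 h := rfl

@[simp] theorem vecAlong_smul_apply (r : SmoothFun F Z) (X : P.VecAlong) (h : SmoothFun E M) :
    (r • X).1 h = r * X.1 h := rfl

theorem vecAlong_sum_apply {ι : Type*} (s : Finset ι) (X : ι → P.VecAlong) (h : SmoothFun E M) :
    (∑ i ∈ s, X i).1 h = ∑ i ∈ s, (X i).1 h := by
  rw [AddSubmonoidClass.coe_finsetSum, LinearMap.sum_apply]

theorem push_generator : P.push P.generator = 0 :=
  P.vecAlong_ext fun h => P.generator_pullFun h

theorem baseVec_add (W W' : VecField E M) : P.baseVec (W + W') = P.baseVec W + P.baseVec W' :=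
  P.vecAlong_ext fun h => by simp [baseVec_apply]

theorem baseVec_smul (r : SmoothFun E M) (W : VecField E M) :
    P.baseVec (r • W) = P.pullFun r • P.baseVec W :=
  P.vecAlong_ext fun h => by simp [baseVec_apply]

theorem smul_vecAlong {m : M} (fr : LocalFrame E m) (X : P.VecAlong) :
    P.pullFun fr.cutoff • X = ∑ i, X.1 (fr.coord i) • P.baseVec (fr.vec i) := by
  refine P.vecAlong_ext fun h => ?_
  ext z
  have := fr.expand (P.proj z) ((SmoothFun.evalHom z).toLinearMap ∘ₗ X.1)
    (fun h k => by simp [X.2 h k]) h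
  rw [P.vecAlong_sum_apply, SmoothFun.sum_apply]
  simpa [baseVec_apply] using this

/-- A functional on vector fields along the projection is determined by its values on vector fields
of the base. -/
theorem dual_ext {ζ ζ' : Module.Dual (SmoothFun F Z) P.VecAlong}
    (h : ∀ W, ζ (P.baseVec W) = ζ' (P.baseVec W)) : ζ = ζ' := by
  ext X z
  obtain ⟨fr⟩ := exists_localFrame (E := E) (P.proj z)
  have h1 : ζ (P.pullFun fr.cutoff • X) = ζ' (P.pullFun fr.cutoff • X) := by
    rw [P.smul_vecAlong, map_sum, map_sum]
    simp only [map_smul, h]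
  have h2 := congrArg (fun u : SmoothFun F Z => u z) h1
  simpa [fr.cutoff_eq_one.self_of_nhds] using h2

/-! #### Gluing -/

/-- Smooth functions defined near the fibres glue. -/
def glue (χ : M → SmoothFun E M) (hχ : ∀ m, ∀ᶠ x in 𝓝 m, χ m x = 1) (f : M → SmoothFun F Z)
    (hf : ∀ m m', P.pullFun (χ m') * f m = P.pullFun (χ m) * f m') : SmoothFun F Z :=
  SmoothFun.mk (fun z => f (P.proj z) z) fun z => by
    refine (f (P.proj z)).smooth.contMDiffAt.congr_of_eventuallyEq ?_
    filter_upwards [(P.proj_smooth.continuous.tendsto z).eventually (hχ (P.proj z))] with w hw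
    have h1 := congrArg (fun u : SmoothFun F Z => u w) (hf (P.proj w) (P.proj z))
    simpa [hw, (hχ (P.proj w)).self_of_nhds] using h1

@[simp] theorem glue_apply (χ : M → SmoothFun E M) (hχ : ∀ m, ∀ᶠ x in 𝓝 m, χ m x = 1)
    (f : M → SmoothFun F Z)
    (hf : ∀ m m', P.pullFun (χ m') * f m = P.pullFun (χ m) * f m') (z : Z) :
    P.glue χ hχ f hf z = f (P.proj z) z := rfl

/-- Extension of `C^∞(M)`-linear functionals to vector fields along the projection. -/
theorem exists_dual_extension (ζ₀ : VecField E M → SmoothFun F Z)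
    (hadd : ∀ W W', ζ₀ (W + W') = ζ₀ W + ζ₀ W')
    (hsmul : ∀ (r : SmoothFun E M) W, ζ₀ (r • W) = P.pullFun r * ζ₀ W) :
    ∃ ζ : Module.Dual (SmoothFun F Z) P.VecAlong, ∀ W, ζ (P.baseVec W) = ζ₀ W := by
  let fr : ∀ m : M, LocalFrame E m := fun m => (exists_localFrame m).some
  have hsum : ∀ (s : Finset (Fin (Module.finrank ℝ E))) (W
      : Fin (Module.finrank ℝ E) → VecField E M),
      ζ₀ (∑ i ∈ s, W i) = ∑ i ∈ s, ζ₀ (W i) := by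
    intro s W
    have h0 : ζ₀ 0 = 0 := by simpa using hadd 0 0
    exact map_sum (⟨⟨ζ₀, h0⟩, hadd⟩ : VecField E M →+ SmoothFun F Z) W s
  let loc : M → P.VecAlong → SmoothFun F Z := fun m X =>
    ∑ i, X.1 ((fr m).coord i) * ζ₀ ((fr m).vec i)
  -- With `X` expanded in the frame at `m` and `ζ₀` in the frame at `m'`, both sides become one
  -- double sum over the two frames.
  have hcompat : ∀ X m m', P.pullFun (fr m').cutoff * loc m X =
      P.pullFun (fr m).cutoff * loc m' X := by
    intro X m m'
    have h1 : ∀ i, P.pullFun (fr m').cutoff * ζ₀ ((fr m).vec i) =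
        ∑ j, P.pullFun ((fr m).vec i ((fr m').coord j)) * ζ₀ ((fr m').vec j) := by
      intro i
      rw [← hsmul, (fr m').smul_vecField, hsum]
      simp only [hsmul]
    have h2 : ∀ j, P.pullFun (fr m).cutoff * X.1 ((fr m').coord j) =
        ∑ i, X.1 ((fr m).coord i) * P.pullFun ((fr m).vec i ((fr m').coord j)) := by
      intro j
      have := congrArg (fun Y : P.VecAlong => Y.1 ((fr m').coord j)) (P.smul_vecAlong (fr m) X)
      simpa [P.vecAlong_sum_apply, baseVec_apply] using this
    simp only [loc, Finset.mul_sum]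
    simp only [← mul_assoc, h2, Finset.sum_mul]
    rw [Finset.sum_comm]
    refine Finset.sum_congr rfl fun i _ => ?_
    rw [mul_comm (P.pullFun _), mul_assoc, h1, Finset.mul_sum]
    simp only [mul_assoc]
  refine ⟨{ toFun := fun X => P.glue (fun m => (fr m).cutoff) (fun m => (fr m).cutoff_eq_one)
              (fun m => loc m X) (hcompat X)
            map_add' := fun X Y => by
              ext z
              simp only [glue_apply, loc, SmoothFun.add_apply, vecAlong_add_apply, add_mul,
                Finset.sum_add_distrib]
            map_smul' := fun r X => by
              ext z
              simp only [glue_apply, loc, vecAlong_smul_apply, mul_assoc, ← Finset.mul_sum,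
                SmoothFun.mul_apply, smul_eq_mul, RingHom.id_apply] }, fun W => ?_⟩
  ext z
  change loc (P.proj z) (P.baseVec W) z = _
  have h1 : loc (P.proj z) (P.baseVec W) = P.pullFun (fr (P.proj z)).cutoff * ζ₀ W := by
    rw [← hsmul, (fr _).smul_vecField, hsum]
    simp only [hsmul, loc, baseVec_apply]
  rw [h1]
  simp [(fr (P.proj z)).cutoff_eq_one.self_of_nhds]

theorem oneFormAlong_baseVec (ξ : OneForm E M) (W : VecField E M) :
    P.oneFormAlong ξ (P.baseVec W) = P.pullFun (ξ W) := by
  have h := P.exists_dual_extension (fun W => P.pullFun (ξ W)) (fun W W' => by simp)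
    (fun r W => by simp)
  rw [oneFormAlong, dif_pos h]
  exact h.choose_spec W

/-! #### Vertical vector fields -/

/-- Under the action the circle coordinate of a trivialization has weight -1 and its inverse weight
1. Multiplied by a cutoff they become global functions, whose product is the square of that cutoff.
They serve to shift weights near a fibre. -/
theorem exists_local_section (m : M) : ∃ (χ : SmoothFun E M) (s s' : SmoothFun F Z),
    χ m = 1 ∧ s ∈ P.lineSec 1 ∧ s' ∈ P.lineSec (-1) ∧ s * s' = P.pullFun χ := by
  obtain ⟨U, e, hU, hm, hs, -, hsm, -, he⟩ := P.locally_trivial m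
  obtain ⟨χ, hχ, hχU⟩ := exists_smoothFun_one_nhds (E := E) m (hU.mem_nhds hm)
  have hsrc : ∀ z, χ (P.proj z) ≠ 0 → z ∈ e.source := fun z hz => by
    rw [hs]; exact hχU (subset_tsupport _ hz)
  have hsmooth : ∀ g : Circle → ℂ, ContMDiff (𝓡 1) 𝓘(ℝ, ℂ) ∞ g →
      ContMDiff 𝓘(ℝ, F) 𝓘(ℝ, ℂ) ∞ (fun z => χ (P.proj z) * g (e z).2) := by
    intro g hg z
    by_cases hz : P.proj z ∈ tsupport χ
    · have hz' : z ∈ e.source := by rw [hs]; exact hχU hz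
      have h1 : ContMDiffAt 𝓘(ℝ, F) 𝓘(ℝ, ℂ) ∞ (fun z => g (e z).2) z :=
        hg.contMDiffAt.comp z (contMDiffAt_snd.comp z
          ((hsm z hz').contMDiffAt (e.open_source.mem_nhds hz')))
      exact ((contDiff_mul (𝕜 := ℝ) (𝔸 := ℂ) (n := ∞)).contMDiff.contMDiffAt (x := _)).comp z
        ((P.pullFun χ).smooth.contMDiffAt.prodMk_space h1)
    · have h1 : ∀ᶠ w in 𝓝 z, χ (P.proj w) = 0 :=
        (P.proj_smooth.continuous.tendsto z).eventually (notMem_tsupport_iff_eventuallyEq.1 hz)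
      refine (contMDiffAt_const (c := (0 : ℂ))).congr_of_eventuallyEq (h1.mono fun x hx => ?_)
      simp only [hx, zero_mul]
  have hcoe : ContMDiff (𝓡 1) 𝓘(ℝ, ℂ) ∞ (fun t : Circle => (t : ℂ)) := by
    have : Fact (Module.finrank ℝ ℂ = 1 + 1) := ⟨Complex.finrank_real_complex⟩
    exact contMDiff_coe_sphere
  have hinv : ContMDiff (𝓡 1) 𝓘(ℝ, ℂ) ∞ (fun t : Circle => ((t⁻¹ : Circle) : ℂ)) := by
    exact hcoe.comp (contMDiff_inv (𝓡 1) ∞)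
  refine ⟨χ * χ, SmoothFun.mk _ (hsmooth _ hinv), SmoothFun.mk _ (hsmooth _ hcoe), ?_, ?_, ?_, ?_⟩
  · simp [hχ.self_of_nhds]
  · intro t z
    simp only [SmoothFun.mk_apply, P.proj_smul]
    by_cases hz : χ (P.proj z) = 0
    · simp [hz]
    · rw [((he z (hsrc z hz)).2 t), mul_inv]
      push_cast
      simp only [zpow_neg, zpow_one]
      ring
  · intro t z
    simp only [SmoothFun.mk_apply, P.proj_smul]
    by_cases hz : χ (P.proj z) = 0
    · simp [hz]
    · rw [((he z (hsrc z hz)).2 t)]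
      rw [show (-(-1) : ℤ) = 1 from rfl, zpow_one]
      push_cast
      ring
  · ext z
    simp only [SmoothFun.mul_apply, SmoothFun.mk_apply, pullFun_apply]
    rw [mul_mul_mul_comm]
    simp

theorem pow_mem_lineSec {n : ℤ} {u : SmoothFun F Z} (hu : u ∈ P.lineSec n) (k : ℕ) :
    u ^ k ∈ P.lineSec (k * n) := by
  induction k with
  | zero =>
    simp only [pow_zero, Nat.cast_zero, zero_mul]
    intro t z
    simp
  | succ k ih =>
    rw [pow_succ, show ((k + 1 : ℕ) : ℤ) * n = k * n + n by push_cast; ring]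
    exact P.mul_mem_lineSec ih hu

/-- Vertical derivations act on the weight spaces through the weight. -/
theorem vertical_apply_of_mem {x : VecField F Z} (hx : P.push x = 0) (z : Z) :
    ∃ κ : ℂ, ∀ (n : ℤ), ∀ u ∈ P.lineSec n, x u z = κ * P.generator u z := by
  obtain ⟨χ, s, s', hχ, hs, hs', hss⟩ := P.exists_local_section (P.proj z)
  have hpull : ∀ u ∈ P.lineSec 0, x u = 0 := by
    intro u hu
    obtain ⟨h, rfl⟩ := P.exists_pullFun_eq hu
    exact congrArg (fun Y : P.VecAlong => Y.1 h) hx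
  have h1 : s z * s' z = 1 := by
    have := congrArg (fun u : SmoothFun F Z => u z) hss
    simpa [hχ] using this
  have h2 : s z * x s' z + s' z * x s z = 0 := by
    have := congrArg (fun u : SmoothFun F Z => x u z) hss
    have h3 : x (P.pullFun χ) = 0 := hpull _ (P.pullFun_mem χ)
    simpa [h3, Derivation.leibniz] using this
  -- A vertical field kills invariant functions, so the Leibniz rule relates `x u` to `x w`. The
  -- additional factor `w z` avoids the exponent k - 1.
  have key : ∀ (k : ℕ) (u w : SmoothFun F Z), u * w ^ k ∈ P.lineSec 0 →
      x u z * w z ^ k * w z = -(k * u z * w z ^ k * x w z) := by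
    intro k u w hu
    have h3 := congrArg (fun u : SmoothFun F Z => u z) (hpull _ hu)
    rcases Nat.eq_zero_or_pos k with rfl | hk
    · have h4 : x u z = 0 := by simpa using h3
      simp [h4]
    · obtain ⟨j, rfl⟩ : ∃ j, k = j + 1 := ⟨k - 1, by omega⟩
      simp only [Derivation.leibniz, Derivation.leibniz_pow, smul_eq_mul, SmoothFun.add_apply,
        SmoothFun.mul_apply, SmoothFun.pow_apply, SmoothFun.zero_apply, nsmul_eq_mul,
        Nat.add_sub_cancel] at h3
      have h5 : (((j + 1 : ℕ) : SmoothFun F Z)) z = ((j + 1 : ℕ) : ℂ) :=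
        map_natCast (SmoothFun.evalHom (E := F) z) _
      rw [h5] at h3
      linear_combination (w z) * h3
  have hgen : ∀ (n : ℤ), ∀ u ∈ P.lineSec n, P.generator u z = weightConst n * u z := by
    intro n u hu
    rw [P.mem_lineSec_iff.1 hu, SmoothFun.smul_apply]
  have hs0 : s z ≠ 0 := left_ne_zero_of_mul_eq_one h1
  have hs0' : s' z ≠ 0 := right_ne_zero_of_mul_eq_one h1
  -- Shifting `u` to weight zero by a power of `s'` or `s`, according to the sign of n, shows that
  -- `x` multiplies by n times a number independent of `u` and n, just as the generator does.
  have hfin : ∀ (n : ℤ), ∀ u ∈ P.lineSec n, x u z = n * (s' z * x s z) * u z := by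
    intro n u hu
    obtain ⟨k, rfl | rfl⟩ := n.eq_nat_or_neg
    · have h3 := key k u s' (by
        have := P.mul_mem_lineSec hu (P.pow_mem_lineSec hs' k)
        simpa using this)
      have h4 : x u z * s' z = -(k * u z * x s' z) := by
        have h6 : s' z ^ k ≠ 0 := pow_ne_zero _ hs0'
        apply mul_left_cancel₀ h6
        linear_combination h3
      push_cast
      linear_combination s z * h4 - (x u z) * h1 - k * u z * h2
    · have h3 := key k u s (by
        have := P.mul_mem_lineSec hu (P.pow_mem_lineSec hs k)
        simpa using this)
      have h4 : x u z * s z = -(k * u z * x s z) := by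
        have h6 : s z ^ k ≠ 0 := pow_ne_zero _ hs0
        apply mul_left_cancel₀ h6
        linear_combination h3
      push_cast
      linear_combination s' z * h4 - (x u z) * h1
  refine ⟨s' z * x s z / weightConst 1, fun n u hu => ?_⟩
  have h3 : weightConst 1 ≠ 0 := by simp [weightConst, Real.pi_ne_zero]
  have h4 : weightConst n = n * weightConst 1 := by simp only [weightConst]; push_cast; ring
  rw [hfin n u hu, hgen n u hu, h4]
  field_simp

/-- Vertical vector fields are multiples of the generator. -/
theorem eq_smul_generator (A : P.Connection) {x : VecField F Z} (hx : P.push x = 0) :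
    x = A.form x • P.generator := by
  ext h z
  obtain ⟨κ, hκ⟩ := P.vertical_apply_of_mem hx z
  -- Both fields act term by term on the Fourier series, so proportionality on pure weights extends
  -- to all functions.
  have h1 : ∀ h, x h z = κ * P.generator h z := by
    intro h
    have hsum : (P.rapidDecay_comp h).sum = h := by
      ext z
      exact ((P.rapidDecay_comp h).hasSum z).unique (P.hasSum_comp h z)
    have hx := (P.rapidDecay_comp h).apply_hasSum x z
    have hv := ((P.rapidDecay_comp h).apply_hasSum P.generator z).mul_left κ
    rw [hsum] at hx hv
    refine hx.unique ?_
    simpa only [hκ _ _ (P.comp_mem _ h)] using hv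
  -- The difference vanishes at `z` as a derivation, hence pairs to zero with the connection form;
  -- this identifies `κ` with the value of `A.form x`.
  have h2 : A.form (x - κ • P.generator) z = 0 :=
    oneForm_apply_eq_zero _ fun h => by simp [h1]
  have h3 : A.form (κ • P.generator) = algebraMap ℂ _ κ := by
    rw [← algebraMap_smul (SmoothFun F Z) κ P.generator, map_smul, A.form_generator, smul_eq_mul,
      mul_one]
  rw [map_sub, h3, SmoothFun.sub_apply, SmoothFun.algebraMap_apply, sub_eq_zero] at h2
  rw [h1, Derivation.smul_apply, smul_eq_mul, SmoothFun.mul_apply, h2]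

/-- The difference is vertical, hence the multiple of the generator given by its connection value,
which is zero. Most identities between fields on `Z` are checked through these two projections. -/
theorem vecField_ext (A : P.Connection) {x y : VecField F Z} (h1 : P.push x = P.push y)
    (h2 : A.form x = A.form y) : x = y := by
  rw [← sub_eq_zero, P.eq_smul_generator A (x := x - y) (by rw [map_sub, h1, sub_self]), map_sub,
    h2, sub_self, zero_smul]

end CircleBundle
namespace CircleBundle

variable {E : Type*} [NormedAddCommGroup E] [NormedSpace ℝ E] [FiniteDimensional ℝ E]
  {M : Type*} [TopologicalSpace M] [ChartedSpace E M] [IsManifold 𝓘(ℝ, E) ∞ M] [T2Space M]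
  {F : Type*} [NormedAddCommGroup F] [NormedSpace ℝ F] [FiniteDimensional ℝ F]
  {Z : Type*} [TopologicalSpace Z] [ChartedSpace F Z] [IsManifold 𝓘(ℝ, F) ∞ Z] [T2Space Z]
  [MulAction Circle Z] (P : CircleBundle E F M Z)

/-! #### Horizontal lifts -/

/-- Coordinate vector fields lift to the total space through a local trivialization. -/
theorem exists_lift_chartDer {m : M} {U : Set M} {e : OpenPartialHomeomorph Z (M × Circle)}
    (hs : e.source = P.proj ⁻¹' U) (ht : e.target = U ×ˢ Set.univ) (hU : IsOpen U)
    (hsm : ContMDiffOn 𝓘(ℝ, F) (𝓘(ℝ, E).prod (𝓡 1)) ∞ e e.source)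
    (hsm' : ContMDiffOn (𝓘(ℝ, E).prod (𝓡 1)) 𝓘(ℝ, F) ∞ e.symm e.target)
    (he : ∀ z ∈ e.source, (e z).1 = P.proj z)
    (ρ : SmoothBumpFunction 𝓘(ℝ, E) m) (hρ : tsupport ρ ⊆ U) (a : E) :
    ∃ y : VecField F Z, P.push y = P.baseVec (chartDer ρ a) := by
  set φ := extChartAt 𝓘(ℝ, E) m with hφ
  -- The base coordinate varies while the circle coordinate of `z` is held fixed; the derivative at
  -- the base point of `z` defines the lift.
  let g : SmoothFun F Z → Z → E → ℂ := fun h z w => h (e.symm (φ.symm w, (e z).2))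
  have hZ1 : IsManifold 𝓘(ℝ, F) 1 Z := IsManifold.of_le (n := ∞) (by simp)
  have key : ∀ z, P.proj z ∈ tsupport ρ → z ∈ e.source ∧ P.proj z ∈ (chartAt E m).source ∧
      φ (P.proj z) ∈ φ.target ∧ φ.symm (φ (P.proj z)) = P.proj z ∧
      e.symm (φ.symm (φ (P.proj z)), (e z).2) = z := by
    intro z hz
    have h1 : z ∈ e.source := by rw [hs]; exact hρ hz
    have h2 := ρ.tsupport_subset_chartAt_source hz
    have h2' : P.proj z ∈ φ.source := by simpa [hφ] using h2
    refine ⟨h1, h2, φ.map_source h2', φ.left_inv h2', ?_⟩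
    rw [φ.left_inv h2', ← he z h1, Prod.mk.eta, e.left_inv h1]
  have hg : ∀ h z, P.proj z ∈ tsupport ρ → ContMDiffAt (𝓘(ℝ, F).prod 𝓘(ℝ, E)) 𝓘(ℝ, ℂ) ∞
      (Function.uncurry (g h)) (z, φ (P.proj z)) := by
    intro h z hz
    obtain ⟨h1, h2, h3, h4, h5⟩ := key z hz
    refine h.smooth.contMDiffAt.comp _ ?_
    have h6 : (φ.symm (φ (P.proj z)), (e z).2) ∈ e.target := by
      rw [ht, h4]
      exact ⟨hρ hz, trivial⟩
    refine ContMDiffAt.comp (z, φ (P.proj z)) (g := e.symm)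
      (f := fun p : Z × E => (φ.symm p.2, (e p.1).2))
      ((hsm' _ h6).contMDiffAt (e.open_target.mem_nhds h6)) (ContMDiffAt.prodMk ?_ ?_)
    · exact ContMDiffAt.comp (z, φ (P.proj z)) (g := φ.symm) (f := Prod.snd) (I' := 𝓘(ℝ, E))
        ((contMDiffOn_extChartAt_symm m).contMDiffAt ((isOpen_extChartAt_target m).mem_nhds h3))
        contMDiffAt_snd
    · exact contMDiffAt_snd.comp _ (ContMDiffAt.comp (z, φ (P.proj z)) (g := e) (f := Prod.fst)
        ((hsm z h1).contMDiffAt (e.open_source.mem_nhds h1)) contMDiffAt_fst)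
  have hd : ∀ h z, P.proj z ∈ tsupport ρ → DifferentiableAt ℝ (g h z) (φ (P.proj z)) := by
    intro h z hz
    have h1 : ContMDiffAt 𝓘(ℝ, E) 𝓘(ℝ, ℂ) ∞ (g h z) (φ (P.proj z)) :=
      ContMDiffAt.comp (φ (P.proj z)) (g := Function.uncurry (g h)) (f := fun w => (z, w))
        (hg h z hz) (contMDiffAt_const.prodMk contMDiffAt_id)
    exact h1.contDiffAt.differentiableAt (by simp)
  have hsmooth : ∀ h, ContMDiff 𝓘(ℝ, F) 𝓘(ℝ, ℂ) ∞
      (fun z => ρ (P.proj z) • fderiv ℝ (g h z) (φ (P.proj z)) a) := by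
    intro h z
    by_cases hz : P.proj z ∈ tsupport ρ
    · refine (ρ.contMDiff.comp P.proj_smooth).contMDiffAt.smul ?_
      exact contMDiffAt_fderiv_param a (hg h z hz)
        ((contMDiffAt_extChartAt' (key z hz).2.1).comp z P.proj_smooth.contMDiffAt)
    · have h1 : ∀ᶠ w in 𝓝 z, ρ (P.proj w) = 0 :=
        (P.proj_smooth.continuous.tendsto z).eventually (notMem_tsupport_iff_eventuallyEq.1 hz)
      refine (contMDiffAt_const (c := (0 : ℂ))).congr_of_eventuallyEq (h1.mono fun x hx => ?_)
      simp only [hx, zero_smul]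
  have hmem : ∀ z, ρ (P.proj z) ≠ 0 → P.proj z ∈ tsupport ρ := fun z hz => subset_tsupport _ hz
  refine ⟨Derivation.mk'
    { toFun := fun h => SmoothFun.mk _ (hsmooth h)
      map_add' := fun h k => by
        ext z
        by_cases hz : ρ (P.proj z) = 0
        · simp [hz]
        · simp only [SmoothFun.mk_apply, SmoothFun.add_apply]
          have h1 : g (h + k) z = fun w => g h z w + g k z w := rfl
          rw [h1, fderiv_fun_add (hd h z (hmem z hz)) (hd k z (hmem z hz)), add_apply, smul_add]
      map_smul' := fun b h => by
        ext z
        by_cases hz : ρ (P.proj z) = 0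
        · simp [hz]
        · simp only [SmoothFun.mk_apply, SmoothFun.smul_apply, RingHom.id_apply]
          have h1 : g (b • h) z = fun w => b * g h z w := rfl
          rw [h1, fderiv_const_mul (hd h z (hmem z hz))]
          simp only [smul_apply, smul_eq_mul, Complex.real_smul]
          ring }
    (fun h k => by
      ext z
      by_cases hz : ρ (P.proj z) = 0
      · simp [hz]
      · have h1 : g (h * k) z = fun w => g h z w * g k z w := rfl
        change ρ (P.proj z) • fderiv ℝ (g (h * k) z) _ a = h z * _ + k z * _
        rw [h1, fderiv_fun_mul (hd h z (hmem z hz)) (hd k z (hmem z hz))]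
        have h2 : ∀ h, g h z (φ (P.proj z)) = h z := fun h => by
          change h _ = _
          rw [(key z (hmem z hz)).2.2.2.2]
        simp only [add_apply, smul_apply, smul_eq_mul, Complex.real_smul, h2]
        change _ = h z * (ρ (P.proj z) • _) + k z * (ρ (P.proj z) • _)
        simp only [Complex.real_smul]
        ring), P.vecAlong_ext fun k => ?_⟩
  ext z
  change ρ (P.proj z) • fderiv ℝ (g (P.pullFun k) z) (φ (P.proj z)) a =
    ρ (P.proj z) • fderiv ℝ (fun w => k (φ.symm w)) (φ (P.proj z)) a
  by_cases hz : ρ (P.proj z) = 0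
  · simp [hz]
  · congr 2
    refine Filter.EventuallyEq.fderiv_eq ?_
    obtain ⟨h1, h2, h3, h4, h5⟩ := key z (hmem z hz)
    have h6 : ∀ᶠ w in 𝓝 (φ (P.proj z)), φ.symm w ∈ U := by
      refine ((continuousOn_extChartAt_symm m).continuousAt
        ((isOpen_extChartAt_target m).mem_nhds h3)).eventually (hU.mem_nhds ?_)
      rw [← hφ, h4]
      exact hρ (hmem z hz)
    filter_upwards [h6] with w hw
    have h7 : (φ.symm w, (e z).2) ∈ e.target := by rw [ht]; exact ⟨hw, trivial⟩
    change k (P.proj (e.symm (φ.symm w, (e z).2))) = _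
    rw [← he _ (e.map_target h7), e.right_inv h7]

theorem exists_localFrame_lift (m : M) : ∃ (fr : LocalFrame E m)
    (y : Fin (Module.finrank ℝ E) → VecField F Z), ∀ i, P.push (y i) = P.baseVec (fr.vec i) := by
  obtain ⟨U, e, hU, hm, hs, ht, hsm, hsm', he⟩ := P.locally_trivial m
  obtain ⟨ρ, -, hρ⟩ :=
    (SmoothBumpFunction.nhds_basis_tsupport (I := 𝓘(ℝ, E)) m).mem_iff.1 (hU.mem_nhds hm)
  obtain ⟨fr, hfr⟩ := exists_localFrame_of_bump ρ
  choose y hy using fun i => P.exists_lift_chartDer hs ht hU hsm hsm' (fun z hz => (he z hz).1) ρ hρ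
    (Module.finBasis ℝ E i)
  refine ⟨fr, fun i => P.pullFun fr.cutoff • y i, fun i => ?_⟩
  rw [map_smul, hy, hfr, P.baseVec_smul]

variable {P}

/-- Lift the frame, subtract from each lift its connection value times the generator, and extend
linearly. The cutoff remains because the frame expands only the cut-off field. -/
theorem exists_local_horLift (A : P.Connection) (m : M) : ∃ (fr : LocalFrame E m)
    (l : P.VecAlong →ₗ[SmoothFun F Z] VecField F Z),
    ∀ X, P.push (l X) = P.pullFun fr.cutoff • X ∧ A.form (l X) = 0 := by
  obtain ⟨fr, y, hy⟩ := P.exists_localFrame_lift m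
  let y' : Fin (Module.finrank ℝ E) → VecField F Z := fun i => y i - A.form (y i) • P.generator
  have h1 : ∀ i, P.push (y' i) = P.baseVec (fr.vec i) := fun i => by
    simp [y', P.push_generator, hy]
  have h2 : ∀ i, A.form (y' i) = 0 := fun i => by
    simp [y', A.form_generator]
  refine ⟨fr, { toFun := fun X => ∑ i, X.1 (fr.coord i) • y' i
                map_add' := fun X Y => by
                  simp only [vecAlong_add_apply, add_smul, Finset.sum_add_distrib]
                map_smul' := fun r X => by
                  simp only [vecAlong_smul_apply, mul_smul, Finset.smul_sum, RingHom.id_apply] },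
    fun X => ⟨?_, ?_⟩⟩
  · change P.push (∑ i, X.1 (fr.coord i) • y' i) = _
    rw [P.smul_vecAlong, map_sum]
    simp only [map_smul, h1]
  · change A.form (∑ i, X.1 (fr.coord i) • y' i) = _
    rw [map_sum]
    simp [h2]

/-- Local horizontal lifts agree up to their cutoffs, since a field is determined by its projection
and its connection value. They therefore glue without a partition of unity, and the global lift
demanded by the definition exists. -/
theorem horLift_spec (A : P.Connection) (X : P.VecAlong) :
    P.push (horLift A X) = X ∧ A.form (horLift A X) = 0 := by
  have h : ∃ l : P.VecAlong →ₗ[SmoothFun F Z] VecField F Z,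
      ∀ X, P.push (l X) = X ∧ A.form (l X) = 0 := by
    choose fr l hl using exists_local_horLift A
    have hcompat : ∀ X h m m', P.pullFun (fr m').cutoff * l m X h =
        P.pullFun (fr m).cutoff * l m' X h := by
      intro X h m m'
      have h1 : P.pullFun (fr m').cutoff • l m X = P.pullFun (fr m).cutoff • l m' X := by
        refine P.vecField_ext A ?_ ?_
        · rw [map_smul, map_smul, (hl m X).1, (hl m' X).1, smul_comm]
        · rw [map_smul, map_smul, (hl m X).2, (hl m' X).2, smul_zero, smul_zero]
      exact congrArg (fun y : VecField F Z => y h) h1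
    let L : P.VecAlong → VecField F Z := fun X => Derivation.mk'
      { toFun := fun h => P.glue (fun m => (fr m).cutoff) (fun m => (fr m).cutoff_eq_one)
          (fun m => l m X h) (hcompat X h)
        map_add' := fun h k => by ext z; simp
        map_smul' := fun b h => by ext z; simp }
      (fun h k => by
        ext z
        change l (P.proj z) X (h * k) z = h z * l (P.proj z) X k z + k z * l (P.proj z) X h z
        simp [Derivation.leibniz])
    have hL : ∀ X h z, L X h z = l (P.proj z) X h z := fun X h z => rfl
    refine ⟨{ toFun := L
              map_add' := fun X Y => by ext h z; simp [hL]
              map_smul' := fun r X => by ext h z; simp [hL] }, fun X => ⟨?_, ?_⟩⟩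
    · refine P.vecAlong_ext fun h => ?_
      ext z
      have h1 := congrArg (fun Y : P.VecAlong => Y.1 h z) (hl (P.proj z) X).1
      change l (P.proj z) X (P.pullFun h) z = _
      simpa [P.push_apply, (fr (P.proj z)).cutoff_eq_one.self_of_nhds] using h1
    · ext z
      have h1 : A.form (L X - l (P.proj z) X) z = 0 :=
        oneForm_apply_eq_zero _ fun h => by simp [hL]
      rw [map_sub, (hl (P.proj z) X).2, sub_zero] at h1
      exact h1
  rw [horLift, dif_pos h]
  exact h.choose_spec X

@[simp] theorem push_horLift (A : P.Connection) (X : P.VecAlong) : P.push (horLift A X) = X :=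
  (horLift_spec A X).1

@[simp] theorem form_horLift (A : P.Connection) (X : P.VecAlong) : A.form (horLift A X) = 0 :=
  (horLift_spec A X).2

theorem horLift_pullFun (A : P.Connection) (X : P.VecAlong) (h : SmoothFun E M) :
    horLift A X (P.pullFun h) = X.1 h := by
  rw [← P.push_apply, push_horLift]

theorem horLift_push (A : P.Connection) (x : VecField F Z) :
    horLift A (P.push x) + A.form x • P.generator = x := by
  refine P.vecField_ext A ?_ ?_
  · simp [P.push_generator]
  · simp [A.form_generator]

theorem form_lie_generator (A : P.Connection) (x : VecField F Z) :
    A.form ⁅P.generator, x⁆ = P.generator (A.form x) := by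
  have h1 := congrArg (fun α : OneForm F Z => α x) A.form_invariant
  exact (sub_eq_zero.1 h1).symm

/-- Both projections of the bracket vanish: functions from the base stay invariant under the lift,
and the connection form is itself invariant. -/
theorem lie_generator_horLift_baseVec (A : P.Connection) (W : VecField E M) :
    ⁅P.generator, horLift A (P.baseVec W)⁆ = 0 := by
  refine P.vecField_ext A (P.vecAlong_ext fun h => ?_) ?_
  · rw [P.push_apply, Derivation.commutator_apply, horLift_pullFun, P.baseVec_apply,
      P.generator_pullFun, P.generator_pullFun, map_zero, map_zero, sub_zero]
    rfl
  · rw [form_lie_generator, form_horLift, map_zero, map_zero]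

/-- The identification of quadruples `(X, f, ξ, g)` with sections of `TZ ⊕ T*Z`. -/
def assembleEquiv (A : P.Connection) : P.Quad ≃ₗ[ℂ] GenSection F Z where
  toFun := assemble A
  map_add' c d := by
    simp only [assemble, Prod.fst_add, Prod.snd_add, map_add, add_smul, LinearMap.add_comp]
    ext1 <;> simp only [Prod.fst_add, Prod.snd_add] <;> abel
  map_smul' r c := by
    refine Prod.ext ?_ ?_
    · simp only [assemble, Prod.smul_fst, Prod.smul_snd, RingHom.id_apply, smul_add]
      rw [← algebraMap_smul (SmoothFun F Z) r c.1, map_smul, algebraMap_smul, smul_assoc]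
    · simp only [assemble, Prod.smul_fst, Prod.smul_snd, RingHom.id_apply, smul_add, smul_assoc]
      rfl
  invFun a := (P.push a.1, A.form a.1, a.2 ∘ₗ horLift A, a.2 P.generator)
  left_inv c := by
    obtain ⟨X, f, ξ, g⟩ := c
    simp only [assemble, Prod.mk.injEq]
    refine ⟨?_, ?_, ?_, ?_⟩
    · simp [P.push_generator]
    · simp [A.form_generator]
    · ext1 W
      simp
    · simp [P.push_generator, A.form_generator]
  right_inv a := by
    refine Prod.ext (horLift_push A a.1) (LinearMap.ext fun x => ?_)
    conv_rhs => rw [← horLift_push A x]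
    simp [assemble, mul_comm]

@[simp] theorem assembleEquiv_apply (A : P.Connection) (c : P.Quad) :
    assembleEquiv A c = assemble A c := rfl

theorem assembleEquiv_symm_apply (A : P.Connection) (a : GenSection F Z) :
    (assembleEquiv A).symm a = (P.push a.1, A.form a.1, a.2 ∘ₗ horLift A, a.2 P.generator) := rfl

end CircleBundle
namespace CircleBundle

variable {E : Type*} [NormedAddCommGroup E] [NormedSpace ℝ E] [FiniteDimensional ℝ E]
  {M : Type*} [TopologicalSpace M] [ChartedSpace E M] [IsManifold 𝓘(ℝ, E) ∞ M] [T2Space M]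
  {F : Type*} [NormedAddCommGroup F] [NormedSpace ℝ F] [FiniteDimensional ℝ F]
  {Z : Type*} [TopologicalSpace Z] [ChartedSpace F Z] [IsManifold 𝓘(ℝ, F) ∞ Z] [T2Space Z]
  [MulAction Circle Z] (P : CircleBundle E F M Z)

/-! #### Weight components of quadruples -/

theorem comp_invariant_mul {r : SmoothFun F Z} (hr : r ∈ P.lineSec 0) (n : ℤ) (u : SmoothFun F Z) :
    P.comp n (r * u) = r * P.comp n u := by
  rw [P.comp_mul hr, sub_zero]

theorem comp_pullFun_mul (r : SmoothFun E M) (n : ℤ) (u : SmoothFun F Z) :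
    P.comp n (P.pullFun r * u) = P.pullFun r * P.comp n u :=
  P.comp_invariant_mul (P.pullFun_mem r) n u

/-- The weight components of a vector field along the projection. -/
def compVec (n : ℤ) : P.VecAlong →ₗ[ℂ] P.VecAlong where
  toFun X := ⟨P.comp n ∘ₗ X.1, fun h k => by
    simp only [LinearMap.comp_apply, X.2 h k, map_add, comp_pullFun_mul]⟩
  map_add' X Y := P.vecAlong_ext fun h => by simp [LinearMap.comp_apply]
  map_smul' c X := P.vecAlong_ext fun h => by simp [LinearMap.comp_apply]

@[simp] theorem compVec_apply (n : ℤ) (X : P.VecAlong) (h : SmoothFun E M) :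
    (P.compVec n X).1 h = P.comp n (X.1 h) := rfl

theorem exists_compDual (n : ℤ) (ζ : Module.Dual (SmoothFun F Z) P.VecAlong) :
    ∃ ζ' : Module.Dual (SmoothFun F Z) P.VecAlong,
      ∀ W, ζ' (P.baseVec W) = P.comp n (ζ (P.baseVec W)) :=
  P.exists_dual_extension _ (fun W W' => by rw [P.baseVec_add, map_add, map_add])
    (fun r W => by rw [P.baseVec_smul, map_smul, smul_eq_mul, P.comp_pullFun_mul])

/-- The weight components of a one-form along the projection. -/
def compDual (n : ℤ) : Module.Dual (SmoothFun F Z) P.VecAlong →ₗ[ℂ]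
    Module.Dual (SmoothFun F Z) P.VecAlong where
  toFun ζ := (P.exists_compDual n ζ).choose
  map_add' ζ ζ' := P.dual_ext fun W => by
    rw [LinearMap.add_apply, (P.exists_compDual n (ζ + ζ')).choose_spec,
      (P.exists_compDual n ζ).choose_spec, (P.exists_compDual n ζ').choose_spec,
      LinearMap.add_apply, map_add]
  map_smul' c ζ := P.dual_ext fun W => by
    rw [RingHom.id_apply, LinearMap.smul_apply, (P.exists_compDual n (c • ζ)).choose_spec,
      (P.exists_compDual n ζ).choose_spec, LinearMap.smul_apply, map_smul]

@[simp] theorem compDual_baseVec (n : ℤ) (ζ : Module.Dual (SmoothFun F Z) P.VecAlong)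
    (W : VecField E M) : P.compDual n ζ (P.baseVec W) = P.comp n (ζ (P.baseVec W)) :=
  (P.exists_compDual n ζ).choose_spec W

/-- The weight components of a quadruple. -/
def compQuad (n : ℤ) : P.Quad →ₗ[ℂ] P.Quad :=
  (P.compVec n).prodMap ((P.comp n).prodMap ((P.compDual n).prodMap (P.comp n)))

@[simp] theorem compQuad_apply (n : ℤ) (c : P.Quad) :
    P.compQuad n c = (P.compVec n c.1, P.comp n c.2.1, P.compDual n c.2.2.1, P.comp n c.2.2.2) :=
  rfl

theorem quad_ext {c d : P.Quad} (h1 : ∀ h, c.1.1 h = d.1.1 h) (h2 : c.2.1 = d.2.1)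
    (h3 : ∀ W, c.2.2.1 (P.baseVec W) = d.2.2.1 (P.baseVec W)) (h4 : c.2.2.2 = d.2.2.2) : c = d :=
  Prod.ext (P.vecAlong_ext h1) (Prod.ext h2 (Prod.ext (P.dual_ext h3) h4))

theorem compQuad_mem (n : ℤ) (c : P.Quad) : P.compQuad n c ∈ P.weightSec n :=
  ⟨fun h => P.comp_mem n _, P.comp_mem n _, fun W => by simpa using P.comp_mem n _,
    P.comp_mem n _⟩

theorem compQuad_of_mem {n : ℤ} {c : P.Quad} (hc : c ∈ P.weightSec n) (p : ℤ) :
    P.compQuad p c = if p = n then c else 0 := by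
  obtain ⟨h1, h2, h3, h4⟩ := hc
  split_ifs with hp
  · refine P.quad_ext (fun h => ?_) ?_ (fun W => ?_) ?_
    · simp [P.comp_of_mem (h1 h), hp]
    · simp [P.comp_of_mem h2, hp]
    · simp [P.comp_of_mem (h3 W), hp]
    · simp [P.comp_of_mem h4, hp]
  · refine P.quad_ext (fun h => ?_) ?_ (fun W => ?_) ?_
    · simp [P.comp_of_mem (h1 h), hp]
    · simp [P.comp_of_mem h2, hp]
    · simp [P.comp_of_mem (h3 W), hp]
    · simp [P.comp_of_mem h4, hp]

/-- Resummation is linear over functions of the base. One statement covers what is needed to resum a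
quadruple: additivity, linearity of the one-form, and the Leibniz rule for the vector part. -/
theorem comp_sub_lineSum {u w : ℤ → SmoothFun F Z} (hu : u ∈ P.lineSum) (hw : w ∈ P.lineSum)
    {r r' : SmoothFun E M} {x : ℤ → SmoothFun F Z} (hx : x ∈ P.lineSum)
    (h : ∀ n, x n = P.pullFun r * u n + P.pullFun r' * w n) :
    P.funDecomposition.symm ⟨x, hx⟩ = P.pullFun r * P.funDecomposition.symm ⟨u, hu⟩ +
      P.pullFun r' * P.funDecomposition.symm ⟨w, hw⟩ := by
  refine P.ext_comp fun n => ?_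
  rw [map_add, P.comp_pullFun_mul, P.comp_pullFun_mul]
  simp only [comp_funDecomposition_symm]
  exact h n

/-- Summing the sequences obtained by testing on functions and fields of the base preserves the
derivation and linearity rules, so the sums define a quadruple; `exists_dual_extension` extends the
one-form to all fields along the projection. -/
theorem exists_quad_of_quadSum (s : P.quadSum) : ∃ c : P.Quad, ∀ n, P.compQuad n c = s.1 n := by
  obtain ⟨s, hs, hX, hf, hξ, hg⟩ := s
  have hX' : ∀ h, (fun n => (s n).1.1 h) ∈ P.lineSum := fun h => ⟨fun n => (hs n).1 h, hX h⟩
  have hξ' : ∀ W, (fun n => (s n).2.2.1 (P.baseVec W)) ∈ P.lineSum := fun W =>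
    ⟨fun n => (hs n).2.2.1 W, hξ W⟩
  obtain ⟨ζ, hζ⟩ := P.exists_dual_extension
    (fun W => P.funDecomposition.symm ⟨_, hξ' W⟩)
    (fun W W' => by
      have := P.comp_sub_lineSum (hξ' W) (hξ' W') (r := 1) (r' := 1) (hξ' (W + W')) (fun n => by
        simp [P.baseVec_add])
      simpa using this)
    (fun r W => by
      have := P.comp_sub_lineSum (hξ' W) (hξ' W) (r := r) (r' := 0) (hξ' (r • W)) (fun n => by
        simp [P.baseVec_smul])
      simpa using this)
  refine ⟨(⟨{ toFun := fun h => P.funDecomposition.symm ⟨_, hX' h⟩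
              map_add' := fun h k => by
                have := P.comp_sub_lineSum (hX' h) (hX' k) (r := 1) (r' := 1) (hX' (h + k))
                  (fun n => by simp)
                simpa using this
              map_smul' := fun c h => by
                refine P.ext_comp fun n => ?_
                simp [comp_funDecomposition_symm] }, fun h k => ?_⟩,
    P.funDecomposition.symm ⟨_, fun n => (hs n).2.1, hf⟩, ζ,
    P.funDecomposition.symm ⟨_, fun n => (hs n).2.2.2, hg⟩), fun n => ?_⟩
  · exact P.comp_sub_lineSum (hX' k) (hX' h) (hX' (h * k)) (fun n => (s n).1.2 h k)
  · refine P.quad_ext (fun h => ?_) ?_ (fun W => ?_) ?_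
    · exact P.comp_funDecomposition_symm _ n
    · exact P.comp_funDecomposition_symm _ n
    · simp only [compQuad_apply, compDual_baseVec, hζ]
      exact P.comp_funDecomposition_symm _ n
    · exact P.comp_funDecomposition_symm _ n

/-- The sequence of weight components of a quadruple. -/
def quadComponents : P.Quad →ₗ[ℂ] P.quadSum where
  toFun c := ⟨fun n => P.compQuad n c, fun n => P.compQuad_mem n c,
    fun h => P.rapidDecay_comp _, P.rapidDecay_comp _,
    fun W => by simpa using P.rapidDecay_comp (c.2.2.1 (P.baseVec W)), P.rapidDecay_comp _⟩
  map_add' c d := Subtype.ext <| funext fun n => map_add (P.compQuad n) c d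
  map_smul' r c := Subtype.ext <| funext fun n => map_smul (P.compQuad n) r c

theorem quadComponents_bijective : Function.Bijective P.quadComponents := by
  refine ⟨fun c d h => ?_, fun s => ?_⟩
  · have h1 : ∀ n, P.compQuad n c = P.compQuad n d := fun n =>
      congrFun (congrArg Subtype.val h) n
    refine P.quad_ext (fun k => ?_) ?_ (fun W => ?_) ?_
    · exact P.ext_comp fun n => congrArg (fun q : P.Quad => q.1.1 k) (h1 n)
    · exact P.ext_comp fun n => congrArg (fun q : P.Quad => q.2.1) (h1 n)
    · exact P.ext_comp fun n => by
        simpa using congrArg (fun q : P.Quad => q.2.2.1 (P.baseVec W)) (h1 n)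
    · exact P.ext_comp fun n => congrArg (fun q : P.Quad => q.2.2.2) (h1 n)
  · obtain ⟨c, hc⟩ := P.exists_quad_of_quadSum s
    exact ⟨c, Subtype.ext (funext hc)⟩

/-- The decomposition of quadruples into weight components. -/
def quadDecomposition : P.Quad ≃ₗ[ℂ] P.quadSum :=
  LinearEquiv.ofBijective P.quadComponents P.quadComponents_bijective

/-! #### Weight components of vector fields and one-forms on the total space -/

variable {P}

/-- The weight components of a vector field. -/
def compField (A : P.Connection) (n : ℤ) (x : VecField F Z) : VecField F Z :=
  horLift A (P.compVec n (P.push x)) + P.comp n (A.form x) • P.generator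

/-- The weight components of a one-form. -/
def compForm (A : P.Connection) (n : ℤ) (α : OneForm F Z) : OneForm F Z :=
  P.compDual n (α ∘ₗ horLift A) ∘ₗ P.push + P.comp n (α P.generator) • A.form

theorem assemble_compQuad (A : P.Connection) (n : ℤ) (a : GenSection F Z) :
    assemble A (P.compQuad n ((assembleEquiv A).symm a)) =
      (compField A n a.1, compForm A n a.2) := rfl

@[simp] theorem push_compField (A : P.Connection) (n : ℤ) (x : VecField F Z) :
    P.push (compField A n x) = P.compVec n (P.push x) := by
  simp [compField, P.push_generator]

theorem compField_pullFun (A : P.Connection) (n : ℤ) (x : VecField F Z) (h : SmoothFun E M) :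
    compField A n x (P.pullFun h) = P.comp n (x (P.pullFun h)) := by
  rw [← P.push_apply, push_compField]; rfl

@[simp] theorem form_compField (A : P.Connection) (n : ℤ) (x : VecField F Z) :
    A.form (compField A n x) = P.comp n (A.form x) := by
  simp [compField, A.form_generator]

/-- Invariant vector fields: `X + f v` with `X` the horizontal lift of a vector field on the base
and `f` invariant. -/
def IsInvariantField (A : P.Connection) (w : VecField F Z) : Prop :=
  (∃ W, P.push w = P.baseVec W) ∧ A.form w ∈ P.lineSec 0

theorem isInvariantField_generator (A : P.Connection) : IsInvariantField A P.generator :=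
  ⟨⟨0, P.push_generator.trans (P.vecAlong_ext fun h => by simp [P.baseVec_apply])⟩, by
    rw [A.form_generator, ← map_one P.pullFun]
    exact P.pullFun_mem 1⟩

theorem isInvariantField_horLift (A : P.Connection) (W : VecField E M) :
    IsInvariantField A (horLift A (P.baseVec W)) :=
  ⟨⟨W, push_horLift A _⟩, by rw [form_horLift]; exact zero_mem _⟩

theorem IsInvariantField.lie_generator {A : P.Connection} {w : VecField F Z} (hw
    : IsInvariantField A w) :
    ⁅P.generator, w⁆ = 0 := by
  obtain ⟨⟨W, hW⟩, hc⟩ := hw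
  refine P.vecField_ext A (P.vecAlong_ext fun h => ?_) ?_
  · have h1 : w (P.pullFun h) = P.pullFun (W h) :=
      congrArg (fun Y : P.VecAlong => Y.1 h) hW
    rw [P.push_apply, Derivation.commutator_apply, h1, P.generator_pullFun, P.generator_pullFun,
      map_zero, sub_zero]
    rfl
  · rw [form_lie_generator, P.mem_lineSec_iff.1 hc, weightConst_zero, zero_smul, map_zero]

/-- The coefficients of an invariant field pass through `comp n`. Since invariant fields separate
one-forms, this property characterizes `compForm` and replaces its definition below. -/
theorem compForm_apply_invariant (A : P.Connection) (n : ℤ) (α : OneForm F Z) {w : VecField F Z}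
    (hw : IsInvariantField A w) : compForm A n α w = P.comp n (α w) := by
  obtain ⟨⟨W, hW⟩, hc⟩ := hw
  have h1 : α w = α (horLift A (P.baseVec W)) + A.form w * α P.generator := by
    conv_lhs => rw [← horLift_push A w, hW]
    simp
  rw [h1, map_add, P.comp_invariant_mul hc]
  simp [compForm, hW, mul_comm]

/-- One-forms are determined by their values on invariant fields. -/
theorem oneForm_ext_invariant (A : P.Connection) {α β : OneForm F Z}
    (h : ∀ w, IsInvariantField A w → α w = β w) : α = β := by
  have h1 : α ∘ₗ horLift A = β ∘ₗ horLift A :=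
    P.dual_ext fun W => h _ (isInvariantField_horLift A W)
  ext1 x
  rw [← horLift_push A x, map_add, map_add, map_smul, map_smul, h _ (isInvariantField_generator A)]
  congr 1
  exact congrArg (fun ζ : Module.Dual (SmoothFun F Z) P.VecAlong => ζ (P.push x)) h1

theorem eq_compForm (A : P.Connection) {n : ℤ} {α β : OneForm F Z}
    (h : ∀ w, IsInvariantField A w → β w = P.comp n (α w)) : β = compForm A n α :=
  oneForm_ext_invariant A fun w hw => by rw [h w hw, compForm_apply_invariant A n α hw]

theorem eq_compField (A : P.Connection) {n : ℤ} {x y : VecField F Z}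
    (h1 : ∀ h, y (P.pullFun h) = P.comp n (x (P.pullFun h)))
    (h2 : A.form y = P.comp n (A.form x)) : y = compField A n x :=
  P.vecField_ext A (P.vecAlong_ext fun h => by rw [push_compField]; exact h1 h)
    (by rw [form_compField, h2])

/-- Invariant one-forms commute with taking weight components. -/
theorem comp_invariantForm (A : P.Connection) {γ : OneForm F Z}
    (hγ : ∀ w, IsInvariantField A w → γ w ∈ P.lineSec 0) (n : ℤ) (x : VecField F Z) :
    P.comp n (γ x) = γ (compField A n x) := by
  -- In a local frame the invariant form has coefficients of weight zero, which pass through `comp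
  -- n`.
  have h1 : ∀ X : P.VecAlong, P.comp n (γ (horLift A X)) = γ (horLift A (P.compVec n X)) := by
    intro X
    ext z
    obtain ⟨fr⟩ := exists_localFrame (E := E) (P.proj z)
    have h2 : ∀ X : P.VecAlong, P.pullFun fr.cutoff * γ (horLift A X) =
        ∑ i, γ (horLift A (P.baseVec (fr.vec i))) * X.1 (fr.coord i) := by
      intro X
      have := congrArg (fun Y => γ (horLift A Y)) (P.smul_vecAlong fr X)
      simpa [map_sum, mul_comm] using this
    have h3 := congrArg (fun u => P.comp n u z) (h2 X)
    have h4 := congrArg (fun u : SmoothFun F Z => u z) (h2 (P.compVec n X))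
    simp only [P.comp_pullFun_mul, map_sum,
      P.comp_invariant_mul (hγ _ (isInvariantField_horLift A _)), SmoothFun.mul_apply,
          pullFun_apply,
      fr.cutoff_eq_one.self_of_nhds, one_mul, compVec_apply] at h3 h4
    rw [h3, h4]
  have h5 : γ x = γ (horLift A (P.push x)) + γ P.generator * A.form x := by
    conv_lhs => rw [← horLift_push A x]
    simp [mul_comm]
  rw [h5, map_add, h1, P.comp_invariant_mul (hγ _ (isInvariantField_generator A))]
  simp [compField, mul_comm]

/-! #### Convolution formulas -/

/-- `c` has the weight components `c_p = ∑_n u_{n, p-n}`. -/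
def IsConvolution (P : CircleBundle E F M Z) (u : ℤ → ℤ → SmoothFun F Z) (c : SmoothFun F Z) :
    Prop :=
  ∀ p z, HasSum (fun n => u n (p - n) z) (P.comp p c z)

namespace IsConvolution

variable {u w : ℤ → ℤ → SmoothFun F Z} {c d : SmoothFun F Z}

theorem add (hu : P.IsConvolution u c) (hw : P.IsConvolution w d) :
    P.IsConvolution (fun n m => u n m + w n m) (c + d) := fun p z => by
  rw [map_add]
  exact (hu p z).add (hw p z)

theorem sub (hu : P.IsConvolution u c) (hw : P.IsConvolution w d) :
    P.IsConvolution (fun n m => u n m - w n m) (c - d) := fun p z => by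
  rw [map_sub]
  exact (hu p z).sub (hw p z)

theorem flip (hu : P.IsConvolution u c) : P.IsConvolution (fun n m => u m n) c := fun p z => by
  have h1 := (Equiv.subLeft p).hasSum_iff.2 (hu p z)
  refine h1.congr_fun ?_
  intro n
  simp

theorem sum {ι : Type*} (s : Finset ι) {u : ι → ℤ → ℤ → SmoothFun F Z} {c : ι → SmoothFun F Z}
    (h : ∀ i ∈ s, P.IsConvolution (u i) (c i)) :
    P.IsConvolution (fun n m => ∑ i ∈ s, u i n m) (∑ i ∈ s, c i) := fun p z => by
  rw [map_sum, SmoothFun.sum_apply]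
  simp only [SmoothFun.sum_apply]
  exact hasSum_sum fun i hi => h i hi p z

/-- Convolution formulas can be checked after multiplication with cutoff functions. -/
theorem of_local (h : ∀ m : M, ∃ χ : SmoothFun E M, χ m = 1 ∧
    P.IsConvolution (fun n k => P.pullFun χ * u n k) (P.pullFun χ * c)) :
    P.IsConvolution u c := fun p z => by
  obtain ⟨χ, hχ, h1⟩ := h (P.proj z)
  have h2 := h1 p z
  rw [P.comp_pullFun_mul] at h2
  simpa [hχ] using h2

/-- A convolution with a single nonzero term has the sum of the weights. -/
theorem mem_lineSec {n m : ℤ} (hu : P.IsConvolution u c)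
    (h0 : ∀ k l, ¬(k = n ∧ l = m) → u k l = 0) : c ∈ P.lineSec (n + m) := by
  have h1 : ∀ p, p ≠ n + m → P.comp p c = 0 := by
    intro p hp
    ext z
    refine (hu p z).unique ?_
    have h2 : (fun k => u k (p - k) z) = fun _ => 0 := by
      funext k
      rw [h0 k (p - k) (by rintro ⟨rfl, h⟩; omega)]
      rfl
    rw [h2]
    exact hasSum_zero
  have h3 : c = P.comp (n + m) c := by
    refine P.ext_comp fun p => ?_
    rw [P.comp_of_mem (P.comp_mem (n + m) c)]
    split_ifs with hp
    · rw [hp]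
    · exact h1 p hp
  rw [h3]
  exact P.comp_mem _ c

end IsConvolution

theorem isConvolution_mul (P : CircleBundle E F M Z) (f g : SmoothFun F Z) :
    P.IsConvolution (fun n m => P.comp n f * P.comp m g) (f * g) :=
  fun p z => P.hasSum_comp_mul f g p z

/-- In a local frame the pairing is a finite sum of products of functions, so the product formula
applies; the cutoff is harmless by `of_local`. -/
theorem isConvolution_dual (P : CircleBundle E F M Z) (ζ : Module.Dual (SmoothFun F Z) P.VecAlong)
    (X : P.VecAlong) :
    P.IsConvolution (fun n m => P.compDual n ζ (P.compVec m X)) (ζ X) := by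
  refine IsConvolution.of_local fun m => ?_
  obtain ⟨fr⟩ := exists_localFrame (E := E) m
  refine ⟨fr.cutoff, fr.cutoff_eq_one.self_of_nhds, ?_⟩
  have h1 : ∀ (ζ : Module.Dual (SmoothFun F Z) P.VecAlong) (X : P.VecAlong),
      P.pullFun fr.cutoff * ζ X = ∑ i, ζ (P.baseVec (fr.vec i)) * X.1 (fr.coord i) := by
    intro ζ X
    have := congrArg ζ (P.smul_vecAlong fr X)
    simpa [map_sum, mul_comm] using this
  simp only [h1, compDual_baseVec, compVec_apply]
  exact IsConvolution.sum _ fun i _ => isConvolution_mul P _ _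

/-- The pairing of one-forms with vector fields. -/
theorem isConvolution_form (A : P.Connection) (α : OneForm F Z) (x : VecField F Z) :
    P.IsConvolution (fun n m => compForm A n α (compField A m x)) (α x) := by
  have h1 : α x = (α ∘ₗ horLift A) (P.push x) + α P.generator * A.form x := by
    conv_lhs => rw [← horLift_push A x]
    simp [mul_comm]
  rw [h1]
  have h2 : ∀ n m, compForm A n α (compField A m x) =
      P.compDual n (α ∘ₗ horLift A) (P.compVec m (P.push x)) +
        P.comp n (α P.generator) * P.comp m (A.form x) := fun n m => by
    simp [compForm]
  simp only [h2]
  exact (isConvolution_dual P _ _).add (isConvolution_mul P _ _)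

/-- On invariant fields this is their commutation with weight components. It makes the action of a
field on a function an instance of the pairing of a one-form with a field. -/
theorem compForm_dFun (A : P.Connection) (n : ℤ) (h : SmoothFun F Z) :
    dFun (P.comp n h) = compForm A n (dFun h) :=
  eq_compForm A fun _ hw => (P.comp_apply_of_invariant hw.lie_generator n h).symm

/-- The action of vector fields on functions. -/
theorem isConvolution_apply (A : P.Connection) (x : VecField F Z) (h : SmoothFun F Z) :
    P.IsConvolution (fun n m => compField A n x (P.comp m h)) (x h) := by
  have h1 := (isConvolution_form A (dFun h) x).flip
  simp only [← compForm_dFun] at h1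
  exact h1

end CircleBundle

/-! ### Symmetries of the terms of the Dorfman bracket. -/

section Standard

variable {E : Type*} [NormedAddCommGroup E] [NormedSpace ℝ E]
  {N : Type*} [TopologicalSpace N] [ChartedSpace E N]

theorem lieOneForm_apply (x : VecField E N) (β : OneForm E N) (w : VecField E N) :
    lieOneForm x β w = x (β w) - β ⁅x, w⁆ := rfl

theorem contractD_apply (y : VecField E N) (α : OneForm E N) (w : VecField E N) :
    contractD y α w = y (α w) - α ⁅y, w⁆ - w (α y) := rfl

theorem contractTwo_apply (H : KForm E N 3) (x y w : VecField E N) :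
    contractTwo H x y w = H ![y, x, w] := rfl

theorem contractD_skew (α : OneForm E N) (y w : VecField E N) :
    contractD y α w = -contractD w α y := by
  rw [contractD_apply, contractD_apply, ← lie_skew, map_neg]
  ring

theorem kForm_three_swap_right (H : KForm E N 3) (x y w : VecField E N) :
    H ![x, w, y] = -H ![x, y, w] := by
  have h1 := H.map_swap ![x, y, w] (i := 1) (j := 2) (by decide)
  rw [← h1]
  congr 1
  ext i : 1
  fin_cases i <;> rfl

theorem kForm_three_swap_left (H : KForm E N 3) (x y w : VecField E N) :
    H ![y, x, w] = -H ![x, y, w] := by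
  have h1 := H.map_swap ![x, y, w] (i := 0) (j := 1) (by decide)
  rw [← h1]
  congr 1
  ext i : 1
  fin_cases i <;> rfl

theorem kForm_three_rotate (H : KForm E N 3) (x y w : VecField E N) :
    H ![y, w, x] = H ![x, y, w] := by
  rw [kForm_three_swap_right, kForm_three_swap_left, neg_neg]

theorem dorfman_zero_left (H : KForm E N 3) (b : GenSection E N) : dorfman H 0 b = 0 := by
  refine Prod.ext (zero_lie b.1) (LinearMap.ext fun w => ?_)
  have h1 : H ![b.1, 0, w] = 0 := H.map_coord_zero 1 rfl
  have h2 : ⁅(0 : VecField E N), w⁆ = 0 := zero_lie w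
  simp [dorfman, lieOneForm_apply, contractD_apply, contractTwo_apply, h1, h2]

theorem dorfman_zero_right (H : KForm E N 3) (a : GenSection E N) : dorfman H a 0 = 0 := by
  refine Prod.ext (lie_zero a.1) (LinearMap.ext fun w => ?_)
  have h1 : H ![0, a.1, w] = 0 := H.map_coord_zero 0 rfl
  have h2 : ⁅(0 : VecField E N), w⁆ = 0 := zero_lie w
  simp [dorfman, lieOneForm_apply, contractD_apply, contractTwo_apply, h1, h2]

end Standard

/-! ### Invariance of pulled-back forms and of brackets of invariant fields. -/

namespace CircleBundle

variable {E : Type*} [NormedAddCommGroup E] [NormedSpace ℝ E] [FiniteDimensional ℝ E]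
  {M : Type*} [TopologicalSpace M] [ChartedSpace E M] [IsManifold 𝓘(ℝ, E) ∞ M] [T2Space M]
  {F : Type*} [NormedAddCommGroup F] [NormedSpace ℝ F] [FiniteDimensional ℝ F]
  {Z : Type*} [TopologicalSpace Z] [ChartedSpace F Z] [IsManifold 𝓘(ℝ, F) ∞ Z] [T2Space Z]
  [MulAction Circle Z] {P : CircleBundle E F M Z}

theorem formAlong_baseVec_mem (P : CircleBundle E F M Z) {k : ℕ} (η : KForm E M k)
    (X : Fin k → VecField E M) : P.formAlong η (fun i => P.baseVec (X i)) ∈ P.lineSec 0 := by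
  rw [formAlong]
  split_ifs with h
  · rw [h.choose_spec]
    exact P.pullFun_mem _
  · exact zero_mem _

theorem pullForm_mem_of_invariant {A : P.Connection} {k : ℕ} (η : KForm E M k)
    {w : Fin k → VecField F Z} (hw : ∀ i, IsInvariantField A (w i)) :
    P.pullForm η w ∈ P.lineSec 0 := by
  choose W hW using fun i => (hw i).1
  have h1 : P.pullForm η w = P.formAlong η (fun i => P.baseVec (W i)) := by
    simp only [← hW]
    rfl
  rw [h1]
  exact P.formAlong_baseVec_mem η W

variable {A : P.Connection}

theorem IsInvariantField.apply_comp {w : VecField F Z} (hw : IsInvariantField A w) (n : ℤ)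
    (h : SmoothFun F Z) : w (P.comp n h) = P.comp n (w h) :=
  (P.comp_apply_of_invariant hw.lie_generator n h).symm

theorem IsInvariantField.lie {w w' : VecField F Z} (hw : IsInvariantField A w)
    (hw' : IsInvariantField A w') : IsInvariantField A ⁅w, w'⁆ := by
  have hv := hw.lie_generator
  have hv' := hw'.lie_generator
  obtain ⟨⟨W, hW⟩, -⟩ := hw
  obtain ⟨⟨W', hW'⟩, -⟩ := hw'
  refine ⟨⟨⁅W, W'⁆, P.vecAlong_ext fun h => ?_⟩, ?_⟩
  · have h1 : ∀ h, w (P.pullFun h) = P.pullFun (W h) := fun h =>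
      congrArg (fun Y : P.VecAlong => Y.1 h) hW
    have h2 : ∀ h, w' (P.pullFun h) = P.pullFun (W' h) := fun h =>
      congrArg (fun Y : P.VecAlong => Y.1 h) hW'
    rw [P.push_apply, P.baseVec_apply, Derivation.commutator_apply, Derivation.commutator_apply,
      map_sub, h1, h2, h1, h2]
  · rw [P.mem_lineSec_iff, ← form_lie_generator, leibniz_lie, hv, hv', weightConst_zero, zero_smul,
      zero_lie, lie_zero, add_zero, map_zero]

theorem form_lie (A : P.Connection) (x y : VecField F Z) :
    A.form ⁅x, y⁆ = x (A.form y) - y (A.form x) - dOneForm A.form x y := by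
  rw [dOneForm, contractD_apply]
  ring

end CircleBundle

open CircleBundle

/-! ### Weight components of the Dorfman bracket. -/

namespace TDualPair

variable {E : Type*} [NormedAddCommGroup E] [NormedSpace ℝ E] [FiniteDimensional ℝ E]
  {M : Type*} [TopologicalSpace M] [ChartedSpace E M] [IsManifold 𝓘(ℝ, E) ∞ M] [T2Space M]
  {F : Type*} [NormedAddCommGroup F] [NormedSpace ℝ F] [FiniteDimensional ℝ F]
  {Z : Type*} [TopologicalSpace Z] [ChartedSpace F Z] [IsManifold 𝓘(ℝ, F) ∞ Z] [T2Space Z]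
  [MulAction Circle Z]
  {F' : Type*} [NormedAddCommGroup F'] [NormedSpace ℝ F']
  {Z' : Type*} [TopologicalSpace Z'] [ChartedSpace F' Z'] [IsManifold 𝓘(ℝ, F') ∞ Z']
  [MulAction Circle Z'] {P : CircleBundle E F M Z} {P' : CircleBundle E F' M Z'}
  (T : TDualPair P P')

theorem contractD_conn_mem {w w' : VecField F Z} (hw : IsInvariantField T.conn w)
    (hw' : IsInvariantField T.conn w') : contractD w T.conn.form w' ∈ P.lineSec 0 := by
  have h1 : contractD w T.conn.form w' = _ := T.conn_curv w w'
  rw [h1]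
  exact pullForm_mem_of_invariant (A := T.conn) _ fun i => by fin_cases i <;> assumption

theorem flux_mem {w₁ w₂ w₃ : VecField F Z} (h₁ : IsInvariantField T.conn w₁)
    (h₂ : IsInvariantField T.conn w₂) (h₃ : IsInvariantField T.conn w₃) :
    T.flux ![w₁, w₂, w₃] ∈ P.lineSec 0 := by
  have hm : ∀ {u w : SmoothFun F Z}, u ∈ P.lineSec 0 → w ∈ P.lineSec 0 → u * w ∈ P.lineSec 0 :=
    fun hu hw => by simpa using P.mul_mem_lineSec hu hw
  rw [T.flux_eq]
  refine add_mem (sub_mem (add_mem ?_ (hm h₁.2 ?_)) (hm h₂.2 ?_)) (hm h₃.2 ?_) <;>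
  exact pullForm_mem_of_invariant (A := T.conn) _ fun i => by fin_cases i <;> assumption

/-- The curvature comes from the base, so contracting it with an invariant field gives an invariant
one-form. Skew symmetry moves the general field into the remaining slot, where `comp_invariantForm`
applies. -/
theorem compForm_contractD_conn (n : ℤ) (x : VecField F Z) :
    contractD (compField T.conn n x) T.conn.form = compForm T.conn n (contractD x T.conn.form) := by
  refine eq_compForm _ fun w hw => ?_
  rw [contractD_skew, contractD_skew _ x w, map_neg,
    comp_invariantForm T.conn fun w' hw' => T.contractD_conn_mem hw hw']

/-- With two invariant arguments the flux is an invariant one-form in the third; cyclic rotation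
puts the general field there. -/
theorem compForm_contractTwo_flux {w : VecField F Z} (hw : IsInvariantField T.conn w) (n : ℤ)
    (x : VecField F Z) : contractTwo T.flux w (compField T.conn n x) =
      compForm T.conn n (contractTwo T.flux w x) := by
  refine eq_compForm _ fun w' hw' => ?_
  rw [contractTwo_apply, contractTwo_apply, ← kForm_three_rotate, ← kForm_three_rotate _ x]
  have h1 := comp_invariantForm T.conn (γ := contractTwo T.flux w' w)
    (fun w'' hw'' => T.flux_mem hw hw' hw'') n x
  exact h1.symm

/-- Tested on functions of the base this is commutation of `w` with components. For the connection
value the additional term is the curvature, which is invariant. -/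
theorem compField_lie {w : VecField F Z} (hw : IsInvariantField T.conn w) (n : ℤ)
    (x : VecField F Z) : ⁅w, compField T.conn n x⁆ = compField T.conn n ⁅w, x⁆ := by
  obtain ⟨⟨W, hW⟩, hA⟩ := id hw
  have h1 : ∀ h, w (P.pullFun h) = P.pullFun (W h) := fun h =>
    congrArg (fun Y : P.VecAlong => Y.1 h) hW
  refine eq_compField _ (fun h => ?_) ?_
  · rw [Derivation.commutator_apply, Derivation.commutator_apply, h1, compField_pullFun,
      compField_pullFun, hw.apply_comp, map_sub]
  · obtain ⟨k, hk⟩ := P.exists_pullFun_eq hA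
    rw [form_lie, form_lie, ← hk, compField_pullFun, form_compField, hw.apply_comp, map_sub,
      map_sub, dOneForm, dOneForm,
      ← comp_invariantForm T.conn fun w' hw' => T.contractD_conn_mem hw hw']

theorem compForm_lieOneForm {w : VecField F Z} (hw : IsInvariantField T.conn w) (n : ℤ)
    (α : OneForm F Z) : lieOneForm w (compForm T.conn n α) =
      compForm T.conn n (lieOneForm w α) := by
  refine eq_compForm _ fun w' hw' => ?_
  rw [lieOneForm_apply, lieOneForm_apply, compForm_apply_invariant _ _ _ hw',
    compForm_apply_invariant _ _ _ (hw.lie hw'), hw.apply_comp, map_sub]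

/-- The weight components of a section of `TZ ⊕ T*Z`. -/
def compSection (n : ℤ) (a : GenSection F Z) : GenSection F Z :=
  (compField T.conn n a.1, compForm T.conn n a.2)

theorem isConvolution_dorfman_fst (a b : GenSection F Z) (h : SmoothFun E M) :
    P.IsConvolution
      (fun n m => (dorfman T.flux (T.compSection n a) (T.compSection m b)).1 (P.pullFun h))
      ((dorfman T.flux a b).1 (P.pullFun h)) := by
  have h1 := (isConvolution_apply T.conn a.1 (b.1 (P.pullFun h))).sub
    (isConvolution_apply T.conn b.1 (a.1 (P.pullFun h))).flip
  simp only [← compField_pullFun T.conn, ← Derivation.commutator_apply] at h1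
  exact h1

/-- The formula for dA writes the connection value of a bracket as two actions of fields on
functions and one pairing, each of which is a convolution. -/
theorem isConvolution_dorfman_form (a b : GenSection F Z) :
    P.IsConvolution
      (fun n m => T.conn.form (dorfman T.flux (T.compSection n a) (T.compSection m b)).1)
      (T.conn.form (dorfman T.flux a b).1) := by
  have h1 := ((isConvolution_apply T.conn a.1 (T.conn.form b.1)).sub
    (isConvolution_apply T.conn b.1 (T.conn.form a.1)).flip).sub
    (isConvolution_form T.conn (contractD a.1 T.conn.form) b.1)
  simp only [← form_compField, ← compForm_contractD_conn] at h1
  simp only [dorfman, form_lie]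
  exact h1

theorem isConvolution_dorfman_snd (a b : GenSection F Z) {w : VecField F Z}
    (hw : IsInvariantField T.conn w) :
    P.IsConvolution
      (fun n m => (dorfman T.flux (T.compSection n a) (T.compSection m b)).2 w)
      ((dorfman T.flux a b).2 w) := by
  -- The fixed invariant field is moved into operators that commute with components: bracket with
  -- `w`, Lie derivative along `w`, contraction of the flux. The derivative of `a.2 b.1` along `w`
  -- is split by the Leibniz rule, so that every term is an action or a pairing.
  have key : ∀ a b : GenSection F Z, (dorfman T.flux a b).2 w =
      a.1 (b.2 w) + b.2 ⁅w, a.1⁆ - (b.1 (a.2 w) + a.2 ⁅w, b.1⁆ -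
        (lieOneForm w a.2 b.1 + a.2 ⁅w, b.1⁆)) + contractTwo T.flux w a.1 b.1 := by
    intro a b
    have h1 : T.flux ![b.1, a.1, w] = T.flux ![a.1, w, b.1] :=
      (kForm_three_rotate T.flux b.1 a.1 w).symm
    simp only [dorfman, LinearMap.add_apply, LinearMap.sub_apply, lieOneForm_apply,
      contractD_apply, contractTwo_apply, h1]
    rw [← lie_skew a.1 w, ← lie_skew b.1 w, map_neg, map_neg]
    ring
  have h1 := (((isConvolution_apply T.conn a.1 (b.2 w)).add
    (isConvolution_form T.conn b.2 ⁅w, a.1⁆).flip).sub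
    (((isConvolution_apply T.conn b.1 (a.2 w)).flip.add
      (isConvolution_form T.conn a.2 ⁅w, b.1⁆)).sub
      ((isConvolution_form T.conn (lieOneForm w a.2) b.1).add
        (isConvolution_form T.conn a.2 ⁅w, b.1⁆)))).add
    (isConvolution_form T.conn (contractTwo T.flux w a.1) b.1)
  simp only [← T.compField_lie hw, ← T.compForm_lieOneForm hw, ← T.compForm_contractTwo_flux hw,
    ← compForm_apply_invariant T.conn _ _ hw] at h1
  rw [key]
  simp only [key]
  exact h1

end TDualPair

/-! ### Convolution formulas for quadruples. -/

namespace CircleBundle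

variable {E : Type*} [NormedAddCommGroup E] [NormedSpace ℝ E] [FiniteDimensional ℝ E]
  {M : Type*} [TopologicalSpace M] [ChartedSpace E M] [IsManifold 𝓘(ℝ, E) ∞ M] [T2Space M]
  {F : Type*} [NormedAddCommGroup F] [NormedSpace ℝ F] [FiniteDimensional ℝ F]
  {Z : Type*} [TopologicalSpace Z] [ChartedSpace F Z] [IsManifold 𝓘(ℝ, F) ∞ Z] [T2Space Z]
  [MulAction Circle Z] {P : CircleBundle E F M Z}

/-- The quadruple `c` has the weight components `c_p = ∑_n u_{n, p-n}`. -/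
structure IsQuadConvolution (P : CircleBundle E F M Z) (u : ℤ → ℤ → P.Quad) (c : P.Quad) :
    Prop where
  vec : ∀ h, P.IsConvolution (fun n m => (u n m).1.1 h) (c.1.1 h)
  fst : P.IsConvolution (fun n m => (u n m).2.1) c.2.1
  dual : ∀ W, P.IsConvolution (fun n m => (u n m).2.2.1 (P.baseVec W)) (c.2.2.1 (P.baseVec W))
  snd : P.IsConvolution (fun n m => (u n m).2.2.2) c.2.2.2

namespace IsQuadConvolution

variable {u : ℤ → ℤ → P.Quad} {c : P.Quad}

/-- The one-form component is known to converge only on fields of the base; at a given point any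
field along the projection is a finite combination of those. -/
theorem quadHasSum (hu : P.IsQuadConvolution u c) (p : ℤ) :
    P.QuadHasSum (fun n => u n (p - n)) (P.compQuad p c) := by
  refine ⟨fun h => hu.vec h p, hu.fst p, fun X z => ?_, hu.snd p⟩
  obtain ⟨fr⟩ := exists_localFrame (E := E) (P.proj z)
  have h1 : ∀ ζ : Module.Dual (SmoothFun F Z) P.VecAlong,
      ζ X z = ∑ i, X.1 (fr.coord i) z * ζ (P.baseVec (fr.vec i)) z := by
    intro ζ
    have := congrArg (fun Y => ζ Y z) (P.smul_vecAlong fr X)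
    simpa [map_sum, fr.cutoff_eq_one.self_of_nhds] using this
  simp only [h1]
  refine hasSum_sum fun i _ => HasSum.mul_left _ ?_
  simpa using hu.dual (fr.vec i) p z

theorem mem_weightSec (hu : P.IsQuadConvolution u c) {n m : ℤ}
    (h0 : ∀ k l, ¬(k = n ∧ l = m) → u k l = 0) : c ∈ P.weightSec (n + m) :=
  ⟨fun h => (hu.vec h).mem_lineSec fun k l hkl => by rw [h0 k l hkl]; rfl,
    hu.fst.mem_lineSec fun k l hkl => by rw [h0 k l hkl]; rfl,
    fun W => (hu.dual W).mem_lineSec fun k l hkl => by rw [h0 k l hkl]; rfl,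
    hu.snd.mem_lineSec fun k l hkl => by rw [h0 k l hkl]; rfl⟩

end IsQuadConvolution

theorem QuadHasSum.negSwap {s : ℤ → P.Quad} {c : P.Quad} (h : P.QuadHasSum s c) :
    P.QuadHasSum (fun n => P.negSwap (s n)) (P.negSwap c) :=
  ⟨fun k z => (h.1 k z).neg, fun z => (h.2.2.2 z).neg, fun W z => (h.2.2.1 W z).neg,
    fun z => (h.2.1 z).neg⟩

theorem QuadHasSum.unique {s : ℤ → P.Quad} {c d : P.Quad} (h : P.QuadHasSum s c)
    (h' : P.QuadHasSum s d) : c = d := by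
  refine P.quad_ext (fun k => ?_) ?_ (fun W => ?_) ?_ <;> ext z
  · exact (h.1 k z).unique (h'.1 k z)
  · exact (h.2.1 z).unique (h'.2.1 z)
  · exact (h.2.2.1 _ z).unique (h'.2.2.1 _ z)
  · exact (h.2.2.2 z).unique (h'.2.2.2 z)

end CircleBundle

/-! ### The Dorfman bracket on quadruples. -/

namespace TDualPair

variable {E : Type*} [NormedAddCommGroup E] [NormedSpace ℝ E] [FiniteDimensional ℝ E]
  {M : Type*} [TopologicalSpace M] [ChartedSpace E M] [IsManifold 𝓘(ℝ, E) ∞ M] [T2Space M]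
  {F : Type*} [NormedAddCommGroup F] [NormedSpace ℝ F] [FiniteDimensional ℝ F]
  {Z : Type*} [TopologicalSpace Z] [ChartedSpace F Z] [IsManifold 𝓘(ℝ, F) ∞ Z] [T2Space Z]
  [MulAction Circle Z]
  {F' : Type*} [NormedAddCommGroup F'] [NormedSpace ℝ F']
  {Z' : Type*} [TopologicalSpace Z'] [ChartedSpace F' Z'] [IsManifold 𝓘(ℝ, F') ∞ Z']
  [MulAction Circle Z'] {P : CircleBundle E F M Z} {P' : CircleBundle E F' M Z'}
  (T : TDualPair P P')

/-- The Dorfman bracket in terms of quadruples. -/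
def quadDorfman (c d : P.Quad) : P.Quad :=
  (assembleEquiv T.conn).symm (dorfman T.flux (assemble T.conn c) (assemble T.conn d))

theorem assemble_compQuad_eq (n : ℤ) (c : P.Quad) :
    assemble T.conn (P.compQuad n c) = T.compSection n (assemble T.conn c) := by
  have h1 := assemble_compQuad T.conn n (assembleEquiv T.conn c)
  rwa [LinearEquiv.symm_apply_apply] at h1

theorem isQuadConvolution_dorfman (c d : P.Quad) :
    P.IsQuadConvolution (fun n m => T.quadDorfman (P.compQuad n c) (P.compQuad m d))
      (T.quadDorfman c d) := by
  simp only [quadDorfman, assemble_compQuad_eq]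
  exact ⟨T.isConvolution_dorfman_fst _ _, T.isConvolution_dorfman_form _ _,
    fun W => T.isConvolution_dorfman_snd _ _ (isInvariantField_horLift T.conn W),
    T.isConvolution_dorfman_snd _ _ (isInvariantField_generator T.conn)⟩

theorem quadDorfman_zero_left (d : P.Quad) : T.quadDorfman 0 d = 0 := by
  have h1 : assemble T.conn (0 : P.Quad) = 0 := map_zero (assembleEquiv T.conn)
  rw [quadDorfman, h1, dorfman_zero_left, map_zero]

theorem quadDorfman_zero_right (c : P.Quad) : T.quadDorfman c 0 = 0 := by
  have h1 : assemble T.conn (0 : P.Quad) = 0 := map_zero (assembleEquiv T.conn)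
  rw [quadDorfman, h1, dorfman_zero_right, map_zero]

/-- For pure weights the convolution has a single nonzero term, so only one component of the bracket
survives. -/
theorem quadDorfman_mem {n m : ℤ} {c d : P.Quad} (hc : c ∈ P.weightSec n)
    (hd : d ∈ P.weightSec m) : T.quadDorfman c d ∈ P.weightSec (n + m) := by
  refine (T.isQuadConvolution_dorfman c d).mem_weightSec fun k l hkl => ?_
  rw [P.compQuad_of_mem hc, P.compQuad_of_mem hd]
  by_cases hk : k = n
  · have hl : l ≠ m := fun hl => hkl ⟨hk, hl⟩
    rw [if_neg hl, quadDorfman_zero_right]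
  · rw [if_neg hk, quadDorfman_zero_left]

end TDualPair

/-! ### Cartan calculus as identities between operators on cochains. -/

section Cartan

variable {V R S : Type*} [CommRing R] [CommRing S] [Algebra S R]

theorem Cochain.ext_contract {k : ℕ} {σ τ : Cochain V R (k + 1)}
    (h : ∀ x, contract x σ = contract x τ) : σ = τ := by
  funext u
  have h1 := congrFun (h (u 0)) (Fin.tail u)
  simpa only [contract, Fin.cons_self_tail] using h1

theorem wedgeOne_add (α : V → R) (k : ℕ) (σ τ : Cochain V R k) :
    wedgeOne α k (σ + τ) = wedgeOne α k σ + wedgeOne α k τ := by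
  induction k with
  | zero => funext u; exact mul_add _ _ _
  | succ k ih =>
    funext u
    have h1 : contract (u 0) (σ + τ) = contract (u 0) σ + contract (u 0) τ := rfl
    simp only [wedgeOne, h1, ih, Pi.add_apply]
    ring

theorem wedgeTwo_add (β : V → V → R) (k : ℕ) (σ τ : Cochain V R k) :
    wedgeTwo β k (σ + τ) = wedgeTwo β k σ + wedgeTwo β k τ := by
  induction k with
  | zero => funext u; exact mul_add _ _ _
  | succ k ih =>
    funext u
    have h1 : contract (u 0) (σ + τ) = contract (u 0) σ + contract (u 0) τ := rfl
    simp only [wedgeTwo, h1, ih, wedgeOne_add, Pi.add_apply]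
    ring

theorem wedgeThree_add (η : V → V → V → R) (k : ℕ) (σ τ : Cochain V R k) :
    wedgeThree η k (σ + τ) = wedgeThree η k σ + wedgeThree η k τ := by
  induction k with
  | zero => funext u; exact mul_add _ _ _
  | succ k ih =>
    funext u
    have h1 : contract (u 0) (σ + τ) = contract (u 0) σ + contract (u 0) τ := rfl
    simp only [wedgeThree, h1, ih, wedgeTwo_add, Pi.add_apply]
    ring

variable (D : V → Derivation S R R) (br : V → V → V)

theorem lieDer_add (x : V) {k : ℕ} (σ τ : Cochain V R k) :
    lieDer (fun x r => D x r) br x (σ + τ) =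
      lieDer (fun x r => D x r) br x σ + lieDer (fun x r => D x r) br x τ := by
  funext u
  simp only [lieDer, Pi.add_apply, map_add, Finset.sum_add_distrib]
  ring

theorem extDer_add (k : ℕ) (σ τ : Cochain V R k) :
    extDer (fun x r => D x r) br k (σ + τ) =
      extDer (fun x r => D x r) br k σ + extDer (fun x r => D x r) br k τ := by
  induction k with
  | zero => funext u; exact map_add _ _ _
  | succ k ih =>
    funext u
    have h1 : contract (u 0) (σ + τ) = contract (u 0) σ + contract (u 0) τ := rfl
    simp only [extDer, h1, ih, lieDer_add, Pi.add_apply]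
    ring

/-- Contraction as an additive operator. -/
def contractOp (x : V) : AddMonoid.End (MixedCochain V R) where
  toFun := mixedContract x
  map_zero' := rfl
  map_add' _ _ := rfl

/-- Multiplication by a function as an additive operator. -/
def mulOp (r : R) : AddMonoid.End (MixedCochain V R) where
  toFun σ := fun k u => r * σ k u
  map_zero' := funext₂ fun _ _ => mul_zero _
  map_add' _ _ := funext₂ fun _ _ => mul_add _ _ _

/-- Exterior multiplication by a one-form as an additive operator. -/
def wedgeOp (α : V → R) : AddMonoid.End (MixedCochain V R) :=
  AddMonoidHom.mk' (mixedWedgeOne α) fun _ _ => funext fun k => match k with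
    | 0 => (add_zero _).symm
    | k + 1 => wedgeOne_add α k _ _

/-- Exterior multiplication by a two-form as an additive operator. -/
def wedgeTwoOp (β : V → V → R) : AddMonoid.End (MixedCochain V R) :=
  AddMonoidHom.mk' (fun σ k => match k with
    | 0 => 0
    | 1 => 0
    | k + 2 => wedgeTwo β k (σ k)) fun _ _ => funext fun k => match k with
    | 0 => (add_zero _).symm
    | 1 => (add_zero _).symm
    | k + 2 => wedgeTwo_add β k _ _

/-- Exterior multiplication by a three-form as an additive operator. -/
def wedgeThreeOp (η : V → V → V → R) : AddMonoid.End (MixedCochain V R) :=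
  AddMonoidHom.mk' (mixedWedgeThree η) fun _ _ => funext fun k => match k with
    | 0 => (add_zero _).symm
    | 1 => (add_zero _).symm
    | 2 => (add_zero _).symm
    | k + 3 => wedgeThree_add η k _ _

/-- The Lie derivative as an additive operator. -/
def lieOp (x : V) : AddMonoid.End (MixedCochain V R) :=
  AddMonoidHom.mk' (fun σ k => lieDer (fun x r => D x r) br x (σ k)) fun _ _ =>
    funext fun _ => lieDer_add D br x _ _

/-- The exterior derivative as an additive operator. -/
def extOp : AddMonoid.End (MixedCochain V R) :=
  AddMonoidHom.mk' (mixedExtDer (fun x r => D x r) br) fun _ _ => funext fun k => match k with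
    | 0 => (add_zero _).symm
    | k + 1 => extDer_add D br k _ _

theorem contractOp_mul_mulOp (x : V) (r : R) :
    contractOp x * mulOp r = mulOp r * contractOp x := rfl

theorem mulOp_sub (r s : R) : (mulOp (r - s) : AddMonoid.End (MixedCochain V R)) =
    mulOp r - mulOp s :=
  AddMonoidHom.ext fun _ => funext₂ fun _ _ => sub_mul _ _ _

theorem mulOp_mul_mulOp (r s : R) : (mulOp r * mulOp s : AddMonoid.End (MixedCochain V R)) =
    mulOp s * mulOp r :=
  AddMonoidHom.ext fun _ => funext₂ fun _ _ => mul_left_comm _ _ _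

/-- In positive degree this is the recursion defining `wedgeOne`; in degree zero the last term is
absent. No linearity of cochains is involved, so the calculus runs on arbitrary functions of the
arguments. -/
theorem contractOp_mul_wedgeOp (x : V) (α : V → R) :
    contractOp x * wedgeOp α = mulOp (α x) - wedgeOp α * contractOp x := by
  refine AddMonoidHom.ext fun σ => funext₂ fun k u => ?_
  cases k with
  | zero =>
    have h1 : u = ![] := Subsingleton.elim _ _
    subst h1
    exact (sub_zero _).symm
  | succ k => rfl

theorem contractOp_mul_wedgeTwoOp (x : V) (β : V → V → R) :
    contractOp x * wedgeTwoOp β = wedgeOp (β x) + wedgeTwoOp β * contractOp x := by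
  refine AddMonoidHom.ext fun σ => funext₂ fun k u => ?_
  match k with
  | 0 => exact (add_zero _).symm
  | 1 => exact (add_zero _).symm
  | k + 2 => rfl

theorem contractOp_mul_wedgeThreeOp (x : V) (η : V → V → V → R) :
    contractOp x * wedgeThreeOp η = wedgeTwoOp (η x) - wedgeThreeOp η * contractOp x := by
  refine AddMonoidHom.ext fun σ => funext₂ fun k u => ?_
  match k with
  | 0 => exact (sub_zero _).symm
  | 1 => exact (sub_zero _).symm
  | 2 => exact (sub_zero _).symm
  | k + 3 => rfl

theorem contractOp_mul_extOp (x : V) :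
    contractOp x * extOp D br = lieOp D br x - extOp D br * contractOp x := by
  refine AddMonoidHom.ext fun σ => funext₂ fun k u => ?_
  cases k with
  | zero =>
    have h1 : u = ![] := Subsingleton.elim _ _
    subst h1
    change D x _ = D x _ - ∑ i : Fin 0, _ - 0
    simp
  | succ k => rfl

/-- The correction is the summand of the Lie derivative in which the bracket hits the slot filled by
`y`; the other summands commute with the contraction. -/
theorem contractOp_mul_lieOp (x y : V) :
    contractOp y * lieOp D br x = lieOp D br x * contractOp y - contractOp (br x y) := by
  refine AddMonoidHom.ext fun σ => funext₂ fun k u => ?_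
  change lieDer (fun x r => D x r) br x (σ (k + 1)) (Fin.cons y u) =
    lieDer (fun x r => D x r) br x (contract y (σ (k + 1))) u - σ (k + 1) (Fin.cons (br x y) u)
  simp only [lieDer, contract, Fin.sum_univ_succ, Fin.cons_zero, Fin.cons_succ,
      Fin.update_cons_zero,
    ← Fin.cons_update]
  ring

theorem lieOp_mul_mulOp (x : V) (r : R) :
    lieOp D br x * mulOp r = mulOp r * lieOp D br x + mulOp (D x r) := by
  refine AddMonoidHom.ext fun σ => funext₂ fun k u => ?_
  change D x (r * σ k u) - ∑ i, r * σ k _ = r * (D x (σ k u) - ∑ i, σ k _) + D x r * σ k u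
  rw [Derivation.leibniz, ← Finset.mul_sum, smul_eq_mul, smul_eq_mul]
  ring

/-- An operator that vanishes in degree zero and commutes with contractions up to sign
vanishes. -/
theorem op_eq_zero {A : AddMonoid.End (MixedCochain V R)} (h0 : ∀ σ, A σ 0 = 0)
    (h : (∀ x, contractOp x * A = A * contractOp x) ∨ (∀ x,
        contractOp x * A = -(A * contractOp x))) :
    A = 0 := by
  have key : ∀ k σ, A σ k = 0 := by
    intro k
    induction k with
    | zero => exact h0
    | succ k ih =>
      intro σ
      -- A cochain of positive degree is determined by its contractions; moving the contraction
      -- through `A` lowers the degree.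
      refine Cochain.ext_contract fun x => ?_
      change (contractOp x * A : AddMonoid.End (MixedCochain V R)) σ k = 0
      rcases h with h | h
      · rw [h]; exact ih _
      · rw [h]; exact (congrArg Neg.neg (ih _)).trans neg_zero
  exact AddMonoidHom.ext fun σ => funext fun k => key k σ

/-- The operator identities from here to `extOp_mul_wedgeOp` follow one scheme: the difference of
the sides vanishes in degree zero, and commuting a contraction through it by earlier identities
reproduces it up to sign, so `op_eq_zero` applies. -/
theorem mulOp_mul_wedgeOp (r : R) (α : V → R) :
    mulOp r * wedgeOp α = wedgeOp α * mulOp r := by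
  rw [← sub_eq_zero]
  refine op_eq_zero (fun σ => ?_) (Or.inr fun x => ?_)
  · exact funext fun u => (congrArg (· - (0 : R)) (mul_zero r)).trans (sub_zero 0)
  · rw [mul_sub, ← mul_assoc, ← mul_assoc, contractOp_mul_mulOp, contractOp_mul_wedgeOp,
      mul_assoc, contractOp_mul_wedgeOp, mul_sub, sub_mul, mul_assoc (wedgeOp α),
      contractOp_mul_mulOp, mulOp_mul_mulOp]
    simp only [mul_add, add_mul, mul_sub, sub_mul, neg_mul, mul_neg, mul_assoc]
    abel

theorem wedgeOp_mul_wedgeOp (α β : V → R) :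
    (wedgeOp α * wedgeOp β : AddMonoid.End (MixedCochain V R)) = -(wedgeOp β * wedgeOp α) := by
  rw [← sub_eq_zero, sub_neg_eq_add]
  refine op_eq_zero (fun σ => add_zero _) (Or.inl fun x => ?_)
  rw [mul_add, ← mul_assoc, ← mul_assoc, contractOp_mul_wedgeOp, contractOp_mul_wedgeOp, sub_mul,
    sub_mul, mul_assoc, mul_assoc _ _ (wedgeOp α), contractOp_mul_wedgeOp, contractOp_mul_wedgeOp,
    mulOp_mul_wedgeOp, mulOp_mul_wedgeOp]
  simp only [mul_add, add_mul, mul_sub, sub_mul, neg_mul, mul_neg, mul_assoc]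
  abel

theorem wedgeTwoOp_mul_mulOp (r : R) (β : V → V → R) :
    mulOp r * wedgeTwoOp β = wedgeTwoOp β * mulOp r := by
  rw [← sub_eq_zero]
  refine op_eq_zero (fun σ => ?_) (Or.inl fun x => ?_)
  · exact funext fun u => (congrArg (· - (0 : R)) (mul_zero r)).trans (sub_zero 0)
  · rw [mul_sub, ← mul_assoc, ← mul_assoc, contractOp_mul_mulOp, contractOp_mul_wedgeTwoOp,
      mul_assoc, contractOp_mul_wedgeTwoOp, mul_add, add_mul, mul_assoc (wedgeTwoOp β),
      contractOp_mul_mulOp, mulOp_mul_wedgeOp]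
    simp only [mul_add, add_mul, mul_sub, sub_mul, neg_mul, mul_neg, mul_assoc]
    abel

theorem wedgeTwoOp_mul_wedgeOp (β : V → V → R) (α : V → R) :
    (wedgeTwoOp β * wedgeOp α : AddMonoid.End (MixedCochain V R)) = wedgeOp α * wedgeTwoOp β := by
  rw [← sub_eq_zero]
  refine op_eq_zero (fun σ => sub_zero _) (Or.inr fun x => ?_)
  rw [mul_sub, ← mul_assoc, ← mul_assoc, contractOp_mul_wedgeOp, contractOp_mul_wedgeTwoOp, sub_mul,
    add_mul, mul_assoc, mul_assoc (wedgeOp α), contractOp_mul_wedgeOp, contractOp_mul_wedgeTwoOp,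
    wedgeTwoOp_mul_mulOp, wedgeOp_mul_wedgeOp]
  simp only [mul_add, add_mul, mul_sub, sub_mul, neg_mul, mul_neg, mul_assoc]
  abel

theorem wedgeThreeOp_mul_wedgeOp (η : V → V → V → R) (α : V → R) :
    (wedgeThreeOp η * wedgeOp α : AddMonoid.End (MixedCochain V R)) =
      -(wedgeOp α * wedgeThreeOp η) := by
  have h1 : ∀ r : R, (mulOp r * wedgeThreeOp η : AddMonoid.End (MixedCochain V R)) =
      wedgeThreeOp η * mulOp r := by
    intro r
    rw [← sub_eq_zero]
    refine op_eq_zero (fun σ => ?_) (Or.inr fun x => ?_)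
    · exact funext fun u => (congrArg (· - (0 : R)) (mul_zero r)).trans (sub_zero 0)
    · rw [mul_sub, ← mul_assoc, ← mul_assoc, contractOp_mul_mulOp, contractOp_mul_wedgeThreeOp,
        mul_assoc, contractOp_mul_wedgeThreeOp, mul_sub, sub_mul, mul_assoc (wedgeThreeOp η),
        contractOp_mul_mulOp, wedgeTwoOp_mul_mulOp]
      simp only [mul_add, add_mul, mul_sub, sub_mul, neg_mul, mul_neg, mul_assoc]
      abel
  rw [← sub_eq_zero, sub_neg_eq_add]
  refine op_eq_zero (fun σ => add_zero _) (Or.inl fun x => ?_)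
  rw [mul_add, ← mul_assoc, ← mul_assoc, contractOp_mul_wedgeOp, contractOp_mul_wedgeThreeOp,
    sub_mul, sub_mul, mul_assoc (wedgeThreeOp η), mul_assoc (wedgeOp α), contractOp_mul_wedgeOp,
    contractOp_mul_wedgeThreeOp, h1, wedgeTwoOp_mul_wedgeOp]
  simp only [mul_add, add_mul, mul_sub, sub_mul, neg_mul, mul_neg, mul_assoc]
  abel

theorem extOp_mul_mulOp (r : R) :
    extOp D br * mulOp r = mulOp r * extOp D br + wedgeOp (fun x => D x r) := by
  rw [← sub_eq_zero]
  refine op_eq_zero (fun σ => ?_) (Or.inr fun x => ?_)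
  · refine funext fun u => ?_
    change (0 : R) - (r * 0 + 0) = 0
    simp
  · rw [mul_sub, mul_add, ← mul_assoc, ← mul_assoc, contractOp_mul_mulOp, contractOp_mul_extOp,
      sub_mul, mul_assoc, mul_assoc, contractOp_mul_extOp, contractOp_mul_mulOp, lieOp_mul_mulOp,
      contractOp_mul_wedgeOp]
    simp only [mul_add, add_mul, mul_sub, sub_mul, neg_mul, mul_neg, mul_assoc]
    abel

theorem lieOp_mul_wedgeOp (x : V) (α : V → R) :
    lieOp D br x * wedgeOp α =
      wedgeOp α * lieOp D br x + wedgeOp (fun w => D x (α w) - α (br x w)) := by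
  rw [← sub_eq_zero]
  refine op_eq_zero (fun σ => ?_) (Or.inr fun y => ?_)
  · refine funext fun u => ?_
    change D x (0 : R) - ∑ i : Fin 0, _ - (0 + 0) = 0
    simp
  · rw [mul_sub, mul_add, ← mul_assoc, ← mul_assoc, contractOp_mul_lieOp, contractOp_mul_wedgeOp,
      contractOp_mul_wedgeOp, sub_mul, sub_mul, mul_assoc, mul_assoc (wedgeOp α),
      contractOp_mul_lieOp, contractOp_mul_wedgeOp, contractOp_mul_wedgeOp, mul_sub,
      lieOp_mul_mulOp, mulOp_sub]
    simp only [mul_add, add_mul, mul_sub, sub_mul, neg_mul, mul_neg, mul_assoc]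
    abel

theorem wedgeOp_sub (α β : V → R) : (wedgeOp (fun w => α w - β w) :
    AddMonoid.End (MixedCochain V R)) = wedgeOp α - wedgeOp β := by
  rw [← sub_eq_zero]
  refine op_eq_zero (fun σ => ?_) (Or.inr fun x => ?_)
  · exact (sub_eq_zero.mpr (sub_zero _).symm)
  · rw [mul_sub, mul_sub, contractOp_mul_wedgeOp, contractOp_mul_wedgeOp, contractOp_mul_wedgeOp,
      mulOp_sub]
    simp only [mul_add, add_mul, mul_sub, sub_mul, neg_mul, mul_neg, mul_assoc]
    abel

theorem wedgeOp_add (α β : V → R) : (wedgeOp (fun w => α w + β w) :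
    AddMonoid.End (MixedCochain V R)) = wedgeOp α + wedgeOp β := by
  have h1 := wedgeOp_sub (fun w => α w + β w) β
  simp only [add_sub_cancel_right] at h1
  rw [h1, sub_add_cancel]

theorem wedgeOp_mul (r : R) (α : V → R) : (wedgeOp (fun w => r * α w) :
    AddMonoid.End (MixedCochain V R)) = mulOp r * wedgeOp α := by
  rw [← sub_eq_zero]
  refine op_eq_zero (fun σ => ?_) (Or.inr fun x => ?_)
  · exact funext fun u => (congrArg ((0 : R) - ·) (mul_zero r)).trans (sub_zero 0)
  · have h1 : (mulOp (r * α x) : AddMonoid.End (MixedCochain V R)) = mulOp r * mulOp (α x) :=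
      AddMonoidHom.ext fun _ => funext₂ fun _ _ => mul_assoc _ _ _
    rw [mul_sub, ← mul_assoc, contractOp_mul_mulOp, contractOp_mul_wedgeOp, mul_assoc,
      contractOp_mul_wedgeOp, h1]
    simp only [mul_add, add_mul, mul_sub, sub_mul, neg_mul, mul_neg, mul_assoc]
    abel

theorem extOp_mul_wedgeOp (α : V → R) :
    extOp D br * wedgeOp α =
      wedgeTwoOp (fun y w => D y (α w) - α (br y w) - D w (α y)) - wedgeOp α * extOp D br := by
  rw [← sub_eq_zero]
  refine op_eq_zero (fun σ => ?_) (Or.inl fun x => ?_)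
  · refine funext fun u => ?_
    change (0 : R) - (0 - 0) = 0
    simp
  · rw [mul_sub, mul_sub, ← mul_assoc, ← mul_assoc, contractOp_mul_extOp,
      contractOp_mul_wedgeOp, contractOp_mul_wedgeTwoOp, sub_mul, sub_mul, mul_assoc,
      mul_assoc (wedgeOp α), contractOp_mul_extOp, contractOp_mul_wedgeOp, mul_sub,
      extOp_mul_mulOp, lieOp_mul_wedgeOp]
    simp only [wedgeOp_sub, mul_add, add_mul, mul_sub, sub_mul, neg_mul, mul_neg, mul_assoc]
    abel

/-- The derived bracket of the exterior derivative twisted by a three-form. -/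
theorem derived_bracket (η : V → V → V → R) (x y : V) (α β : V → R) :
    let Q : AddMonoid.End (MixedCochain V R) := extOp D br + wedgeThreeOp η
    let a : AddMonoid.End (MixedCochain V R) := contractOp x + wedgeOp α
    let b : AddMonoid.End (MixedCochain V R) := contractOp y + wedgeOp β
    (Q * a + a * Q) * b - b * (Q * a + a * Q) =
      contractOp (br x y) + wedgeOp (fun w => D x (β w) - β (br x w) -
        (D y (α w) - α (br y w) - D w (α y)) - η x y w) := by
  intro Q a b
  -- By Cartan's formula the inner anticommutator is a Lie derivative plus multiplication by
  -- two-forms, an even operator; hence the outer bracket is a commutator. Neither the Jacobi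
  -- identity nor closedness of `η` is needed.
  have h1 : Q * a + a * Q = lieOp D br x +
      wedgeTwoOp (fun y w => D y (α w) - α (br y w) - D w (α y)) + wedgeTwoOp (η x) := by
    simp only [Q, a, mul_add, add_mul, mul_sub, sub_mul, contractOp_mul_extOp,
        contractOp_mul_wedgeThreeOp,
      extOp_mul_wedgeOp, wedgeThreeOp_mul_wedgeOp]
    abel
  rw [h1]
  simp only [b, mul_add, add_mul, mul_sub, sub_mul, contractOp_mul_lieOp, contractOp_mul_wedgeTwoOp,
    lieOp_mul_wedgeOp, wedgeTwoOp_mul_wedgeOp, wedgeOp_sub]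
  abel

end Cartan

/-! ### Contractions on alternating cochains and the weight-dependent correction. -/

section Alternating

variable {V R : Type*} [CommRing R] [AddCommGroup V] [Module R V]

/-- Inhomogeneous cochains all of whose components are alternating multilinear. -/
def IsAlternatingCochain (σ : MixedCochain V R) : Prop :=
  ∀ k, ∃ ζ : V [⋀^Fin k]→ₗ[R] R, σ k = fun u => ζ u

namespace IsAlternatingCochain

variable {σ : MixedCochain V R}

theorem contract (hσ : IsAlternatingCochain σ) (x : V) :
    IsAlternatingCochain (contractOp x σ) := fun k => by
  obtain ⟨ζ, hζ⟩ := hσ (k + 1)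
  exact ⟨ζ.curryLeft x, funext fun u => congrFun hζ _⟩

theorem contractOp_add (hσ : IsAlternatingCochain σ) (x y : V) :
    contractOp (x + y) σ =
      contractOp x σ + contractOp y σ :=
  funext fun k => by
    obtain ⟨ζ, hζ⟩ := hσ (k + 1)
    change ExoticTDuality.contract (x + y) (σ (k + 1)) = ExoticTDuality.contract x (σ (k + 1)) +
      ExoticTDuality.contract y (σ (k + 1))
    rw [hζ]
    exact funext fun u => congrArg (fun z : V [⋀^Fin k]→ₗ[R] R => z u) (ζ.curryLeft.map_add x y)

theorem contractOp_smul (hσ : IsAlternatingCochain σ) (r : R) (x : V) :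
    contractOp (r • x) σ = r • contractOp x σ :=
  funext fun k => by
    obtain ⟨ζ, hζ⟩ := hσ (k + 1)
    change ExoticTDuality.contract (r • x) (σ (k + 1)) =
      r • ExoticTDuality.contract x (σ (k + 1))
    rw [hζ]
    exact funext fun u => congrArg (fun z : V [⋀^Fin k]→ₗ[R] R => z u) (ζ.curryLeft.map_smul r x)

theorem contractOp_neg (hσ : IsAlternatingCochain σ) (x : V) :
    contractOp (-x) σ = -contractOp x σ := by
  rw [← neg_one_smul R x, hσ.contractOp_smul, neg_one_smul]

theorem contractOp_sub (hσ : IsAlternatingCochain σ) (x y : V) :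
    contractOp (x - y) σ = contractOp x σ - contractOp y σ := by
  rw [sub_eq_add_neg, hσ.contractOp_add, hσ.contractOp_neg, sub_eq_add_neg]

theorem contractOp_swap (hσ : IsAlternatingCochain σ) (x y : V) :
    contractOp x (contractOp y σ) =
      -contractOp y (contractOp x σ) := funext₂ fun k u => by
  obtain ⟨ζ, hζ⟩ := hσ (k + 2)
  change σ (k + 2) (Fin.cons y (Fin.cons x u)) = -σ (k + 2) (Fin.cons x (Fin.cons y u))
  rw [hζ]
  have h1 := ζ.map_swap (Fin.cons x (Fin.cons y u)) (i := 0) (j := 1) (by simp)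
  rw [← h1]
  congr 1
  funext i
  refine Fin.cases ?_ (fun i => Fin.cases ?_ (fun i => ?_) i) i
  · simp [Equiv.swap_apply_left]
  · have : Equiv.swap (0 : Fin (k + 2)) 1 (Fin.succ 0) = 0 := Equiv.swap_apply_right _ _
    simp only [Function.comp_apply, this]; rfl
  · have : Equiv.swap (0 : Fin (k + 2)) 1 i.succ.succ = i.succ.succ :=
      Equiv.swap_apply_of_ne_of_ne (Fin.succ_ne_zero _) (by simp [Fin.ext_iff])
    simp only [Function.comp_apply, this]; rfl

end IsAlternatingCochain

theorem contractOp_wedgeOp_apply (x : V) (α : V → R) (σ : MixedCochain V R) :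
    contractOp x (wedgeOp α σ) = α x • σ - wedgeOp α (contractOp x σ) :=
  congrArg (fun A : AddMonoid.End (MixedCochain V R) => A σ) (contractOp_mul_wedgeOp x α)

theorem wedgeOp_smul_apply (r : R) (α : V → R) (σ : MixedCochain V R) :
    wedgeOp α (r • σ) = r • wedgeOp α σ :=
  (congrArg (fun A : AddMonoid.End (MixedCochain V R) => A σ) (mulOp_mul_wedgeOp r α)).symm

theorem contractOp_smul_apply (r : R) (x : V) (σ : MixedCochain V R) :
    contractOp x (r • σ) = r • contractOp x σ := rfl

/-- The contribution of a contraction whose coefficient depends on the weight to a derived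
bracket. -/
theorem weighted_derived_bracket {σ : MixedCochain V R} (hσ : IsAlternatingCochain σ) (e x y : V)
    (α β : V → R) (p m n : R) :
    let a : AddMonoid.End (MixedCochain V R) := contractOp x + wedgeOp α
    let b : AddMonoid.End (MixedCochain V R) := contractOp y + wedgeOp β
    (p + m + n) • contractOp e (a (b σ)) + a ((p + m) • contractOp e (b σ)) -
        b ((p + n) • contractOp e (a σ) + a (p • contractOp e σ)) =
      (m * α e) • b σ - (n * β e) • a σ + (n * (α y + β x)) • contractOp e σ := by
  intro a b
  -- Only the anticommutation of contractions requires alternating cochains. Morally, the weights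
  -- shift by n under `a` and by m under `b`, the anticommutators with the contraction by `e` are
  -- α(e) and β(e), and that of `a` with `b` is the pairing; p drops out.
  have hxy := (hσ.contract e).contractOp_swap x y
  have hex := hσ.contractOp_swap e x
  have hey := hσ.contractOp_swap e y
  have hexy := (hσ.contract y).contractOp_swap e x
  have hadd : ∀ (A B : AddMonoid.End (MixedCochain V R)) τ, (A + B) τ = A τ + B τ :=
    fun _ _ _ => rfl
  simp only [a, b, hadd, map_add, map_sub, map_neg, contractOp_wedgeOp_apply,
    wedgeOp_smul_apply, contractOp_smul_apply, hexy, hex, hey, smul_add, smul_sub, smul_neg, hxy]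
  have h1 : wedgeOp α (wedgeOp β (contractOp e σ)) = -wedgeOp β (wedgeOp α (contractOp e σ)) :=
    congrArg (fun A : AddMonoid.End (MixedCochain V R) => A (contractOp e σ))
      (wedgeOp_mul_wedgeOp α β)
  rw [h1]
  module

end Alternating

/-! ### Weights of assembled sections. -/

namespace CircleBundle

variable {E : Type*} [NormedAddCommGroup E] [NormedSpace ℝ E] [FiniteDimensional ℝ E]
  {M : Type*} [TopologicalSpace M] [ChartedSpace E M] [IsManifold 𝓘(ℝ, E) ∞ M] [T2Space M]
  {F : Type*} [NormedAddCommGroup F] [NormedSpace ℝ F] [FiniteDimensional ℝ F]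
  {Z : Type*} [TopologicalSpace Z] [ChartedSpace F Z] [IsManifold 𝓘(ℝ, F) ∞ Z] [T2Space Z]
  [MulAction Circle Z] {P : CircleBundle E F M Z}

theorem assemble_fst_pullFun (A : P.Connection) (c : P.Quad) (h : SmoothFun E M) :
    (assemble A c).1 (P.pullFun h) = c.1.1 h := by
  have h1 : (assemble A c).1 (P.pullFun h) =
      horLift A c.1 (P.pullFun h) + c.2.1 * P.generator (P.pullFun h) := rfl
  rw [h1, P.generator_pullFun, mul_zero, add_zero, horLift_pullFun]

@[simp] theorem push_assemble (A : P.Connection) (c : P.Quad) : P.push (assemble A c).1 = c.1 := by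
  simp [assemble, P.push_generator]

@[simp] theorem form_assemble (A : P.Connection) (c : P.Quad) :
    A.form (assemble A c).1 = c.2.1 := by
  simp [assemble, A.form_generator]

@[simp] theorem assemble_snd_horLift (A : P.Connection) (c : P.Quad) (X : P.VecAlong) :
    (assemble A c).2 (horLift A X) = c.2.2.1 X := by
  simp [assemble]

@[simp] theorem assemble_snd_generator (A : P.Connection) (c : P.Quad) :
    (assemble A c).2 P.generator = c.2.2.2 := by
  simp [assemble, P.push_generator, A.form_generator]

theorem assemble_snd_apply (A : P.Connection) (c : P.Quad) (x : VecField F Z) :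
    (assemble A c).2 x = c.2.2.1 (P.push x) + c.2.2.2 * A.form x := rfl

theorem assemble_fst_apply (A : P.Connection) (c : P.Quad) (h : SmoothFun F Z) :
    (assemble A c).1 h = horLift A c.1 h + c.2.1 * P.generator h := rfl

theorem push_lie_generator_assemble (A : P.Connection) {n : ℤ} {c : P.Quad}
    (hc : c ∈ P.weightSec n) :
    P.push ⁅P.generator, (assemble A c).1⁆ = weightConst n • c.1 := by
  refine P.vecAlong_ext fun h => ?_
  rw [P.push_apply, Derivation.commutator_apply, P.generator_pullFun, map_zero, sub_zero,
    assemble_fst_pullFun, P.mem_lineSec_iff.1 (hc.1 h)]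
  rfl

theorem isWeightNeg_assemble_iff (A : P.Connection) (n : ℤ) (c : P.Quad) :
    P.IsWeightNeg n (assemble A c) ↔ c ∈ P.weightSec n := by
  constructor
  · intro h
    have h1 : ⁅P.generator, (assemble A c).1⁆ = weightConst n • (assemble A c).1 :=
      congrArg Prod.fst h
    have h2 : lieOneForm P.generator (assemble A c).2 = weightConst n • (assemble A c).2 :=
      congrArg Prod.snd h
    refine ⟨fun k => ?_, ?_, fun W => ?_, ?_⟩ <;> rw [P.mem_lineSec_iff]
    · have h3 := congrArg (fun x : VecField F Z => x (P.pullFun k)) h1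
      simp only [Derivation.commutator_apply, P.generator_pullFun, map_zero, sub_zero,
        Derivation.smul_apply, assemble_fst_pullFun] at h3
      exact h3
    · have h3 := congrArg A.form h1
      rw [form_lie_generator, form_assemble] at h3
      rw [h3, ← algebraMap_smul (SmoothFun F Z) (weightConst n) (assemble A c).1, map_smul,
        form_assemble, algebraMap_smul]
    · have h3 := congrArg (fun α : OneForm F Z => α (horLift A (P.baseVec W))) h2
      simp only [lieOneForm_apply, lie_generator_horLift_baseVec, map_zero, sub_zero,
        LinearMap.smul_apply, assemble_snd_horLift] at h3
      exact h3
    · have h3 := congrArg (fun α : OneForm F Z => α P.generator) h2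
      simp only [lieOneForm_apply, lie_self, map_zero, sub_zero,
        LinearMap.smul_apply, assemble_snd_generator] at h3
      exact h3
  · intro hc
    refine Prod.ext (P.vecField_ext A ?_ ?_) (oneForm_ext_invariant A fun w hw => ?_)
    · rw [lieGen, push_lie_generator_assemble A hc, Prod.smul_fst,
        ← algebraMap_smul (SmoothFun F Z) _ (assemble A c).1, map_smul, push_assemble,
        algebraMap_smul]
      rfl
    · rw [lieGen, form_lie_generator, form_assemble, P.mem_lineSec_iff.1 hc.2.1, Prod.smul_fst,
        ← algebraMap_smul (SmoothFun F Z) _ (assemble A c).1, map_smul, form_assemble,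
        algebraMap_smul]
      rfl
    · have h1 : (assemble A c).2 w ∈ P.lineSec n := by
        obtain ⟨⟨W, hW⟩, hr⟩ := hw
        rw [assemble_snd_apply, hW]
        exact add_mem (hc.2.2.1 W) (by simpa using P.mul_mem_lineSec hc.2.2.2 hr)
      have h2 : lieOneForm P.generator (assemble A c).2 w = P.generator ((assemble A c).2 w) := by
        rw [lieOneForm_apply, hw.lie_generator, map_zero, sub_zero]
      exact h2.trans (P.mem_lineSec_iff.1 h1)

/-- Leibniz rule for the Lie derivative along the generator: `X` need not be invariant, so besides
the weight of the one-form there is a bracket term. -/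
theorem generator_dual_apply (A : P.Connection) {n : ℤ} {c : P.Quad} (hc : c ∈ P.weightSec n)
    (X : P.VecAlong) : P.generator (c.2.2.1 X) =
      c.2.2.1 (P.push ⁅P.generator, horLift A X⁆) + weightConst n • c.2.2.1 X := by
  have h1 := congrArg (fun a : GenSection F Z => a.2 (horLift A X))
    ((isWeightNeg_assemble_iff A n c).2 hc)
  have h2 : P.generator ((assemble A c).2 (horLift A X)) -
      (assemble A c).2 ⁅P.generator, horLift A X⁆ =
      weightConst n • (assemble A c).2 (horLift A X) := h1
  rw [assemble_snd_horLift, assemble_snd_apply, form_lie_generator, form_horLift, map_zero,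
    mul_zero, add_zero] at h2
  rw [← h2]
  ring

end CircleBundle

/-! ### Sign rules for alternating maps in two and three arguments. -/

section Alternating

variable {V R : Type*} [CommRing R] [AddCommGroup V] [Module R V]

theorem alternating_two_neg_left (ζ : V [⋀^Fin 2]→ₗ[R] R) (x y : V) :
    ζ ![-x, y] = -ζ ![x, y] := by
  have h1 := ζ.map_update_neg ![x, y] 0 x
  have h2 : Function.update ![x, y] 0 x = ![x, y] := Function.update_eq_self 0 _
  rw [h2] at h1
  rw [← h1]
  congr 1
  funext i
  fin_cases i <;> rfl

theorem alternating_two_neg_right (ζ : V [⋀^Fin 2]→ₗ[R] R) (x y : V) :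
    ζ ![x, -y] = -ζ ![x, y] := by
  have h1 := ζ.map_update_neg ![x, y] 1 y
  have h2 : Function.update ![x, y] 1 y = ![x, y] := Function.update_eq_self 1 _
  rw [h2] at h1
  rw [← h1]
  congr 1
  funext i
  fin_cases i <;> rfl

theorem alternating_two_swap (ζ : V [⋀^Fin 2]→ₗ[R] R) (x y : V) :
    ζ ![y, x] = -ζ ![x, y] := by
  have h1 := ζ.map_swap ![x, y] (i := 0) (j := 1) (by decide)
  rw [← h1]
  congr 1
  funext i
  fin_cases i <;> rfl

theorem alternating_three_neg_left (ζ : V [⋀^Fin 3]→ₗ[R] R) (x y w : V) :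
    ζ ![-x, y, w] = -ζ ![x, y, w] := by
  have h1 := ζ.map_update_neg ![x, y, w] 0 x
  have h2 : Function.update ![x, y, w] 0 x = ![x, y, w] := Function.update_eq_self 0 _
  rw [h2] at h1
  rw [← h1]
  congr 1
  funext i
  fin_cases i <;> rfl

theorem alternating_three_neg_middle (ζ : V [⋀^Fin 3]→ₗ[R] R) (x y w : V) :
    ζ ![x, -y, w] = -ζ ![x, y, w] := by
  have h1 := ζ.map_update_neg ![x, y, w] 1 y
  have h2 : Function.update ![x, y, w] 1 y = ![x, y, w] := Function.update_eq_self 1 _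
  rw [h2] at h1
  rw [← h1]
  congr 1
  funext i
  fin_cases i <;> rfl

theorem alternating_three_swap (ζ : V [⋀^Fin 3]→ₗ[R] R) (x y w : V) :
    ζ ![y, x, w] = -ζ ![x, y, w] := by
  have h1 := ζ.map_swap ![x, y, w] (i := 0) (j := 1) (by decide)
  rw [← h1]
  congr 1
  funext i
  fin_cases i <;> rfl

end Alternating

open CircleBundle

namespace CircleBundle

variable {E : Type*} [NormedAddCommGroup E] [NormedSpace ℝ E]
  {M : Type*} [TopologicalSpace M] [ChartedSpace E M]
  {F : Type*} [NormedAddCommGroup F] [NormedSpace ℝ F]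
  {Z : Type*} [TopologicalSpace Z] [ChartedSpace F Z] [IsManifold 𝓘(ℝ, F) ∞ Z]
  [MulAction Circle Z] {P : CircleBundle E F M Z}

theorem pullForm_two_apply (ζ : KForm E M 2) (x y : VecField F Z) :
    P.pullForm ζ ![x, y] = P.formAlong ζ ![P.push x, P.push y] := by
  refine congrArg (P.formAlong ζ) (funext fun i => ?_)
  fin_cases i <;> rfl

theorem pullForm_three_apply (ζ : KForm E M 3) (x y w : VecField F Z) :
    P.pullForm ζ ![x, y, w] = P.formAlong ζ ![P.push x, P.push y, P.push w] := by
  refine congrArg (P.formAlong ζ) (funext fun i => ?_)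
  fin_cases i <;> rfl

end CircleBundle

/-! ### The derived bracket on exotic forms. -/

namespace TDualPair

variable {E : Type*} [NormedAddCommGroup E] [NormedSpace ℝ E] [FiniteDimensional ℝ E]
  {M : Type*} [TopologicalSpace M] [ChartedSpace E M] [IsManifold 𝓘(ℝ, E) ∞ M] [T2Space M]
  {F : Type*} [NormedAddCommGroup F] [NormedSpace ℝ F] [FiniteDimensional ℝ F]
  {Z : Type*} [TopologicalSpace Z] [ChartedSpace F Z] [IsManifold 𝓘(ℝ, F) ∞ Z] [T2Space Z]
  [MulAction Circle Z]
  {F' : Type*} [NormedAddCommGroup F'] [NormedSpace ℝ F']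
  {Z' : Type*} [TopologicalSpace Z'] [ChartedSpace F' Z'] [IsManifold 𝓘(ℝ, F') ∞ Z']
  [MulAction Circle Z'] {P : CircleBundle E F M Z} {P' : CircleBundle E F' M Z'}
  (T : TDualPair P P')

/-- The one-form `ξ + g A'` of a quadruple. -/
def cliffordForm (a : P.Quad) (w : T.DualVec) : SmoothFun F Z := a.2.2.1 w.1 + a.2.2.2 * w.2

theorem clifford_eq (a : P.Quad) (σ : MixedCochain T.DualVec (SmoothFun F Z)) :
    T.clifford a σ = (contractOp ((a.1, a.2.1) : T.DualVec) + wedgeOp (T.cliffordForm a) :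
      AddMonoid.End (MixedCochain T.DualVec (SmoothFun F Z))) σ := rfl

theorem exoticDiff_eq (p : ℤ) (σ : MixedCochain T.DualVec (SmoothFun F Z)) :
    T.exoticDiff p σ = -((extOp (fun x : T.DualVec => horLift T.conn x.1) T.dualLie +
      wedgeThreeOp T.dualFlux) σ +
      algebraMap ℂ (SmoothFun F Z) (weightConst p) • contractOp ((0, 1) : T.DualVec) σ) := by
  have h1 : algebraMap ℂ (SmoothFun F Z) (weightConst p) • contractOp ((0, 1) : T.DualVec) σ =
      -((2 * Real.pi * Complex.I * p : ℂ) • mixedContract ((0, 1) : T.DualVec) σ) := by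
    rw [algebraMap_smul, weightConst, neg_smul]
    rfl
  rw [h1]
  change -(mixedExtDer T.dualAct T.dualLie σ - _ + mixedWedgeThree T.dualFlux σ) =
    -(mixedExtDer T.dualAct T.dualLie σ + mixedWedgeThree T.dualFlux σ + - _)
  rw [← sub_eq_add_neg, sub_add_eq_add_sub]

theorem IsExoticForm.isAlternatingCochain {p : ℤ} {σ : MixedCochain T.DualVec (SmoothFun F Z)}
    (hσ : T.IsExoticForm p σ) : IsAlternatingCochain σ := fun k => (hσ k).1

/-- The derived bracket of two sections of weights `n` and `m`. -/
theorem isWeightBracket_of {n m : ℤ} {a b c : P.Quad}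
    (hvec : ((c.1, c.2.1) : T.DualVec) = -(T.dualLie (a.1, a.2.1) (b.1, b.2.1) +
      (algebraMap ℂ (SmoothFun F Z) (weightConst m) * a.2.2.2) • (b.1, b.2.1) -
      (algebraMap ℂ (SmoothFun F Z) (weightConst n) * b.2.2.2) • (a.1, a.2.1) +
      (algebraMap ℂ (SmoothFun F Z) (weightConst n) * (T.cliffordForm a (b.1, b.2.1) +
        T.cliffordForm b (a.1, a.2.1))) • (0, 1)))
    (hform : ∀ w, T.cliffordForm c w = -(horLift T.conn a.1 (T.cliffordForm b w) -
      T.cliffordForm b (T.dualLie (a.1, a.2.1) w) - (horLift T.conn b.1 (T.cliffordForm a w) -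
        T.cliffordForm a (T.dualLie (b.1, b.2.1) w) -
        horLift T.conn w.1 (T.cliffordForm a (b.1, b.2.1))) -
      T.dualFlux (a.1, a.2.1) (b.1, b.2.1) w +
      algebraMap ℂ (SmoothFun F Z) (weightConst m) * a.2.2.2 * T.cliffordForm b w -
      algebraMap ℂ (SmoothFun F Z) (weightConst n) * b.2.2.2 * T.cliffordForm a w)) :
    T.IsWeightBracket n m a b c := by
  intro p σ hσ
  have hσ := IsExoticForm.isAlternatingCochain T hσ
  have h1 := weighted_derived_bracket hσ (0, 1) (a.1, a.2.1) (b.1, b.2.1) (T.cliffordForm a)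
    (T.cliffordForm b) (algebraMap ℂ (SmoothFun F Z) (weightConst p))
    (algebraMap ℂ (SmoothFun F Z) (weightConst m)) (algebraMap ℂ (SmoothFun F Z) (weightConst n))
  have h2 := congrArg (fun A : AddMonoid.End (MixedCochain T.DualVec (SmoothFun F Z)) => A σ)
    (derived_bracket (fun x : T.DualVec => horLift T.conn x.1) T.dualLie T.dualFlux
      (a.1, a.2.1) (b.1, b.2.1) (T.cliffordForm a) (T.cliffordForm b))
  have ha : T.cliffordForm a (0, 1) = a.2.2.2 := by simp [cliffordForm]
  have hb : T.cliffordForm b (0, 1) = b.2.2.2 := by simp [cliffordForm]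
  have hadd : ∀ (A B : AddMonoid.End (MixedCochain T.DualVec (SmoothFun F Z))) τ,
    (A + B) τ = A τ + B τ := fun _ _ _ => rfl
  have hc : T.clifford c σ = -(contractOp (T.dualLie (a.1, a.2.1) (b.1, b.2.1)) σ + wedgeOp
      (fun w => horLift T.conn a.1 (T.cliffordForm b w) -
      T.cliffordForm b (T.dualLie (a.1, a.2.1) w) - (horLift T.conn b.1 (T.cliffordForm a w) -
        T.cliffordForm a (T.dualLie (b.1, b.2.1) w) -
        horLift T.conn w.1 (T.cliffordForm a (b.1, b.2.1))) -
      T.dualFlux (a.1, a.2.1) (b.1, b.2.1) w) σ +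
      (algebraMap ℂ (SmoothFun F Z) (weightConst m) * a.2.2.2) • T.clifford b σ -
      (algebraMap ℂ (SmoothFun F Z) (weightConst n) * b.2.2.2) • T.clifford a σ +
      (algebraMap ℂ (SmoothFun F Z) (weightConst n) * (T.cliffordForm a (b.1, b.2.1) +
        T.cliffordForm b (a.1, a.2.1))) • contractOp ((0, 1) : T.DualVec) σ) := by
    have hmul : ∀ (r : SmoothFun F Z) (α : T.DualVec → SmoothFun F Z),
        wedgeOp (fun w => r * α w) σ = r • wedgeOp α σ := fun r α =>
      congrArg (fun A : AddMonoid.End (MixedCochain T.DualVec (SmoothFun F Z)) => A σ)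
        (wedgeOp_mul r α)
    have hsub : ∀ (A B : AddMonoid.End (MixedCochain T.DualVec (SmoothFun F Z))) τ,
      (A - B) τ = A τ - B τ := fun _ _ _ => rfl
    have hform' : T.cliffordForm c = _ := funext hform
    -- The overall sign is written as a scalar factor so that `wedgeOp_mul` can extract it.
    simp only [← neg_one_mul (_ - _ : SmoothFun F Z)] at hform'
    rw [clifford_eq, clifford_eq, clifford_eq, hform', hvec, hadd, hadd, hadd, hmul, neg_one_smul,
      wedgeOp_sub, wedgeOp_add, hsub, hadd, hmul, hmul, hσ.contractOp_neg, hσ.contractOp_add,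
      hσ.contractOp_sub, hσ.contractOp_add, hσ.contractOp_smul, hσ.contractOp_smul,
      hσ.contractOp_smul]
    module
  rw [hc]
  simp only [exoticDiff_eq, weightConst_add, map_add]
  rw [ha, hb] at h1
  set Q : AddMonoid.End (MixedCochain T.DualVec (SmoothFun F Z)) :=
    extOp (fun x : T.DualVec => horLift T.conn x.1) T.dualLie + wedgeThreeOp T.dualFlux
  set A : AddMonoid.End (MixedCochain T.DualVec (SmoothFun F Z)) :=
    contractOp ((a.1, a.2.1) : T.DualVec) + wedgeOp (T.cliffordForm a)
  set B : AddMonoid.End (MixedCochain T.DualVec (SmoothFun F Z)) :=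
    contractOp ((b.1, b.2.1) : T.DualVec) + wedgeOp (T.cliffordForm b)
  have hA : ∀ τ, T.clifford a τ = A τ := fun _ => rfl
  have hB : ∀ τ, T.clifford b τ = B τ := fun _ => rfl
  replace h2 : Q (A (B σ)) + A (Q (B σ)) - B (Q (A σ) + A (Q σ)) = _ := h2.trans (hadd _ _ _)
  simp only [hA, hB, map_neg, map_add] at h1 h2 ⊢
  -- The derived bracket is additive in the differential, so the contributions of the twisted
  -- exterior derivative and of the weighted contraction add; the sign is that of the differential.
  have h3 := congrArg₂ (fun u v : MixedCochain T.DualVec (SmoothFun F Z) => -(u + v)) h2 h1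
  refine Eq.trans ?_ (h3.symm.trans ?_) <;> abel

/-- Two kinds of test forms suffice, all of weight zero: the constant 1 returns the one-form in
degree one, and an invariant linear functional returns its value on the vector part in degree zero.
-/
theorem clifford_injective {c d : P.Quad}
    (h : ∀ (p : ℤ) (σ : MixedCochain T.DualVec (SmoothFun F Z)), T.IsExoticForm p σ →
      T.clifford c σ = T.clifford d σ) : c = d := by
  have hlin : ∀ ℓ : T.DualVec →ₗ[SmoothFun F Z] SmoothFun F Z,
      (∀ X f, ℓ (P.baseVec X, P.pullFun f) ∈ P.lineSec 0) → ℓ (c.1, c.2.1) = ℓ (d.1, d.2.1) := by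
    intro ℓ hℓ
    have h1 := h 0 (fun k => match k with
      | 1 => fun u => ℓ (u 0)
      | _ => 0) fun k => match k with
      | 0 => ⟨⟨0, rfl⟩, fun _ _ => zero_mem _⟩
      | 1 => ⟨⟨AlternatingMap.ofSubsingleton _ _ _ 0 ℓ, rfl⟩, fun X f => hℓ (X 0) (f 0)⟩
      | k + 2 => ⟨⟨0, rfl⟩, fun _ _ => zero_mem _⟩
    have h2 := congrFun (congrFun h1 0) ![]
    exact (add_zero _).symm.trans (h2.trans (add_zero _))
  have hform : ∀ w : T.DualVec, T.cliffordForm c w = T.cliffordForm d w := by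
    intro w
    have h1 := h 0 (fun k => match k with
      | 0 => fun _ => 1
      | _ => 0) fun k => match k with
      | 0 => ⟨⟨AlternatingMap.constOfIsEmpty _ _ _ 1, rfl⟩, fun X f => fun t z => by
          change (1 : ℂ) = _ * 1
          simp⟩
      | k + 1 => ⟨⟨0, rfl⟩, fun _ _ => zero_mem _⟩
    have h2 := congrFun (congrFun h1 1) ![w]
    change 0 + T.cliffordForm c w * 1 = 0 + T.cliffordForm d w * 1 at h2
    simpa using h2
  refine P.quad_ext (fun k => ?_) ?_ (fun W => ?_) ?_
  · let ev : P.VecAlong →ₗ[SmoothFun F Z] SmoothFun F Z :=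
      { toFun := fun X => X.1 k, map_add' := fun _ _ => rfl, map_smul' := fun _ _ => rfl }
    exact hlin (ev ∘ₗ LinearMap.fst _ _ _) fun X f => P.pullFun_mem (X k)
  · exact hlin (LinearMap.snd _ _ _) fun X f => P.pullFun_mem f
  · simpa [cliffordForm] using hform (P.baseVec W, 0)
  · simpa [cliffordForm] using hform (0, 1)

theorem IsWeightBracket.unique {n m : ℤ} {a b c d : P.Quad} (hc : T.IsWeightBracket n m a b c)
    (hd : T.IsWeightBracket n m a b d) : c = d :=
  T.clifford_injective fun p σ hσ => (hc p σ hσ).trans (hd p σ hσ).symm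

end TDualPair

open CircleBundle

/-! ### The Dorfman bracket of pure weights compared with the derived bracket. -/

namespace TDualPair

variable {E : Type*} [NormedAddCommGroup E] [NormedSpace ℝ E] [FiniteDimensional ℝ E]
  {M : Type*} [TopologicalSpace M] [ChartedSpace E M] [IsManifold 𝓘(ℝ, E) ∞ M] [T2Space M]
  {F : Type*} [NormedAddCommGroup F] [NormedSpace ℝ F] [FiniteDimensional ℝ F]
  {Z : Type*} [TopologicalSpace Z] [ChartedSpace F Z] [IsManifold 𝓘(ℝ, F) ∞ Z] [T2Space Z]
  [MulAction Circle Z]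
  {F' : Type*} [NormedAddCommGroup F'] [NormedSpace ℝ F']
  {Z' : Type*} [TopologicalSpace Z'] [ChartedSpace F' Z'] [IsManifold 𝓘(ℝ, F') ∞ Z']
  [MulAction Circle Z'] {P : CircleBundle E F M Z} {P' : CircleBundle E F' M Z'}
  (T : TDualPair P P')

theorem form_lie_eq (x y : VecField F Z) : T.conn.form ⁅x, y⁆ =
    x (T.conn.form y) - y (T.conn.form x) - P.formAlong T.curv ![P.push x, P.push y] := by
  rw [form_lie, T.conn_curv, pullForm_two_apply]

theorem generator_of_mem {n : ℤ} {u : SmoothFun F Z} (hu : u ∈ P.lineSec n) :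
    P.generator u = algebraMap ℂ (SmoothFun F Z) (weightConst n) * u := by
  rw [P.mem_lineSec_iff.1 hu, Algebra.smul_def]

/-- Derivatives of the vertical coefficients point along the generator and project to zero. The
extra terms are the generator acting on the horizontal parts through their weights. -/
theorem push_lie_assemble {n m : ℤ} {c d : P.Quad} (hc : c ∈ P.weightSec n)
    (hd : d ∈ P.weightSec m) :
    P.push ⁅(assemble T.conn c).1, (assemble T.conn d).1⁆ =
      P.push ⁅horLift T.conn c.1, horLift T.conn d.1⁆ +
        (algebraMap ℂ (SmoothFun F Z) (weightConst m) * c.2.1) • d.1 -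
        (algebraMap ℂ (SmoothFun F Z) (weightConst n) * d.2.1) • c.1 := by
  refine P.vecAlong_ext fun h => ?_
  simp only [vecAlong_sub_apply, vecAlong_add_apply, vecAlong_smul_apply, P.push_apply,
    Derivation.commutator_apply, assemble_fst_pullFun, horLift_pullFun]
  rw [assemble_fst_apply, assemble_fst_apply, generator_of_mem (hd.1 h), generator_of_mem (hc.1 h)]
  ring

theorem form_lie_assemble {n m : ℤ} {c d : P.Quad} (hc : c ∈ P.weightSec n)
    (hd : d ∈ P.weightSec m) :
    T.conn.form ⁅(assemble T.conn c).1, (assemble T.conn d).1⁆ =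
      horLift T.conn c.1 d.2.1 + algebraMap ℂ (SmoothFun F Z) (weightConst m) * c.2.1 * d.2.1 -
        horLift T.conn d.1 c.2.1 - algebraMap ℂ (SmoothFun F Z) (weightConst n) * d.2.1 * c.2.1 -
        P.formAlong T.curv ![c.1, d.1] := by
  rw [form_lie_eq, form_assemble, form_assemble, push_assemble, push_assemble, assemble_fst_apply,
    assemble_fst_apply, generator_of_mem hd.2.1, generator_of_mem hc.2.1]
  ring

/-- `W` is arbitrary, so its bracket with the generator appears twice; the two terms cancel by
`generator_dual_apply` and leave the weight of `d`. The curvature enters through the vertical part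
of the bracket with `W`. -/
theorem lieOneForm_assemble_horLift {m : ℤ} (c : P.Quad) {d : P.Quad} (hd : d ∈ P.weightSec m)
    (W : P.VecAlong) :
    lieOneForm (assemble T.conn c).1 (assemble T.conn d).2 (horLift T.conn W) =
      horLift T.conn c.1 (d.2.2.1 W) +
        algebraMap ℂ (SmoothFun F Z) (weightConst m) * c.2.1 * d.2.2.1 W -
        d.2.2.1 (P.push ⁅horLift T.conn c.1, horLift T.conn W⁆) +
        d.2.2.2 * horLift T.conn W c.2.1 + d.2.2.2 * P.formAlong T.curv ![c.1, W] := by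
  have h1 : P.push ⁅(assemble T.conn c).1, horLift T.conn W⁆ =
      P.push ⁅horLift T.conn c.1, horLift T.conn W⁆ +
        c.2.1 • P.push ⁅P.generator, horLift T.conn W⁆ := by
    refine P.vecAlong_ext fun h => ?_
    simp only [vecAlong_add_apply, vecAlong_smul_apply, P.push_apply,
      Derivation.commutator_apply, assemble_fst_pullFun, horLift_pullFun,
      P.generator_pullFun, map_zero, sub_zero]
    rw [assemble_fst_apply]
    ring
  have h2 := generator_dual_apply T.conn hd W
  rw [Algebra.smul_def] at h2
  rw [lieOneForm_apply, assemble_snd_horLift, assemble_snd_apply, h1, map_add, map_smul,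
    form_lie_eq, form_horLift, map_zero, form_assemble, push_assemble, push_horLift,
    assemble_fst_apply, h2, smul_eq_mul]
  ring

theorem dorfman_assemble_horLift {n m : ℤ} {c d : P.Quad} (hc : c ∈ P.weightSec n)
    (hd : d ∈ P.weightSec m) (W : P.VecAlong) :
    (dorfman T.flux (assemble T.conn c) (assemble T.conn d)).2 (horLift T.conn W) =
      (horLift T.conn c.1 (d.2.2.1 W) +
        algebraMap ℂ (SmoothFun F Z) (weightConst m) * c.2.1 * d.2.2.1 W -
        d.2.2.1 (P.push ⁅horLift T.conn c.1, horLift T.conn W⁆) +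
        d.2.2.2 * horLift T.conn W c.2.1 + d.2.2.2 * P.formAlong T.curv ![c.1, W]) -
      (horLift T.conn d.1 (c.2.2.1 W) +
        algebraMap ℂ (SmoothFun F Z) (weightConst n) * d.2.1 * c.2.2.1 W -
        c.2.2.1 (P.push ⁅horLift T.conn d.1, horLift T.conn W⁆) +
        c.2.2.2 * horLift T.conn W d.2.1 + c.2.2.2 * P.formAlong T.curv ![d.1, W] -
        horLift T.conn W (c.2.2.1 d.1 + c.2.2.2 * d.2.1)) -
      P.formAlong T.base ![c.1, d.1, W] + d.2.1 * P.formAlong T.curv' ![c.1, W] -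
        c.2.1 * P.formAlong T.curv' ![d.1, W] := by
  have h1 : (dorfman T.flux (assemble T.conn c) (assemble T.conn d)).2 (horLift T.conn W) =
      lieOneForm (assemble T.conn c).1 (assemble T.conn d).2 (horLift T.conn W) -
      (lieOneForm (assemble T.conn d).1 (assemble T.conn c).2 (horLift T.conn W) -
        horLift T.conn W ((assemble T.conn c).2 (assemble T.conn d).1)) +
      T.flux ![(assemble T.conn d).1, (assemble T.conn c).1, horLift T.conn W] := rfl
  rw [h1, T.lieOneForm_assemble_horLift c hd, T.lieOneForm_assemble_horLift d hc, T.flux_eq,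
    assemble_snd_apply, pullForm_three_apply, pullForm_two_apply, pullForm_two_apply,
    pullForm_two_apply]
  simp only [push_assemble, form_assemble, push_horLift, form_horLift,
    alternating_three_swap (P.formAlong T.base) c.1 d.1 W]
  ring

/-- Bracketing with the generator multiplies by weights, which yields the term n times the pairing.
The flux with one slot filled by the generator reduces to the dual curvature. -/
theorem dorfman_assemble_generator {n m : ℤ} {c d : P.Quad} (hc : c ∈ P.weightSec n)
    (hd : d ∈ P.weightSec m) :
    (dorfman T.flux (assemble T.conn c) (assemble T.conn d)).2 P.generator =
      horLift T.conn c.1 d.2.2.2 - horLift T.conn d.1 c.2.2.2 +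
        algebraMap ℂ (SmoothFun F Z) (weightConst m) * c.2.1 * d.2.2.2 +
        algebraMap ℂ (SmoothFun F Z) (weightConst n) *
          (d.2.2.1 c.1 + c.2.2.1 d.1 + d.2.2.2 * c.2.1) -
        P.formAlong T.curv' ![c.1, d.1] := by
  have hlie : ∀ {n m : ℤ} {c d : P.Quad}, c ∈ P.weightSec n → d ∈ P.weightSec m →
      lieOneForm (assemble T.conn c).1 (assemble T.conn d).2 P.generator =
        horLift T.conn c.1 d.2.2.2 +
        algebraMap ℂ (SmoothFun F Z) (weightConst m) * c.2.1 * d.2.2.2 +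
        algebraMap ℂ (SmoothFun F Z) (weightConst n) * (d.2.2.1 c.1 + d.2.2.2 * c.2.1) := by
    intro n m c d hc hd
    rw [lieOneForm_apply, assemble_snd_generator, ← lie_skew, map_neg, assemble_snd_apply,
        push_lie_generator_assemble _ hc,
      form_lie_generator, form_assemble, assemble_fst_apply,
      generator_of_mem hd.2.2.2, generator_of_mem hc.2.1,
      ← algebraMap_smul (SmoothFun F Z) (weightConst n) c.1, map_smul, smul_eq_mul]
    ring
  have h2 : P.generator (c.2.2.1 d.1) = algebraMap ℂ (SmoothFun F Z) (weightConst m) * c.2.2.1 d.1 +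
      algebraMap ℂ (SmoothFun F Z) (weightConst n) * c.2.2.1 d.1 := by
    have h3 := push_lie_generator_assemble T.conn hd
    have h4 : P.push ⁅P.generator, horLift T.conn d.1⁆ =
        P.push ⁅P.generator, (assemble T.conn d).1⁆ := by
      refine P.vecAlong_ext fun h => ?_
      simp only [P.push_apply, Derivation.commutator_apply, P.generator_pullFun, map_zero,
        assemble_fst_pullFun, horLift_pullFun]
    rw [generator_dual_apply T.conn hc, h4, h3, ← algebraMap_smul (SmoothFun F Z) _ d.1, map_smul,
      smul_eq_mul, Algebra.smul_def (weightConst n)]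
  have h1 : (dorfman T.flux (assemble T.conn c) (assemble T.conn d)).2 P.generator =
      lieOneForm (assemble T.conn c).1 (assemble T.conn d).2 P.generator -
      (lieOneForm (assemble T.conn d).1 (assemble T.conn c).2 P.generator -
        P.generator ((assemble T.conn c).2 (assemble T.conn d).1)) +
      T.flux ![(assemble T.conn d).1, (assemble T.conn c).1, P.generator] := rfl
  have h5 : ∀ {k : ℕ} (ζ : P.VecAlong [⋀^Fin k]→ₗ[SmoothFun F Z] SmoothFun F Z)
      (u : Fin k → P.VecAlong) (i : Fin k), u i = 0 → ζ u = 0 := fun ζ u i h =>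
    ζ.map_coord_zero i h
  rw [h1, hlie hc hd, hlie hd hc, T.flux_eq, assemble_snd_apply, pullForm_three_apply,
    pullForm_two_apply, pullForm_two_apply, pullForm_two_apply, P.push_generator,
    h5 (P.formAlong T.base) _ 2 rfl, h5 (P.formAlong T.curv') ![_, 0] 1 rfl,
    h5 (P.formAlong T.curv') ![_, 0] 1 rfl, T.conn.form_generator]
  simp only [push_assemble, form_assemble, alternating_two_swap (P.formAlong T.curv') c.1 d.1,
    map_add, h2, Derivation.leibniz, smul_eq_mul, generator_of_mem hc.2.2.2,
    generator_of_mem hd.2.1]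
  ring

/-- The derived bracket of two sections of weights `n` and `m` corresponds to the Dorfman
bracket. -/
theorem isWeightBracket_negSwap {n m : ℤ} {c d : P.Quad} (hc : c ∈ P.weightSec n)
    (hd : d ∈ P.weightSec m) : T.IsWeightBracket n m (P.negSwap c) (P.negSwap d)
      (P.negSwap (T.quadDorfman c d)) := by
  -- After the swap, `e1` and `e4` describe the vector part of the dual bracket and `e2` and `e3`
  -- its one-form part. Thus the dual curvature in `e4` meets the one in `dualLie`, and the
  -- curvature in `e2` and `e3` meets the one in `dualFlux`.
  have e1 : (T.quadDorfman c d).1 = _ := T.push_lie_assemble hc hd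
  have e2 : (T.quadDorfman c d).2.1 = _ := T.form_lie_assemble hc hd
  have e3 : ∀ W, (T.quadDorfman c d).2.2.1 W = _ := T.dorfman_assemble_horLift hc hd
  have e4 : (T.quadDorfman c d).2.2.2 = _ := T.dorfman_assemble_generator hc hd
  have hn : ∀ c : P.Quad, P.negSwap c = (-c.1, -c.2.2.2, -c.2.2.1, -c.2.1) := fun _ => rfl
  have hl : ∀ X : P.VecAlong, horLift T.conn (-X) = -horLift T.conn X := fun X =>
      LinearMap.map_neg _ X
  have hp : ∀ x, P.push (-x) = -P.push x := fun _ => rfl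
  have hd : ∀ (ζ : Module.Dual (SmoothFun F Z) P.VecAlong) (X : P.VecAlong), ζ (-X) = -ζ X :=
    fun ζ X => LinearMap.map_neg ζ X
  have h2l : ∀ (ζ : P.VecAlong [⋀^Fin 2]→ₗ[SmoothFun F Z] SmoothFun F Z) (X Y : P.VecAlong),
      ζ ![-X, Y] = -ζ ![X, Y] := alternating_two_neg_left (V := P.VecAlong)
  have h2r : ∀ (ζ : P.VecAlong [⋀^Fin 2]→ₗ[SmoothFun F Z] SmoothFun F Z) (X Y : P.VecAlong),
      ζ ![X, -Y] = -ζ ![X, Y] := alternating_two_neg_right (V := P.VecAlong)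
  have h3l : ∀ (ζ : P.VecAlong [⋀^Fin 3]→ₗ[SmoothFun F Z] SmoothFun F Z) (X Y W : P.VecAlong),
      ζ ![-X, Y, W] = -ζ ![X, Y, W] := alternating_three_neg_left (V := P.VecAlong)
  have h3m : ∀ (ζ : P.VecAlong [⋀^Fin 3]→ₗ[SmoothFun F Z] SmoothFun F Z) (X Y W : P.VecAlong),
      ζ ![X, -Y, W] = -ζ ![X, Y, W] := alternating_three_neg_middle (V := P.VecAlong)
  refine T.isWeightBracket_of ?_ fun w => ?_
  · refine Prod.ext ?_ ?_
    · simp only [hn, e1, dualLie, Prod.fst_neg, Prod.fst_add, Prod.fst_sub, Prod.smul_fst,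
        map_neg, hl, hp, hd,
        neg_lie, lie_neg, neg_neg]
      module
    · simp only [hn, e4, dualLie, nabla, LinearMap.comp_apply, dFun, LinearMap.coe_mk,
        AddHom.coe_mk, Prod.snd_neg, Prod.snd_add, Prod.snd_sub, Prod.smul_snd, map_neg, hl, hp, hd,
        Derivation.neg_apply, neg_neg, h2l, h2r,
        cliffordForm, LinearMap.neg_apply, smul_eq_mul]
      ring
  · obtain ⟨W, h⟩ := w
    simp only [hn, e2, e3, cliffordForm, dualLie, dualFlux, nabla, LinearMap.comp_apply, dFun,
      LinearMap.coe_mk, AddHom.coe_mk, map_neg, hl, hp, hd, neg_lie, LinearMap.neg_apply,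
      Derivation.neg_apply, neg_neg, h2l, h2r,
      h3l, h3m, map_add, Derivation.leibniz,
      smul_eq_mul]
    ring

end TDualPair

/-! ### Weight zero as sections over the base; the signed swap. -/

namespace CircleBundle

variable {E : Type*} [NormedAddCommGroup E] [NormedSpace ℝ E] [FiniteDimensional ℝ E]
  {M : Type*} [TopologicalSpace M] [ChartedSpace E M] [IsManifold 𝓘(ℝ, E) ∞ M] [T2Space M]
  {F : Type*} [NormedAddCommGroup F] [NormedSpace ℝ F] [FiniteDimensional ℝ F]
  {Z : Type*} [TopologicalSpace Z] [ChartedSpace F Z] [IsManifold 𝓘(ℝ, F) ∞ Z] [T2Space Z]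
  [MulAction Circle Z] (P : CircleBundle E F M Z)

/-- The values on functions of the base are invariant and descend; linearity and the Leibniz rule
descend because pullback is injective. -/
theorem exists_baseVec_eq {X : P.VecAlong} (hX : ∀ h, X.1 h ∈ P.lineSec 0) :
    ∃ W, P.baseVec W = X := by
  choose w hw using fun h => P.exists_pullFun_eq (hX h)
  let W : VecField E M := Derivation.mk'
    { toFun := w
      map_add' := fun h k => P.pullFun_injective (by rw [map_add, hw, hw, hw, map_add])
      map_smul' := fun c h => P.pullFun_injective (by
        rw [RingHom.id_apply, map_smul, hw, hw, map_smul]) }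
    fun h k => P.pullFun_injective (by
      change P.pullFun (w (h * k)) = P.pullFun (h • w k + k • w h)
      rw [smul_eq_mul, smul_eq_mul, map_add, map_mul, map_mul, hw, hw, hw]
      exact X.2 h k)
  exact ⟨W, P.vecAlong_ext hw⟩

theorem exists_oneFormAlong_eq {ξ : Module.Dual (SmoothFun F Z) P.VecAlong}
    (hξ : ∀ W, ξ (P.baseVec W) ∈ P.lineSec 0) : ∃ ζ, P.oneFormAlong ζ = ξ := by
  choose w hw using fun W => P.exists_pullFun_eq (hξ W)
  let ζ : OneForm E M :=
    { toFun := w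
      map_add' := fun W W' => P.pullFun_injective (by
        rw [map_add, hw, hw, hw, P.baseVec_add, map_add])
      map_smul' := fun r W => P.pullFun_injective (by
        rw [RingHom.id_apply, smul_eq_mul, map_mul, hw, hw, P.baseVec_smul, map_smul,
          smul_eq_mul]) }
  exact ⟨ζ, P.dual_ext fun W => (P.oneFormAlong_baseVec ζ W).trans (hw W)⟩

theorem baseQuad_mem (e : BaseQuad E M) : P.baseQuad e ∈ P.weightSec 0 :=
  ⟨fun h => P.pullFun_mem _, P.pullFun_mem _, fun W => by
    rw [baseQuad, oneFormAlong_baseVec]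
    exact P.pullFun_mem _, P.pullFun_mem _⟩

theorem baseQuad_injective : Function.Injective P.baseQuad := by
  intro e e' h
  refine Prod.ext (Derivation.ext fun k =>
      P.pullFun_injective ?_) (Prod.ext (P.pullFun_injective ?_)
    (Prod.ext (LinearMap.ext fun W => P.pullFun_injective ?_) (P.pullFun_injective ?_)))
  · exact congrArg (fun c : P.Quad => c.1.1 k) h
  · exact congrArg (fun c : P.Quad => c.2.1) h
  · rw [← oneFormAlong_baseVec, ← oneFormAlong_baseVec]
    exact congrArg (fun c : P.Quad => c.2.2.1 (P.baseVec W)) h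
  · exact congrArg (fun c : P.Quad => c.2.2.2) h

theorem exists_baseQuad_eq {c : P.Quad} (hc : c ∈ P.weightSec 0) : ∃ e, P.baseQuad e = c := by
  obtain ⟨W, hW⟩ := P.exists_baseVec_eq hc.1
  obtain ⟨f, hf⟩ := P.exists_pullFun_eq hc.2.1
  obtain ⟨ξ, hξ⟩ := P.exists_oneFormAlong_eq hc.2.2.1
  obtain ⟨g, hg⟩ := P.exists_pullFun_eq hc.2.2.2
  exact ⟨(W, f, ξ, g), Prod.ext hW (Prod.ext hf (Prod.ext hξ hg))⟩

theorem bijOn_baseQuad : Set.BijOn P.baseQuad Set.univ (P.weightSec 0 : Set P.Quad) :=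
  ⟨fun e _ => P.baseQuad_mem e, P.baseQuad_injective.injOn, fun _ hc =>
    (P.exists_baseQuad_eq hc).imp fun _ h => ⟨Set.mem_univ _, h⟩⟩

/-- Sections of weight zero are sections over the base. -/
def baseQuadEquiv : BaseQuad E M ≃ₗ[ℂ] P.weightSec 0 :=
  LinearEquiv.ofBijective
    { toFun := fun e => ⟨P.baseQuad e, P.baseQuad_mem e⟩
      map_add' := fun e e' => Subtype.ext <| P.quad_ext (fun _ => map_add P.pullFun _ _)
        (map_add P.pullFun _ _) (fun W => by
          change P.oneFormAlong (e.2.2.1 + e'.2.2.1) (P.baseVec W) =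
            P.oneFormAlong e.2.2.1 (P.baseVec W) + P.oneFormAlong e'.2.2.1 (P.baseVec W)
          rw [oneFormAlong_baseVec, oneFormAlong_baseVec, oneFormAlong_baseVec,
            LinearMap.add_apply, map_add]) (map_add P.pullFun _ _)
      map_smul' := fun r e => Subtype.ext <| P.quad_ext (fun _ => map_smul P.pullFun _ _)
        (map_smul P.pullFun _ _) (fun W => by
          change P.oneFormAlong (r • e.2.2.1) (P.baseVec W) =
            r • P.oneFormAlong e.2.2.1 (P.baseVec W)
          rw [oneFormAlong_baseVec, oneFormAlong_baseVec, LinearMap.smul_apply, map_smul])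
        (map_smul P.pullFun _ _) }
    ⟨fun _ _ h => P.baseQuad_injective (congrArg Subtype.val h), fun c =>
      (P.exists_baseQuad_eq c.2).imp fun _ h => Subtype.ext h⟩

variable {P}

theorem assemble_mem_invariantSec_iff (A : P.Connection) (c : P.Quad) :
    assemble A c ∈ P.invariantSec ↔ c ∈ P.weightSec 0 := by
  rw [← isWeightNeg_assemble_iff A 0 c, IsWeightNeg, Int.cast_zero, mul_zero, neg_zero, zero_smul]
  rfl

theorem exists_assemble_eq (A : P.Connection) (a : GenSection F Z) : ∃ c, assemble A c = a :=
  (assembleEquiv A).surjective a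

theorem bijOn_assemble_baseQuad (A : P.Connection) :
    Set.BijOn (fun e => assemble A (P.baseQuad e)) Set.univ (P.invariantSec : Set _) := by
  refine ⟨fun e _ => (assemble_mem_invariantSec_iff A _).2 (P.baseQuad_mem e),
    ((assembleEquiv A).injective.comp P.baseQuad_injective).injOn, fun a ha => ?_⟩
  obtain ⟨c, rfl⟩ := exists_assemble_eq A a
  obtain ⟨e, rfl⟩ := P.exists_baseQuad_eq ((assemble_mem_invariantSec_iff A c).1 ha)
  exact ⟨e, Set.mem_univ _, rfl⟩

/-- Sections of weight zero are the invariant sections of `TZ ⊕ T*Z`. -/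
def invariantEquiv (A : P.Connection) : P.weightSec 0 ≃ₗ[ℂ] P.invariantSec :=
  LinearEquiv.ofSubmodules (assembleEquiv A) _ _ (by
    ext a
    obtain ⟨c, rfl⟩ := exists_assemble_eq A a
    rw [assemble_mem_invariantSec_iff, Submodule.mem_map]
    exact ⟨fun ⟨d, hd, hdc⟩ => (assembleEquiv A).injective hdc ▸ hd, fun hc => ⟨c, hc, rfl⟩⟩)

theorem invariantEquiv_coe (A : P.Connection) (c : P.weightSec 0) :
    (invariantEquiv A c).1 = assemble A c.1 := rfl

/-- The fibrewise map `(X, f, ξ, g) ↦ -(X, g, ξ, f)` as a linear equivalence. -/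
def negSwapEquiv (P : CircleBundle E F M Z) : P.Quad ≃ₗ[ℂ] P.Quad where
  toFun := P.negSwap
  map_add' c d := P.quad_ext (fun h => neg_add (c.1.1 h) (d.1.1 h)) (neg_add c.2.2.2 d.2.2.2)
    (fun W => neg_add (c.2.2.1 (P.baseVec W)) (d.2.2.1 (P.baseVec W))) (neg_add c.2.1 d.2.1)
  map_smul' r c := P.quad_ext (fun h => (smul_neg r (c.1.1 h)).symm) (smul_neg r c.2.2.2).symm
    (fun W => (smul_neg r (c.2.2.1 (P.baseVec W))).symm) (smul_neg r c.2.1).symm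
  invFun := P.negSwap
  left_inv c := Prod.ext (neg_neg c.1) (Prod.ext (neg_neg c.2.1)
    (Prod.ext (neg_neg c.2.2.1) (neg_neg c.2.2.2)))
  right_inv c := Prod.ext (neg_neg c.1) (Prod.ext (neg_neg c.2.1)
    (Prod.ext (neg_neg c.2.2.1) (neg_neg c.2.2.2)))

theorem negSwap_eq_zero {c : P.Quad} : P.negSwap c = 0 ↔ c = 0 := by
  change P.negSwapEquiv c = 0 ↔ c = 0
  exact P.negSwapEquiv.map_eq_zero_iff

theorem negSwap_mem {n : ℤ} {c : P.Quad} (hc : c ∈ P.weightSec n) :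
    P.negSwap c ∈ P.weightSec n :=
  ⟨fun h => neg_mem (hc.1 h), neg_mem hc.2.2.2, fun W => neg_mem (hc.2.2.1 W), neg_mem hc.2.1⟩

theorem compQuad_negSwap (n : ℤ) (c : P.Quad) :
    P.compQuad n (P.negSwap c) = P.negSwap (P.compQuad n c) :=
  map_neg (P.compQuad n) _

theorem compQuad_injective {c d : P.Quad} (h : ∀ n, P.compQuad n c = P.compQuad n d) : c = d :=
  P.quadDecomposition.injective (Subtype.ext (funext h))

theorem mem_weightSec_iff {n : ℤ} {c : P.Quad} :
    c ∈ P.weightSec n ↔ ∀ m, m ≠ n → P.compQuad m c = 0 := by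
  refine ⟨fun hc m hm => by rw [P.compQuad_of_mem hc, if_neg hm], fun h => ?_⟩
  have h1 : P.compQuad n c = c := compQuad_injective fun m => by
    rw [P.compQuad_of_mem (P.compQuad_mem n c)]
    split_ifs with hm
    · rw [hm]
    · rw [h m hm]
  rw [← h1]
  exact P.compQuad_mem n c

/-- The pairing of quadruples is the pairing of sections of `TZ ⊕ T*Z`, also after the swap. -/
theorem quadPairing_negSwap (A : P.Connection) (c d : P.Quad) :
    P.quadPairing (P.negSwap c) (P.negSwap d) = stdPairing (assemble A c) (assemble A d) := by
  rw [stdPairing, assemble_snd_apply, assemble_snd_apply, push_assemble, push_assemble,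
    form_assemble, form_assemble]
  change -d.2.2.1 (-c.1) + -c.2.2.1 (-d.1) + -c.2.1 * -d.2.2.2 + -c.2.2.2 * -d.2.1 = _
  have h1 : ∀ (ζ : Module.Dual (SmoothFun F Z) P.VecAlong) (X : P.VecAlong), ζ (-X) = -ζ X :=
    fun ζ X => LinearMap.map_neg ζ X
  rw [h1, h1]
  ring

end CircleBundle

open CircleBundle

/-! ### The duality map and its compatibilities. -/

namespace TDualPair

variable {E : Type*} [NormedAddCommGroup E] [NormedSpace ℝ E] [FiniteDimensional ℝ E]
  {M : Type*} [TopologicalSpace M] [ChartedSpace E M] [IsManifold 𝓘(ℝ, E) ∞ M] [T2Space M]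
  {F : Type*} [NormedAddCommGroup F] [NormedSpace ℝ F] [FiniteDimensional ℝ F]
  {Z : Type*} [TopologicalSpace Z] [ChartedSpace F Z] [IsManifold 𝓘(ℝ, F) ∞ Z] [T2Space Z]
  [MulAction Circle Z]
  {F' : Type*} [NormedAddCommGroup F'] [NormedSpace ℝ F']
  {Z' : Type*} [TopologicalSpace Z'] [ChartedSpace F' Z'] [IsManifold 𝓘(ℝ, F') ∞ Z']
  [MulAction Circle Z'] {P : CircleBundle E F M Z} {P' : CircleBundle E F' M Z'}
  (T : TDualPair P P')

/-- The decomposition of sections of `TZ ⊕ T*Z` into weight components. -/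
def decomposition : GenSection F Z ≃ₗ[ℂ] P.quadSum :=
  (assembleEquiv T.conn).symm ≪≫ₗ P.quadDecomposition

/-- The T-duality map. -/
def duality : GenSection F Z ≃ₗ[ℂ] P.quadSum :=
  (assembleEquiv T.conn).symm ≪≫ₗ P.negSwapEquiv ≪≫ₗ P.quadDecomposition

theorem decomposition_apply (a : GenSection F Z) (n : ℤ) :
    (T.decomposition a).1 n = P.compQuad n ((assembleEquiv T.conn).symm a) := rfl

theorem duality_eq (a : GenSection F Z) (n : ℤ) :
    (T.duality a).1 n = P.negSwap (P.compQuad n ((assembleEquiv T.conn).symm a)) := by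
  rw [← compQuad_negSwap]
  rfl

theorem duality_apply (a : GenSection F Z) (n : ℤ) :
    (T.duality a).1 n = P.negSwap ((T.decomposition a).1 n) := by
  rw [duality_eq, decomposition_apply]

theorem duality_assemble (c : P.Quad) (n : ℤ) :
    (T.duality (assemble T.conn c)).1 n = P.negSwap (P.compQuad n c) := by
  rw [duality_eq, ← assembleEquiv_apply, LinearEquiv.symm_apply_apply]

theorem isDecomposition : T.IsDecomposition T.decomposition.toLinearMap := fun a n z => by
  rw [LinearEquiv.coe_coe, decomposition_apply, assembleEquiv_symm_apply, compQuad_apply]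
  refine ⟨fun _ => P.comp_apply n _ z, P.comp_apply n _ z, fun W => ?_, P.comp_apply n _ z⟩
  rw [P.compDual_baseVec]
  exact P.comp_apply n _ z

theorem duality_assemble_of_mem {n : ℤ} {c : P.Quad} (hc : c ∈ P.weightSec n) :
    (T.duality (assemble T.conn c)).1 = Pi.single n (P.negSwap c) := by
  funext m
  rw [duality_assemble, P.compQuad_of_mem hc]
  split_ifs with hm
  · subst hm
    rw [Pi.single_eq_same]
  · rw [Pi.single_eq_of_ne hm]
    exact negSwap_eq_zero.2 rfl

theorem isWeightNeg_iff (n : ℤ) (a : GenSection F Z) :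
    P.IsWeightNeg n a ↔ ∀ m, m ≠ n → (T.duality a).1 m = 0 := by
  obtain ⟨c, rfl⟩ := exists_assemble_eq T.conn a
  rw [isWeightNeg_assemble_iff, mem_weightSec_iff]
  refine forall₂_congr fun m _ => ?_
  rw [duality_assemble, negSwap_eq_zero]

theorem isExoticBracket_duality (a b : GenSection F Z) :
    T.IsExoticBracket (T.duality a) (T.duality b) (T.duality (dorfman T.flux a b)) := by
  obtain ⟨c, rfl⟩ := exists_assemble_eq T.conn a
  obtain ⟨d, rfl⟩ := exists_assemble_eq T.conn b
  refine ⟨fun n m => P.negSwap (T.quadDorfman (P.compQuad n c) (P.compQuad m d)), fun n m => ?_,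
    fun p => ?_⟩
  · rw [duality_assemble, duality_assemble]
    exact ⟨negSwap_mem (T.quadDorfman_mem (P.compQuad_mem n c) (P.compQuad_mem m d)),
      T.isWeightBracket_negSwap (P.compQuad_mem n c) (P.compQuad_mem m d)⟩
  · have h1 : dorfman T.flux (assemble T.conn c) (assemble T.conn d) =
        assemble T.conn (T.quadDorfman c d) :=
      ((assembleEquiv T.conn).apply_symm_apply _).symm
    rw [h1, duality_assemble]
    exact ((T.isQuadConvolution_dorfman c d).quadHasSum p).negSwap

theorem IsExoticBracket.unique {s t c d : P.quadSum} (hc : T.IsExoticBracket s t c)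
    (hd : T.IsExoticBracket s t d) : c = d := by
  obtain ⟨b, hb, hc⟩ := hc
  obtain ⟨b', hb', hd⟩ := hd
  have h1 : b = b' := funext₂ fun n m => IsWeightBracket.unique T (hb n m).2 (hb' n m).2
  subst h1
  exact Subtype.ext (funext fun p => (hc p).unique (hd p))

theorem isExoticPairing_duality (a b : GenSection F Z) :
    T.IsExoticPairing (T.duality a) (T.duality b) (P.funDecomposition (stdPairing a b)) := by
  obtain ⟨c, rfl⟩ := exists_assemble_eq T.conn a
  obtain ⟨d, rfl⟩ := exists_assemble_eq T.conn b
  intro p z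
  have h1 := ((isConvolution_form T.conn (assemble T.conn c).2 (assemble T.conn d).1).add
    (isConvolution_form T.conn (assemble T.conn d).2 (assemble T.conn c).1).flip) p z
  simp only [duality_assemble, quadPairing_negSwap T.conn, assemble_compQuad_eq]
  exact h1

theorem exoticD_eq (n : ℤ) (h : SmoothFun F Z) :
    T.exoticD n h = (-0, -(weightConst n • h), -nabla T.conn h, -0) := by
  rw [weightConst, neg_smul]
  rfl

/-- The covariant derivative supplies the horizontal action, and the other entry of `exoticD` is the
eigenvalue by which the generator acts on `h`; the signs of the swap and of the operator cancel. -/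
theorem quadPairing_exoticD (c : P.Quad) {n : ℤ} {h : SmoothFun F Z} (hh : h ∈ P.lineSec n) :
    P.quadPairing (P.negSwap c) (T.exoticD n h) = (assemble T.conn c).1 h := by
  rw [exoticD_eq, assemble_fst_apply, P.mem_lineSec_iff.1 hh]
  change -(horLift T.conn (-c.1) h) + -c.2.2.1 (-0) + -c.2.1 * (-(weightConst n • h)) +
    -c.2.2.2 * -0 = _
  have h1 : ∀ (ζ : Module.Dual (SmoothFun F Z) P.VecAlong) (X : P.VecAlong), ζ (-X) = -ζ X :=
    fun ζ X => LinearMap.map_neg ζ X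
  have h2 : horLift T.conn (-c.1) = -horLift T.conn c.1 := map_neg (horLift T.conn) c.1
  rw [h1, h2, map_zero, Derivation.neg_apply, Algebra.smul_def]
  ring

theorem isExoticAnchor_duality (a : GenSection F Z) (h : SmoothFun F Z) :
    T.IsExoticAnchor (T.duality a) (P.funDecomposition h) (P.funDecomposition (a.1 h)) := by
  obtain ⟨c, rfl⟩ := exists_assemble_eq T.conn a
  intro p z
  have h1 := isConvolution_apply T.conn (assemble T.conn c).1 h p z
  simp only [duality_assemble, P.funDecomposition_apply, T.quadPairing_exoticD _ (P.comp_mem _ h),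
    assemble_compQuad_eq]
  exact h1

theorem duality_dFun (h : SmoothFun F Z) (n : ℤ) :
    (T.duality (0, dFun h)).1 n = T.exoticD n ((P.funDecomposition h).1 n) := by
  rw [duality_eq, exoticD_eq, assembleEquiv_symm_apply, compQuad_apply]
  refine P.quad_ext (fun k => ?_) ?_ (fun W => ?_) ?_
  · exact congrArg Neg.neg (map_zero (P.comp n))
  -- The coefficient of the connection form in dh is the derivative along the generator. The swap
  -- moves it to the vector slot, where `comp_generator` produces the weight.
  · change -P.comp n (P.generator h) = -(weightConst n • P.comp n h)
    rw [P.comp_generator]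
  · change -P.compDual n (dFun h ∘ₗ horLift T.conn) (P.baseVec W) =
      -(horLift T.conn (P.baseVec W) (P.comp n h))
    rw [P.compDual_baseVec, ← P.comp_apply_of_invariant
      (isInvariantField_horLift T.conn W).lie_generator]
    rfl
  · change -P.comp n (T.conn.form 0) = -0
    rw [map_zero, map_zero]

end TDualPair

section Base

variable {E : Type*} [NormedAddCommGroup E] [NormedSpace ℝ E]
  {M : Type*} [TopologicalSpace M] [ChartedSpace E M]

/-- `(X, f, ξ, g) ↦ (X, g, ξ, f)` on sections over `M` as a linear equivalence. -/
def swapBaseEquiv : BaseQuad E M ≃ₗ[ℂ] BaseQuad E M where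
  toFun := swapBase
  map_add' _ _ := rfl
  map_smul' _ _ := rfl
  invFun := swapBase
  left_inv _ := rfl
  right_inv _ := rfl

end Base

end ExoticTDuality

end

end

/-! ### Assembly of the theorem. -/

open scoped Manifold ContDiff in
open ExoticTDuality CircleBundle in
theorem theorem3p1
    {E : Type*} [NormedAddCommGroup E] [NormedSpace ℝ E] [FiniteDimensional ℝ E]
    {M : Type*} [TopologicalSpace M] [ChartedSpace E M] [IsManifold 𝓘(ℝ, E) ∞ M]
    [T2Space M] [SigmaCompactSpace M]
    {F : Type*} [NormedAddCommGroup F] [NormedSpace ℝ F] [FiniteDimensional ℝ F]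
    {Z : Type*} [TopologicalSpace Z] [ChartedSpace F Z] [IsManifold 𝓘(ℝ, F) ∞ Z]
    [T2Space Z] [SigmaCompactSpace Z] [MulAction Circle Z]
    {F' : Type*} [NormedAddCommGroup F'] [NormedSpace ℝ F'] [FiniteDimensional ℝ F']
    {Z' : Type*} [TopologicalSpace Z'] [ChartedSpace F' Z'] [IsManifold 𝓘(ℝ, F') ∞ Z']
    [T2Space Z'] [SigmaCompactSpace Z'] [MulAction Circle Z']
    (P : CircleBundle E F M Z) (P' : CircleBundle E F' M Z') (T : TDualPair P P') :
    ∃ (Φ : SmoothFun F Z ≃ₗ[ℂ] P.lineSum)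
      (Φ' μ : GenSection F Z ≃ₗ[ℂ] P.quadSum),
      T.IsFunDecomposition Φ.toLinearMap ∧
      T.IsDecomposition Φ'.toLinearMap ∧
      (∀ a n, (μ a).1 n = P.negSwap ((Φ' a).1 n)) ∧
      (∀ (n : ℤ), ∀ c ∈ P.weightSec n,
        (μ (assemble T.conn c)).1 = Pi.single n (P.negSwap c)) ∧
      (∀ (n : ℤ) (a : GenSection F Z), P.IsWeightNeg n a ↔ ∀ m, m ≠ n → (μ a).1 m = 0) ∧
      (∀ s t : P.quadSum, ∃! c : P.quadSum, T.IsExoticBracket s t c) ∧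
      (∀ s t : P.quadSum, ∃! u : P.lineSum, T.IsExoticPairing s t u) ∧
      (∀ (s : P.quadSum) (u : P.lineSum), ∃! w : P.lineSum, T.IsExoticAnchor s u w) ∧
      (∀ a b, T.IsExoticBracket (μ a) (μ b) (μ (dorfman T.flux a b))) ∧
      (∀ a b, T.IsExoticPairing (μ a) (μ b) (Φ (stdPairing a b))) ∧
      (∀ (a : GenSection F Z) (h : SmoothFun F Z),
        T.IsExoticAnchor (μ a) (Φ h) (Φ (a.1 h))) ∧
      (∀ (h : SmoothFun F Z) (n : ℤ), (μ (0, dFun h)).1 n = T.exoticD n ((Φ h).1 n)) ∧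
      Set.BijOn (fun e => assemble T.conn (P.baseQuad e)) Set.univ (P.invariantSec : Set _) ∧
      Set.BijOn P.baseQuad Set.univ (P.weightSec 0 : Set P.Quad) ∧
      ∃ (χ : P.invariantSec ≃ₗ[ℂ] P'.invariantSec) (ψ : P.weightSec 0 ≃ₗ[ℂ] P'.invariantSec),
        T.IsCavalcantiGualtieri χ.toLinearMap ∧
        T.IsWeightZeroIdentification ψ.toLinearMap ∧
        ∀ (a : P.invariantSec) (c : P.weightSec 0), c.1 = (μ a.1).1 0 → ψ c = -χ a := by
  -- Both maps pass through sections over M, with which weight zero on either side is identified;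
  -- only `χ` includes the swap.
  let ψ : P.weightSec 0 ≃ₗ[ℂ] P'.invariantSec :=
    P.baseQuadEquiv.symm ≪≫ₗ P'.baseQuadEquiv ≪≫ₗ invariantEquiv T.conn'
  let χ : P.invariantSec ≃ₗ[ℂ] P'.invariantSec :=
    (invariantEquiv T.conn).symm ≪≫ₗ P.baseQuadEquiv.symm ≪≫ₗ swapBaseEquiv ≪≫ₗ
      P'.baseQuadEquiv ≪≫ₗ invariantEquiv T.conn'
  have hψ : ∀ e, ψ (P.baseQuadEquiv e) = invariantEquiv T.conn' (P'.baseQuadEquiv e) := fun e => by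
    simp [ψ]
  have hχ : ∀ e, χ (invariantEquiv T.conn (P.baseQuadEquiv e)) =
      invariantEquiv T.conn' (P'.baseQuadEquiv (swapBase e)) := fun e => by
    simp only [χ, LinearEquiv.trans_apply, LinearEquiv.symm_apply_apply]
    rfl
  refine ⟨P.funDecomposition, T.decomposition, T.duality, fun h n z => P.comp_apply n h z,
    T.isDecomposition, T.duality_apply, fun n c hc => T.duality_assemble_of_mem hc,
    T.isWeightNeg_iff, fun s t => ?_, fun s t => ?_, fun s u => ?_, T.isExoticBracket_duality,
    T.isExoticPairing_duality, T.isExoticAnchor_duality, T.duality_dFun,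
    bijOn_assemble_baseQuad T.conn, P.bijOn_baseQuad, χ, ψ, fun e a ha => ?_, fun e c hc => ?_,
    fun a c hc => ?_⟩
  -- Existence in the completion is transported from `Z`: every completed section is a dual of an
  -- honest one, so the convolution sums converge without a direct estimate.
  · obtain ⟨a, rfl⟩ := T.duality.surjective s
    obtain ⟨b, rfl⟩ := T.duality.surjective t
    exact ⟨_, T.isExoticBracket_duality a b, fun c hc =>
      TDualPair.IsExoticBracket.unique T hc (T.isExoticBracket_duality a b)⟩
  · obtain ⟨a, rfl⟩ := T.duality.surjective s
    obtain ⟨b, rfl⟩ := T.duality.surjective t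
    exact ⟨_, T.isExoticPairing_duality a b, fun u hu => Subtype.ext <| funext fun p =>
      SmoothFun.ext' fun z => (hu p z).unique (T.isExoticPairing_duality a b p z)⟩
  · obtain ⟨a, rfl⟩ := T.duality.surjective s
    obtain ⟨h, rfl⟩ := P.funDecomposition.surjective u
    exact ⟨_, T.isExoticAnchor_duality a h, fun u hu => Subtype.ext <| funext fun p =>
      SmoothFun.ext' fun z => (hu p z).unique (T.isExoticAnchor_duality a h p z)⟩
  · have h1 : a = invariantEquiv T.conn (P.baseQuadEquiv e) := Subtype.ext ha
    subst h1
    exact congrArg Subtype.val (hχ e)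
  · have h1 : c = P.baseQuadEquiv e := Subtype.ext hc
    subst h1
    exact congrArg Subtype.val (hψ e)
  · obtain ⟨d, rfl⟩ := (invariantEquiv T.conn).surjective a
    obtain ⟨e, rfl⟩ := P.baseQuadEquiv.surjective d
    -- An invariant section has only the component of weight zero, where the duality is minus the
    -- swap over M.
    have h1 : c = (-1 : ℂ) • P.baseQuadEquiv (swapBase e) := by
      refine Subtype.ext (hc.trans ?_)
      rw [invariantEquiv_coe, T.duality_assemble, P.compQuad_of_mem (P.baseQuadEquiv e).2,
        if_pos rfl]
      change P.negSwap (P.baseQuad e) = (-1 : ℂ) • P.baseQuad (swapBase e)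
      exact P.quad_ext (fun h => (neg_one_smul ℂ _).symm) (neg_one_smul ℂ _).symm
        (fun W => (neg_one_smul ℂ _).symm) (neg_one_smul ℂ _).symm
    rw [h1, map_smul, hψ, hχ]
    exact Subtype.ext (Prod.ext (neg_one_smul ℂ _) (LinearMap.ext fun w => neg_one_smul ℂ _))
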